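/- Let $X$ be a compact complex manifold of dimension $n$ and let $\omega$ be an SKT metric on $X$, i.e. a $C^\infty$ positive definite real $(1,1)$-form with $\partial\bar\partial\omega=0$. Let $\langle\langle\cdot,\cdot\rangle\rangle$ be the $L^2$ inner product defined by $\omega$ on smooth complex-valued differential forms on $X$; $P^\star$ denotes the formal adjoint of an operator $P$ with respect to it (all the formal adjoints below exist). For graded operators $A,B$ of degrees $a,b$ put $[A,B]=AB-(-1)^{ab}BA$, and write $A\geq B$ if $\langle\langle Au,u\rangle\rangle\geq\langle\langle Bu,u\rangle\rangle$ for all smooth forms $u$. Let $$\Delta'=[\partial,\partial^\star],\quad \Delta''=[\bar\partial,\bar\partial^\star],\quad \Delta=[d,d^\star],\quad \Delta_h=[d_h,d_h^\star]\ \text{ with } d_h=h\partial+\bar\partial .$$ Let $\Lambda_\omega=(\omega\wedge\cdot)^\star$, let $\tau=[\Lambda_\omega,\partial\omega\wedge\cdot]$ be the torsion operator, $\bar\tau$ its complex conjugate, and $\overline{X}_\omega=[\bar\partial\omega\wedge\cdot,(\bar\partial\omega\wedge\cdot)^\star]$. Then, on differential forms of all (bi)degrees: (i) for every $\delta>0$,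 $$(1+\delta)\,\Delta''+\Big(1+\frac1\delta\Big)[\bar\tau,\bar\tau^\star]\ \geq\ \Delta'\ \geq\ \frac1{1+\delta}\,\Delta''-\frac1\delta\,[\tau,\tau^\star];$$ (ii) for every $0<h<1$, $$\Delta''\ \geq\ h\,\Delta'+\Big(h\,\overline{X}_\omega-\frac{h}{1-h}\,[\bar\tau,\bar\tau^\star]\Big)\qquad\text{and}\qquad \Delta_h-h\Delta\ \geq\ h\Big((1-h)\,\overline{X}_\omega-[\bar\tau,\bar\tau^\star]\Big).$$ Moreover, the operators $\overline{X}_\omega$ and $[\bar\tau,\bar\tau^\star]$ are bounded in the $L^2$ norm, and there is a constant $C>0$, independent of $h$, such that for all $0<h<1$ $$h\Big((1-h)\,\overline{X}_\omega-[\bar\tau,\bar\tau^\star]\Big)\ \geq\ -Ch,\qquad\text{hence}\qquad \Delta_h-h\Delta\geq -Ch .$$ -/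

import Mathlib

open scoped ContDiff Manifold ComplexOrder

namespace HermitianForms

noncomputable section

/-! ### Complex-valued alternating forms on the real vector space `ℂⁿ` -/

/-- The model space `ℂⁿ`. -/
abbrev Cn (n : ℕ) : Type := Fin n → ℂ

/-- Complex-valued, real-multilinear alternating `k`-forms on `ℂⁿ`. -/
abbrev Alt (n k : ℕ) : Type := Cn n [⋀^Fin k]→L[ℝ] ℂ

/-- The tensor product `a ⊗ b` : `v ↦ a (v₁, …, v_p) * b (v_{p+1}, …, v_{p+q})`. -/
def tensor {n p q m : ℕ} (hm : p + q = m) (a : Alt n p) (b : Alt n q) :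
    ContinuousMultilinearMap ℝ (fun _ : Fin m => Cn n) ℂ where
  toFun v := a (fun i => v (Fin.cast hm (Fin.castAdd q i))) *
    b (fun j => v (Fin.cast hm (Fin.natAdd p j)))
  map_update_add' := by
    intro _ v i x y
    have h := (((LinearMap.mul' ℝ ℂ).compMultilinearMap
      (MultilinearMap.domCoprod a.toMultilinearMap b.toMultilinearMap)).domDomCongr
        (finSumFinEquiv.trans (finCongr hm))).map_update_add v i x y
    convert h using 1 <;> congr! 1
  map_update_smul' := by
    intro _ v i c x
    have h := (((LinearMap.mul' ℝ ℂ).compMultilinearMap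
      (MultilinearMap.domCoprod a.toMultilinearMap b.toMultilinearMap)).domDomCongr
        (finSumFinEquiv.trans (finCongr hm))).map_update_smul v i c x
    convert h using 1 <;> congr! 1
  cont := by
    refine Continuous.mul (a.cont.comp ?_) (b.cont.comp ?_) <;> fun_prop

theorem tensor_apply {n p q m : ℕ} (hm : p + q = m) (a : Alt n p) (b : Alt n q)
    (v : Fin m → Cn n) :
    tensor hm a b v = a (fun i => v (Fin.cast hm (Fin.castAdd q i))) *
      b (fun j => v (Fin.cast hm (Fin.natAdd p j))) := rfl

/-- The wedge product of a `p`-form and a `q`-form: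
`(a ∧ b)(v₁, …, v_{p+q}) = (p! q!)⁻¹ ∑_σ sign σ · a (v_{σ 1}, …, v_{σ p}) · b (v_{σ (p+1)}, …)`. -/
def wedge {n p q m : ℕ} (hm : p + q = m) (a : Alt n p) (b : Alt n q) : Alt n m :=
  ((p.factorial * q.factorial : ℝ)⁻¹) • ContinuousMultilinearMap.alternatization (tensor hm a b)

/-- The real basis `∂/∂x_j`, `∂/∂y_j` of `ℂⁿ`. -/
def realBasis (n : ℕ) : Fin n ⊕ Fin n → Cn n :=
  Sum.elim (fun j => Pi.single j 1) (fun j => Pi.single j Complex.I)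

/-- The Gram matrix, in the real basis, of the bilinear form `g (v, w) = w₀ (v, i w)` attached to a
2-form `w₀` (the Riemannian metric, when `w₀` is a positive real `(1,1)`-form). -/
def gramMatrix {n : ℕ} (w₀ : Alt n 2) : Matrix (Fin n ⊕ Fin n) (Fin n ⊕ Fin n) ℝ :=
  Matrix.of fun s t => (w₀ ![realBasis n s, Complex.I • realBasis n t]).re

/-- The inner product induced by the metric `g` on `k`-forms, extended sesquilinearly:
`⟨a, b⟩ = (1 / k!) ∑ g^{s₁ t₁} ⋯ g^{s_k t_k} a_{s₁ … s_k} conj b_{t₁ … t_k}`. It is linear in `a`,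
and the `k`-fold wedge products of a `g`-orthonormal coframe are orthonormal. -/
def fibreInner {n k : ℕ} (w₀ : Alt n 2) (a b : Alt n k) : ℂ :=
  ((k.factorial : ℂ)⁻¹) * ∑ s : Fin k → Fin n ⊕ Fin n, ∑ t : Fin k → Fin n ⊕ Fin n,
    (∏ i, (((gramMatrix w₀)⁻¹ (s i) (t i) : ℝ) : ℂ)) *
      a (fun i => realBasis n (s i)) * (starRingEnd ℂ) (b (fun i => realBasis n (t i)))

/-- The complex conjugate of a form. -/
def conjAlt {n k : ℕ} (a : Alt n k) : Alt n k :=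
  (Complex.conjCLE : ℂ →L[ℝ] ℂ).compContinuousAlternatingMap a

/-! ### Forms and their derivatives on a domain of `ℂⁿ` -/

/-- The `ℂ`-linear part `v ↦ (T v - i T (i v)) / 2` of a real-linear map. -/
def linPart {n k : ℕ} (T : Cn n →L[ℝ] Alt n k) : Cn n →L[ℝ] Alt n k :=
  (1 / 2 : ℂ) • (T - Complex.I • T.comp (Complex.I • ContinuousLinearMap.id ℝ (Cn n)))

/-- The `ℂ`-antilinear part `v ↦ (T v + i T (i v)) / 2` of a real-linear map. -/
def antilinPart {n k : ℕ} (T : Cn n →L[ℝ] Alt n k) : Cn n →L[ℝ] Alt n k :=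
  (1 / 2 : ℂ) • (T + Complex.I • T.comp (Complex.I • ContinuousLinearMap.id ℝ (Cn n)))

/-- `∂ u = ∑_j dz_j ∧ ∂u/∂z_j` on `ℂⁿ`, where `∂/∂z_j` acts on the coefficients of `u`. It is the
exterior derivative with the differential of the coefficients replaced by its `ℂ`-linear part. -/
def delFlat {n k : ℕ} (u : Cn n → Alt n k) (y : Cn n) : Alt n (k + 1) :=
  ContinuousAlternatingMap.alternatizeUncurryFin (linPart (fderiv ℝ u y))

/-- `∂̄ u = ∑_j dz̄_j ∧ ∂u/∂z̄_j` on `ℂⁿ`. -/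
def delbarFlat {n k : ℕ} (u : Cn n → Alt n k) (y : Cn n) : Alt n (k + 1) :=
  ContinuousAlternatingMap.alternatizeUncurryFin (antilinPart (fderiv ℝ u y))

/-! ### Differential forms on a complex manifold

As in Mathlib's `TangentSpace`, the tangent space of `X` at `x` is `ℂⁿ`, through the preferred chart
at `x`. -/

/-- Complex-valued `k`-forms on `X`, not necessarily smooth. -/
abbrev HForm (n k : ℕ) (X : Type*) : Type _ := X → Alt n k

/-- Complex-valued forms on `X` of mixed degree: a form of each degree `k` (those of degree `> 2n`
vanish). -/
abbrev Form (n : ℕ) (X : Type*) : Type _ := ∀ k : ℕ, HForm n k X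

/-- Operators on forms. -/
abbrev Op (n : ℕ) (X : Type*) : Type _ := Form n X → Form n X

variable {n : ℕ} {X : Type*} [TopologicalSpace X] [ChartedSpace (Cn n) X]

/-- The differential at `y` of the inverse `φ⁻¹` of the preferred chart `φ` at `c`, as a map from `ℂⁿ`
to the tangent space of `X` at `x = φ⁻¹ y`. Since that space is `ℂⁿ` through the preferred chart
`φ_x` at `x`, this is the differential of the transition map `φ_x ∘ φ⁻¹` at `y`. -/
def chartSymmDeriv (c : X) (y : Cn n) : Cn n →L[ℂ] Cn n :=
  fderiv ℂ (extChartAt 𝓘(ℂ, Cn n) ((extChartAt 𝓘(ℂ, Cn n) c).symm y) ∘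
    (extChartAt 𝓘(ℂ, Cn n) c).symm) y

/-- The expression of the form `α` in the preferred chart `φ` at `c`: the pull-back `(φ⁻¹)^* α`
(meaningful on the target of `φ`). -/
def localRep {k : ℕ} (c : X) (α : HForm n k X) (y : Cn n) : Alt n k :=
  (α ((extChartAt 𝓘(ℂ, Cn n) c).symm y)).compContinuousLinearMap
    ((chartSymmDeriv c y).restrictScalars ℝ)

/-- A `k`-form is `C^∞` if its expression in every chart is. -/
def IsSmoothH {k : ℕ} (α : HForm n k X) : Prop :=
  ∀ c : X, ContDiffOn ℝ ∞ (localRep c α) (extChartAt 𝓘(ℂ, Cn n) c).target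

/-- A form of mixed degree is `C^∞` if all its components are. -/
def IsSmooth (u : Form n X) : Prop := ∀ k, IsSmoothH (u k)

/-- `∂` on `k`-forms, computed at each point in the chart at that point. -/
def del {k : ℕ} (α : HForm n k X) : HForm n (k + 1) X :=
  fun x => delFlat (localRep x α) (extChartAt 𝓘(ℂ, Cn n) x x)

/-- `∂̄` on `k`-forms. -/
def delbar {k : ℕ} (α : HForm n k X) : HForm n (k + 1) X :=
  fun x => delbarFlat (localRep x α) (extChartAt 𝓘(ℂ, Cn n) x x)

/-- The exterior derivative `d` on `k`-forms. -/
def extD {k : ℕ} (α : HForm n k X) : HForm n (k + 1) X :=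
  fun x => extDeriv (localRep x α) (extChartAt 𝓘(ℂ, Cn n) x x)

/-- `∂` as an operator on forms of all degrees. -/
def delOp : Op n X
  | _, 0 => 0
  | u, k + 1 => del (u k)

/-- `∂̄` as an operator on forms of all degrees. -/
def delbarOp : Op n X
  | _, 0 => 0
  | u, k + 1 => delbar (u k)

/-- `d` as an operator on forms of all degrees. -/
def dOp : Op n X
  | _, 0 => 0
  | u, k + 1 => extD (u k)

/-- The operator `α ∧ ·` of multiplication by a `p`-form `α`. -/
def wedgeOp {X : Type*} {p : ℕ} (α : HForm n p X) : Op n X := fun u m x =>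
  if hp : p ≤ m then wedge (Nat.add_sub_of_le hp) (α x) (u (m - p) x) else 0

/-- The complex conjugate of a form. -/
def conjForm {X : Type*} (u : Form n X) : Form n X := fun k x => conjAlt (u k x)

/-- The complex conjugate `u ↦ conj (A (conj u))` of an operator. -/
def conjOp {X : Type*} (A : Op n X) : Op n X := fun u => conjForm (A (conjForm u))

/-- The graded commutator `[A, B] = A B - (-1)^{ab} B A` of operators of degrees `a` and `b`. -/
def gcomm {X : Type*} (a b : ℤ) (A B : Op n X) : Op n X :=
  fun u => A (B u) - ((-1 : ℝ) ^ (a * b)) • B (A u)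

/-! ### Hermitian metrics, the `L²` inner product and formal adjoints -/

/-- A Hermitian metric, given by its fundamental form: a `C^∞`, real, positive definite
`(1,1)`-form. -/
structure IsHermitianMetric (ω₀ : HForm n 2 X) : Prop where
  smooth : IsSmoothH ω₀
  real : ∀ x v w, (ω₀ x ![v, w]).im = 0
  type_one_one : ∀ x v w, ω₀ x ![Complex.I • v, Complex.I • w] = ω₀ x ![v, w]
  pos : ∀ x v, v ≠ 0 → 0 < (ω₀ x ![v, Complex.I • v]).re

/-- An SKT metric: a Hermitian metric with `∂ ∂̄ ω = 0`. -/
def IsSKT (ω₀ : HForm n 2 X) : Prop := IsHermitianMetric ω₀ ∧ del (delbar ω₀) = 0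

variable [MeasurableSpace X]

/-- The Riemannian volume measure on the domain of the chart at `c`: in that chart it has density
`√(det g)` with respect to Lebesgue measure. -/
def chartVolume (ω₀ : HForm n 2 X) (c : X) : MeasureTheory.Measure X :=
  ((MeasureTheory.volume.restrict (extChartAt 𝓘(ℂ, Cn n) c).target).withDensity
    (fun y => ENNReal.ofReal (Real.sqrt (gramMatrix (localRep c ω₀ y)).det))).map
      (extChartAt 𝓘(ℂ, Cn n) c).symm

/-- The Riemannian volume measure `dV_ω = ωⁿ / n!` of `X`. The measures `chartVolume ω c` agree on
overlaps of charts, and their supremum is the measure that restricts to each of them. -/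
def volumeMeasure (ω₀ : HForm n 2 X) : MeasureTheory.Measure X := ⨆ c : X, chartVolume ω₀ c

/-- The `L²` inner product `⟪⟪u, v⟫⟫ = ∫_X ⟨u, v⟩_ω dV_ω`; forms of different degrees are
orthogonal. -/
def L2 (ω₀ : HForm n 2 X) (u v : Form n X) : ℂ :=
  ∑ k ∈ Finset.range (2 * n + 1), ∫ x, fibreInner (ω₀ x) (u k x) (v k x) ∂(volumeMeasure ω₀)

/-- `Q` is a formal adjoint of `P`: it maps smooth forms to smooth forms and
`⟪⟪P u, v⟫⟫ = ⟪⟪u, Q v⟫⟫` for all smooth `u`, `v`. -/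
def IsFormalAdjoint (ω₀ : HForm n 2 X) (P Q : Op n X) : Prop :=
  (∀ v, IsSmooth v → IsSmooth (Q v)) ∧
    ∀ u v, IsSmooth u → IsSmooth v → L2 ω₀ (P u) v = L2 ω₀ u (Q v)

/-- `P` maps smooth forms to smooth forms and has a formal adjoint. -/
def HasFormalAdjoint (ω₀ : HForm n 2 X) (P : Op n X) : Prop :=
  (∀ u, IsSmooth u → IsSmooth (P u)) ∧ ∃ Q, IsFormalAdjoint ω₀ P Q

open Classical in
/-- The formal adjoint of `P` (unique on smooth forms when it exists, and `0` by convention when it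
does not). -/
def adj (ω₀ : HForm n 2 X) (P : Op n X) : Op n X :=
  if hP : ∃ Q, IsFormalAdjoint ω₀ P Q then hP.choose else 0

/-- `A ≤ B` for operators: `⟪⟪A u, u⟫⟫ ≤ ⟪⟪B u, u⟫⟫` for every smooth form `u` (in the order of `ℂ`,
so that the difference is real and nonnegative). -/
def OpLE (ω₀ : HForm n 2 X) (A B : Op n X) : Prop :=
  ∀ u, IsSmooth u → L2 ω₀ (A u) u ≤ L2 ω₀ (B u) u

/-- `A` is bounded for the `L²` norm. -/
def IsBoundedOp (ω₀ : HForm n 2 X) (A : Op n X) : Prop :=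
  ∃ M : ℝ, ∀ u, IsSmooth u → L2 ω₀ (A u) (A u) ≤ (M : ℂ) * L2 ω₀ u u

/-! ### The operators of Hermitian geometry -/

/-- The Lefschetz operator `L = ω ∧ ·`, of degree `2`. -/
def lefschetz (ω₀ : HForm n 2 X) : Op n X := wedgeOp ω₀

/-- `Λ`, the adjoint of `L`, of degree `-2`. -/
def Lam (ω₀ : HForm n 2 X) : Op n X := adj ω₀ (lefschetz ω₀)

/-- The torsion operator `τ = [Λ, ∂ω ∧ ·]`, of degree `1`. -/
def tau (ω₀ : HForm n 2 X) : Op n X := gcomm (-2) 3 (Lam ω₀) (wedgeOp (del ω₀))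

/-- `τ̄`, the complex conjugate of `τ`. -/
def taubar (ω₀ : HForm n 2 X) : Op n X := conjOp (tau ω₀)

/-- `[τ, τ^⋆]`. -/
def tauSq (ω₀ : HForm n 2 X) : Op n X := gcomm 1 (-1) (tau ω₀) (adj ω₀ (tau ω₀))

/-- `[τ̄, τ̄^⋆]`. -/
def taubarSq (ω₀ : HForm n 2 X) : Op n X := gcomm 1 (-1) (taubar ω₀) (adj ω₀ (taubar ω₀))

/-- `X̄_ω = [∂̄ω ∧ ·, (∂̄ω ∧ ·)^⋆]`. -/
def Xbar (ω₀ : HForm n 2 X) : Op n X :=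
  gcomm 3 (-3) (wedgeOp (delbar ω₀)) (adj ω₀ (wedgeOp (delbar ω₀)))

/-- The Laplacian `[D, D^⋆] = D D^⋆ + D^⋆ D` of an operator `D` of degree `1`. -/
def laplacian (ω₀ : HForm n 2 X) (D : Op n X) : Op n X := gcomm 1 (-1) D (adj ω₀ D)

/-- The rescaled differential `d_h = h ∂ + ∂̄`. -/
def dh (h : ℝ) : Op n X := h • delOp + delbarOp

/-- `Δ' = [∂, ∂^⋆]`. -/
def lap' (ω₀ : HForm n 2 X) : Op n X := laplacian ω₀ delOp

/-- `Δ'' = [∂̄, ∂̄^⋆]`. -/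
def lap'' (ω₀ : HForm n 2 X) : Op n X := laplacian ω₀ delbarOp

/-- `Δ = [d, d^⋆]`. -/
def lap (ω₀ : HForm n 2 X) : Op n X := laplacian ω₀ dOp

/-- `Δ_h = [d_h, d_h^⋆]`. -/
def lapH (ω₀ : HForm n 2 X) (h : ℝ) : Op n X := laplacian ω₀ (dh h)

end

end HermitianForms

open HermitianForms

/-! The inequalities follow from one identity of operators on smooth forms of all degrees: for an SKT
metric,
`Δ'' + [∂ω ∧ ·, (∂ω ∧ ·)^⋆] = [∂ + τ, (∂ + τ)^⋆]`,
together with its complex conjugate (`IsSKT.laplacian_identity`). On quadratic forms it says that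
`‖∂̄u‖² + ‖∂̄^⋆u‖²` is at most `‖(∂ + τ)u‖² + ‖(∂ + τ)^⋆u‖²` (`IsSKT.energy_identity`), and
`‖a + b‖² ≤ (1 + δ) ‖a‖² + (1 + 1/δ) ‖b‖²` separates `∂` from `τ` (`energy_add_le`). This gives the two
inequalities of (i). The first one of (ii) is the case `δ = (1 - h)/h`, with the term in `∂̄ω` kept. The
second one is `1 - h` times the first, since the cross terms of `∂u` and `∂̄u` cancel in the quadratic
form of `Δ_h - h Δ` (`energy_dh_sub`).

The identity is derived from the Kähler identity with torsion `(∂ + τ)^⋆ = i [Λ, ∂̄]`, valid for every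
Hermitian metric (`IsHermitianMetric.L2_dE_add_torOp`), by commutator algebra in the ring of
endomorphisms of the space of smooth forms (`anticomm_adjoint_identity`). The algebra uses
`[Λ, [Λ, ∂ω ∧ ·]] = 2i [L, (∂̄ω ∧ ·)^⋆]` and `[L, [Λ, ∂ω ∧ ·]] = 3 ∂ω ∧ ·`, which hold fibre by fibre
(`IsHermitianAt.lam_torsion`, `IsHermitianAt.lef_torsion`): both come from the Clifford relations
between exterior multiplications and contractions, and from the resulting `sl₂`-triple `L`, `Λ`,
`[L, Λ]`. The SKT condition enters only through `∂̄ (∂ω ∧ ·) = -(∂ω ∧ ·) ∂̄` (`dS_mul_wedgeS_three`).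

The Kähler identity with torsion is proved without normal coordinates. In a chart the two sides, paired
with a second form and multiplied by the volume density, differ by a divergence (`sum_divTerm`): the
derivatives of the density and of the cometric that appear are expressed by `Λ` and by the derivatives
of `ω`, and their contributions add up to `τ`. Divergences of compactly supported
fields integrate to `0` (`setIntegral_lineDeriv_eq_zero`), the volume measure is given by the density in
every chart (`volumeMeasure_apply`), and a partition of unity decomposes a smooth form into forms
supported in charts (`exists_sum_support`).

The operators of order zero are bounded because exterior multiplication by a smooth form is locally
bounded in the fibre norms, hence bounded on the compact manifold, and so is its adjoint
(`IsHermitianMetric.bddOn_wedgeL`, `IsHermitianMetric.L2_le_of_bddOn`). The lower bound `-Ch` follows by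
dropping the non-negative term in `X̄_ω`.

Forms of mixed degree at a point are handled as the space `Fib n` and operators on them as its
endomorphism ring `FibEnd n`; a parameter `ε = ±i` treats `∂` and `∂̄`, `τ` and `τ̄` together. -/

namespace HermitianForms
noncomputable section

/-! ### The signed sum over permutations -/

section AltSum

variable {V : Type*}

/-- The alternatization of a function of `m` vectors. -/
def altSum {m : ℕ} (f : (Fin m → V) → ℂ) (v : Fin m → V) : ℂ :=
  ∑ σ : Equiv.Perm (Fin m), ((Equiv.Perm.sign σ : ℤ) : ℂ) * f (v ∘ σ)

theorem altSum_comp_perm {m : ℕ} (f : (Fin m → V) → ℂ) (ρ : Equiv.Perm (Fin m)) (v : Fin m → V) :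
    altSum (fun w => f (w ∘ ρ)) v = ((Equiv.Perm.sign ρ : ℤ) : ℂ) * altSum f v := by
  unfold altSum
  rw [Finset.mul_sum]
  refine Fintype.sum_equiv (Equiv.mulRight ρ) _ _ fun σ => ?_
  simp only [Equiv.coe_mulRight, Equiv.Perm.sign_mul, Units.val_mul, Int.cast_mul,
    Equiv.Perm.coe_mul, Function.comp_assoc]
  have h : ((Equiv.Perm.sign ρ : ℤ) : ℂ) * ((Equiv.Perm.sign ρ : ℤ) : ℂ) = 1 := by
    rcases Int.units_eq_one_or (Equiv.Perm.sign ρ) with h | h <;> simp [h]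
  linear_combination (-((Equiv.Perm.sign σ : ℤ) : ℂ) * f (v ∘ (σ ∘ ρ))) * h

/-- The permutation with `0 ↦ j` whose remaining values are given by `σ`, skipping `j`. -/
def consPerm {m : ℕ} (x : Fin (m + 1) × Equiv.Perm (Fin m)) : Equiv.Perm (Fin (m + 1)) :=
  x.1.cycleRange.symm * Equiv.Perm.decomposeFin.symm (0, x.2)

theorem consPerm_zero {m : ℕ} (x : Fin (m + 1) × Equiv.Perm (Fin m)) : consPerm x 0 = x.1 := by
  simp [consPerm]

theorem consPerm_succ {m : ℕ} (x : Fin (m + 1) × Equiv.Perm (Fin m)) (i : Fin m) :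
    consPerm x i.succ = x.1.succAbove (x.2 i) := by
  simp [consPerm]

theorem sign_consPerm {m : ℕ} (x : Fin (m + 1) × Equiv.Perm (Fin m)) :
    Equiv.Perm.sign (consPerm x) = (-1) ^ (x.1 : ℕ) * Equiv.Perm.sign x.2 := by
  simp [consPerm, Equiv.Perm.sign_mul, Fin.sign_cycleRange]

theorem consPerm_bijective (m : ℕ) : Function.Bijective (consPerm (m := m)) := by
  rw [Fintype.bijective_iff_injective_and_card]
  refine ⟨fun x y h => ?_, ?_⟩
  · have h0 : x.1 = y.1 := by rw [← consPerm_zero x, ← consPerm_zero y, h]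
    refine Prod.ext h0 (Equiv.ext fun i => ?_)
    have := congrArg (fun σ => σ i.succ) h
    simp only [consPerm_succ, h0] at this
    exact Fin.succAbove_right_injective this
  · simp [Fintype.card_perm, Nat.factorial_succ]

/-- Expansion of an alternatization along the first slot. -/
theorem altSum_succ {m : ℕ} (α : V → ℂ) (g : (Fin m → V) → ℂ) (v : Fin (m + 1) → V) :
    altSum (fun w => α (w 0) * g (fun i => w i.succ)) v =
      ∑ j : Fin (m + 1), (-1) ^ (j : ℕ) * (α (v j) * altSum g (j.removeNth v)) := by
  unfold altSum
  rw [← (consPerm_bijective m).sum_comp, Fintype.sum_prod_type]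
  refine Finset.sum_congr rfl fun j _ => ?_
  rw [Finset.mul_sum, Finset.mul_sum]
  refine Finset.sum_congr rfl fun σ _ => ?_
  simp only [sign_consPerm, Function.comp_apply, consPerm_zero, consPerm_succ]
  have : (fun i => v (j.succAbove (σ i))) = (j.removeNth v) ∘ σ := rfl
  rw [this]
  push_cast
  ring

theorem altSum_finset_sum {m : ℕ} {ι : Type*} (s : Finset ι) (f : ι → (Fin m → V) → ℂ)
    (v : Fin m → V) : altSum (fun w => ∑ i ∈ s, f i w) v = ∑ i ∈ s, altSum (f i) v := by
  unfold altSum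
  rw [Finset.sum_comm]
  exact Finset.sum_congr rfl fun σ _ => Finset.mul_sum _ _ _

theorem altSum_const_mul {m : ℕ} (r : ℂ) (f : (Fin m → V) → ℂ) (v : Fin m → V) :
    altSum (fun w => r * f w) v = r * altSum f v := by
  unfold altSum
  rw [Finset.mul_sum]
  exact Finset.sum_congr rfl fun σ _ => by ring

end AltSum

/-! ### The wedge product -/

variable {n : ℕ}

theorem wedge_apply {p q m : ℕ} (hm : p + q = m) (a : Alt n p) (b : Alt n q)
    (v : Fin m → Cn n) :
    wedge hm a b v = ((p.factorial : ℂ) * q.factorial)⁻¹ *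
      altSum (fun w => a (fun i => w (Fin.cast hm (Fin.castAdd q i))) *
        b (fun j => w (Fin.cast hm (Fin.natAdd p j)))) v := by
  simp only [wedge, ContinuousAlternatingMap.smul_apply,
    ContinuousMultilinearMap.alternatization_apply_apply, tensor_apply, altSum]
  rw [Complex.real_smul]
  push_cast
  congr 1
  refine Finset.sum_congr rfl fun σ _ => ?_
  rw [Units.smul_def, zsmul_eq_mul]

/-- A covector: a complex-valued real-linear form on `ℂⁿ`. -/
abbrev Cov (n : ℕ) : Type := Cn n →L[ℝ] ℂ

/-- The exterior product of a covector and a form. -/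
def extMul {k : ℕ} (α : Cov n) (a : Alt n k) : Alt n (k + 1) :=
  ContinuousAlternatingMap.alternatizeUncurryFin (α.smulRight a)

theorem extMul_apply {k : ℕ} (α : Cov n) (a : Alt n k) (v : Fin (k + 1) → Cn n) :
    extMul α a v = ∑ i : Fin (k + 1), (-1) ^ (i : ℕ) * (α (v i) * a (i.removeNth v)) := by
  simp [extMul, ContinuousAlternatingMap.alternatizeUncurryFin_apply]

theorem wedge_extMul {p q m : ℕ} (hm : p + q = m) (hm' : p + 1 + q = m + 1) (α : Cov n)
    (a : Alt n p) (b : Alt n q) :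
    wedge hm' (extMul α a) b = extMul α (wedge hm a b) := by
  subst hm
  ext v
  rw [wedge_apply, extMul_apply]
  simp only [wedge_apply, extMul_apply, Finset.sum_mul]
  rw [altSum_finset_sum]
  -- the tensor `α ⊗ a ⊗ b`, in which `α` takes the first slot
  let f : (Fin (p + q + 1) → Cn n) → ℂ := fun w => α (w 0) *
    (a (fun i => w (Fin.castAdd q i).succ) * b (fun j => w (Fin.natAdd p j).succ))
  have key : ∀ i : Fin (p + 1), altSum (fun w : Fin (p + q + 1) → Cn n =>
      (-1) ^ (i : ℕ) * (α (w (Fin.cast hm' (Fin.castAdd q i))) *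
        a (i.removeNth fun i => w (Fin.cast hm' (Fin.castAdd q i)))) *
        b (fun j => w (Fin.cast hm' (Fin.natAdd (p + 1) j)))) v = altSum f v := by
    intro i
    let i' : Fin (p + q + 1) := Fin.cast hm' (Fin.castAdd q i)
    have h1 : (fun w : Fin (p + q + 1) → Cn n =>
      (-1) ^ (i : ℕ) * (α (w (Fin.cast hm' (Fin.castAdd q i))) *
        a (i.removeNth fun i => w (Fin.cast hm' (Fin.castAdd q i)))) *
        b (fun j => w (Fin.cast hm' (Fin.natAdd (p + 1) j)))) =
        fun w => (-1) ^ (i : ℕ) * f (w ∘ i'.cycleRange.symm) := by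
      funext w
      have e1 : (i.removeNth fun i => w (Fin.cast hm' (Fin.castAdd q i))) =
          fun j => w (i'.cycleRange.symm (Fin.castAdd q j).succ) := by
        funext j
        rw [Fin.cycleRange_symm_succ, Fin.removeNth]
        congr 1
        ext
        simp only [Fin.succAbove, i', Fin.lt_def, Fin.val_cast, Fin.val_castAdd, Fin.val_castSucc]
        split_ifs <;> simp
      have e2 : (fun j => w (Fin.cast hm' (Fin.natAdd (p + 1) j))) =
          fun j => w (i'.cycleRange.symm (Fin.natAdd p j).succ) := by
        funext j
        rw [Fin.cycleRange_symm_succ]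
        congr 1
        ext
        have := i.2
        simp only [Fin.succAbove, i', Fin.lt_def, Fin.val_cast, Fin.val_castAdd, Fin.val_castSucc,
          Fin.val_natAdd]
        rw [if_neg (by omega)]
        simp
        omega
      simp only [f, Function.comp_apply, Fin.cycleRange_symm_zero, e1, e2]
      ring
    rw [h1, altSum_const_mul, altSum_comp_perm, ← mul_assoc]
    have : ((Equiv.Perm.sign (i'.cycleRange.symm) : ℤ) : ℂ) = (-1) ^ (i : ℕ) := by
      simp [Fin.sign_cycleRange, i']
    rw [this, ← mul_pow]
    simp
  rw [Finset.sum_congr rfl fun i _ => key i]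
  simp only [Finset.sum_const, Finset.card_univ, Fintype.card_fin, nsmul_eq_mul]
  have hf : altSum f v = _ := altSum_succ (fun x => α x) (fun u : Fin (p + q) → Cn n =>
    a (fun i => u (Fin.castAdd q i)) * b (fun j => u (Fin.natAdd p j))) v
  rw [hf, ← mul_assoc, Finset.mul_sum]
  refine Finset.sum_congr rfl fun j _ => ?_
  have h1 : (p.factorial : ℂ) ≠ 0 := by exact_mod_cast p.factorial_ne_zero
  have h2 : (q.factorial : ℂ) ≠ 0 := by exact_mod_cast q.factorial_ne_zero
  have h3 : (p : ℂ) + 1 ≠ 0 := by exact_mod_cast p.succ_ne_zero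
  rw [Nat.factorial_succ]
  push_cast
  simp only [Fin.cast_eq_self]
  field_simp

theorem wedge_zero_left {q m : ℕ} (hm : 0 + q = m) (hq : q = m) (a : Alt n 0) (b : Alt n q) :
    wedge hm a b = a ![] • (hq ▸ b) := by
  subst hq
  ext v
  rw [wedge_apply]
  simp only [ContinuousAlternatingMap.smul_apply, smul_eq_mul]
  have h : ∀ σ : Equiv.Perm (Fin q), b (v ∘ σ) = ((Equiv.Perm.sign σ : ℤ) : ℂ) * b v := by
    intro σ
    have := b.toAlternatingMap.map_perm v σ
    simpa [Units.smul_def] using this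
  have h2 : (q.factorial : ℂ) ≠ 0 := by exact_mod_cast q.factorial_ne_zero
  have key : altSum (fun w : Fin q → Cn n => a (fun i => w (Fin.cast hm (Fin.castAdd q i))) *
        b (fun j => w (Fin.cast hm (Fin.natAdd 0 j)))) v = q.factorial * (a ![] * b v) := by
    unfold altSum
    rw [Finset.sum_congr rfl (g := fun _ => a ![] * b v), Finset.sum_const, Finset.card_univ,
      Fintype.card_perm, Fintype.card_fin, nsmul_eq_mul]
    intro σ _
    have e1 : (fun j => (v ∘ σ) (Fin.cast hm (Fin.natAdd 0 j))) = v ∘ σ := by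
      funext j
      congr 1
      ext
      simp
    beta_reduce
    rw [e1, h, Subsingleton.elim (fun i => (v ∘ σ) (Fin.cast hm (Fin.castAdd q i))) ![]]
    rcases Int.units_eq_one_or (Equiv.Perm.sign σ) with h | h <;> simp [h]
  rw [key]
  simp only [Nat.factorial_zero, Nat.cast_one, one_mul]
  field_simp

theorem wedge_add_left {p q m : ℕ} (hm : p + q = m) (a a' : Alt n p) (b : Alt n q) :
    wedge hm (a + a') b = wedge hm a b + wedge hm a' b := by
  ext v
  simp [wedge_apply, altSum, add_mul, mul_add, Finset.sum_add_distrib]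

theorem wedge_smul_left {p q m : ℕ} (hm : p + q = m) (r : ℂ) (a : Alt n p) (b : Alt n q) :
    wedge hm (r • a) b = r • wedge hm a b := by
  ext v
  simp only [wedge_apply, altSum, ContinuousAlternatingMap.smul_apply, smul_eq_mul, Finset.mul_sum]
  exact Finset.sum_congr rfl fun σ _ => by ring

theorem wedge_add_right {p q m : ℕ} (hm : p + q = m) (a : Alt n p) (b b' : Alt n q) :
    wedge hm a (b + b') = wedge hm a b + wedge hm a b' := by
  ext v
  simp [wedge_apply, altSum, mul_add, Finset.sum_add_distrib]

theorem wedge_smul_right {p q m : ℕ} (hm : p + q = m) (r : ℂ) (a : Alt n p) (b : Alt n q) :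
    wedge hm a (r • b) = r • wedge hm a b := by
  ext v
  simp only [wedge_apply, altSum, ContinuousAlternatingMap.smul_apply, smul_eq_mul, Finset.mul_sum]
  exact Finset.sum_congr rfl fun σ _ => by ring

theorem wedge_conjAlt {p q m : ℕ} (hm : p + q = m) (a : Alt n p) (b : Alt n q) :
    wedge hm (conjAlt a) (conjAlt b) = conjAlt (wedge hm a b) := by
  ext v
  simp only [wedge_apply, altSum, conjAlt, ContinuousLinearMap.compContinuousAlternatingMap_coe,
    Function.comp_apply]
  simp [map_sum, map_mul]

theorem wedge_compContinuousLinearMap {p q m : ℕ} (hm : p + q = m) (a : Alt n p) (b : Alt n q)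
    (A : Cn n →L[ℝ] Cn n) :
    wedge hm (a.compContinuousLinearMap A) (b.compContinuousLinearMap A) =
      (wedge hm a b).compContinuousLinearMap A := by
  ext v
  simp only [wedge_apply, altSum, ContinuousAlternatingMap.compContinuousLinearMap_apply]
  rfl

end
end HermitianForms

namespace HermitianForms
noncomputable section

variable {n : ℕ}

/-! ### Operators on forms at a point -/

/-- The space of alternating forms of mixed degree on `ℂⁿ`: the fibre of `Form n X`. -/
def Fib (n : ℕ) : Type := ∀ k : ℕ, Alt n k

instance (n : ℕ) : AddCommGroup (Fib n) := inferInstanceAs (AddCommGroup (∀ k : ℕ, Alt n k))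
instance (n : ℕ) : Module ℂ (Fib n) := inferInstanceAs (Module ℂ (∀ k : ℕ, Alt n k))
instance (n : ℕ) : Module ℝ (Fib n) := inferInstanceAs (Module ℝ (∀ k : ℕ, Alt n k))
instance (n : ℕ) : SMulCommClass ℂ ℝ (Fib n) :=
  inferInstanceAs (SMulCommClass ℂ ℝ (∀ k : ℕ, Alt n k))

@[simp] theorem alt_smul_zero {k : ℕ} (r : ℂ) : r • (0 : Alt n k) = 0 :=
  smul_zero (A := Alt n k) r

namespace Fib

@[simp] theorem zero_apply (k : ℕ) : (0 : Fib n) k = 0 := rfl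
@[simp] theorem add_apply (a b : Fib n) (k : ℕ) : (a + b) k = a k + b k := rfl
@[simp] theorem sub_apply (a b : Fib n) (k : ℕ) : (a - b) k = a k - b k := rfl
@[simp] theorem neg_apply (a : Fib n) (k : ℕ) : (-a) k = -a k := rfl
@[simp] theorem smul_apply (r : ℂ) (a : Fib n) (k : ℕ) : (r • a) k = r • a k := rfl

@[ext] theorem ext {a b : Fib n} (h : ∀ k, a k = b k) : a = b := funext h

/-- The evaluation in degree `k`. -/
def evalDeg (k : ℕ) : Fib n →ₗ[ℂ] Alt n k where
  toFun a := a k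
  map_add' _ _ := rfl
  map_smul' _ _ := rfl

@[simp] theorem sum_apply {ι : Type*} (s : Finset ι) (a : ι → Fib n) (k : ℕ) :
    (∑ i ∈ s, a i) k = ∑ i ∈ s, a i k := map_sum (evalDeg k) a s

end Fib

/-- The ring of `ℂ`-linear endomorphisms of the space of alternating forms. -/
abbrev FibEnd (n : ℕ) : Type := Module.End ℂ (Fib n)

theorem extMul_add_left {k : ℕ} (α β : Cov n) (a : Alt n k) :
    extMul (α + β) a = extMul α a + extMul β a := by
  ext v
  simp [extMul_apply, add_mul, mul_add, Finset.sum_add_distrib]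

theorem extMul_smul_left {k : ℕ} (r : ℂ) (α : Cov n) (a : Alt n k) :
    extMul (r • α) a = r • extMul α a := by
  ext v
  simp only [extMul_apply, ContinuousAlternatingMap.smul_apply, _root_.smul_apply,
    smul_eq_mul, Finset.mul_sum]
  exact Finset.sum_congr rfl fun σ _ => by ring

theorem extMul_add_right {k : ℕ} (α : Cov n) (a b : Alt n k) :
    extMul α (a + b) = extMul α a + extMul α b := by
  ext v
  simp [extMul_apply, mul_add, Finset.sum_add_distrib]

theorem extMul_smul_right {k : ℕ} (r : ℂ) (α : Cov n) (a : Alt n k) :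
    extMul α (r • a) = r • extMul α a := by
  ext v
  simp only [extMul_apply, ContinuousAlternatingMap.smul_apply,
    smul_eq_mul, Finset.mul_sum]
  exact Finset.sum_congr rfl fun σ _ => by ring

/-- The underlying function of `ext₁`. -/
def ext₁Fun (α : Cov n) (a : Fib n) : Fib n
  | 0 => 0
  | k + 1 => extMul α (a k)

/-- Exterior multiplication `α ∧ ·` by a covector, on forms of mixed degree. -/
def ext₁ : Cov n →ₗ[ℂ] FibEnd n where
  toFun α :=
    { toFun := ext₁Fun α
      map_add' := fun a b => Fib.ext fun k => by
        cases k with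
        | zero => exact (add_zero _).symm
        | succ k => exact extMul_add_right _ _ _
      map_smul' := fun r a => Fib.ext fun k => by
        cases k with
        | zero => exact (alt_smul_zero r).symm
        | succ k => exact extMul_smul_right _ _ _ }
  map_add' α β := LinearMap.ext fun a => Fib.ext fun k => by
    cases k with
    | zero => exact (add_zero _).symm
    | succ k => exact extMul_add_left _ _ _
  map_smul' r α := LinearMap.ext fun a => Fib.ext fun k => by
    cases k with
    | zero => exact (alt_smul_zero r).symm
    | succ k => exact extMul_smul_left _ _ _

@[simp] theorem ext₁_zero_deg (α : Cov n) (a : Fib n) : ext₁ α a 0 = 0 := rfl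

@[simp] theorem ext₁_succ (α : Cov n) (a : Fib n) (k : ℕ) :
    ext₁ α a (k + 1) = extMul α (a k) := rfl

/-- Contraction with a vector, on forms of mixed degree. -/
def contr : Cn n →ₗ[ℝ] FibEnd n where
  toFun v :=
    { toFun := fun a k => (a (k + 1)).curryLeft v
      map_add' := fun a b => rfl
      map_smul' := fun r a => rfl }
  map_add' v w := by
    ext1 a
    funext k
    exact map_add (a (k + 1)).curryLeft _ _
  map_smul' r v := by
    ext1 a
    funext k
    exact map_smul (a (k + 1)).curryLeft _ _

theorem contr_apply (v : Cn n) (a : Fib n) (k : ℕ) (w : Fin k → Cn n) :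
    contr v a k w = a (k + 1) (Matrix.vecCons v w) := rfl

theorem ext₁_contr (α : Cov n) (v : Cn n) :
    ext₁ α * contr v + contr v * ext₁ α = algebraMap ℂ (FibEnd n) (α v) := by
  ext a k w
  change (ext₁ α (contr v a) k + contr v (ext₁ α a) k) w = (α v • a k) w
  rw [ContinuousAlternatingMap.add_apply, contr_apply, ext₁_succ, extMul_apply, Fin.sum_univ_succ]
  have h0 : Fin.removeNth 0 (Matrix.vecCons v w : Fin (k + 1) → Cn n) = w := by
    funext i; simp [Fin.removeNth]
  rw [h0]
  cases k with
  | zero => simp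
  | succ k =>
    rw [ext₁_succ, extMul_apply]
    have : ∀ i : Fin (k + 1), (-1 : ℂ) ^ (i.succ : ℕ) * (α (Matrix.vecCons v w i.succ) *
        a (k + 1) (i.succ.removeNth (Matrix.vecCons v w))) =
        -((-1) ^ (i : ℕ) * (α (w i) * contr v a k (i.removeNth w))) := by
      intro i
      have e : i.succ.removeNth (Matrix.vecCons v w : Fin (k + 2) → Cn n) =
          Matrix.vecCons v (i.removeNth w) := by
        funext j
        refine Fin.cases ?_ (fun j => ?_) j <;> simp [Fin.removeNth]
      rw [contr_apply, e]
      simp [pow_succ]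
    rw [Finset.sum_congr rfl fun i _ => this i, Finset.sum_neg_distrib]
    simp

theorem contr_anticomm (v w : Cn n) : contr v * contr w = -(contr w * contr v) := by
  have hs : ∀ v : Cn n, contr v * contr v = 0 := by
    intro v
    ext a k u
    change (a (k + 2)) (Matrix.vecCons v (Matrix.vecCons v u)) = 0
    exact (a (k + 2)).map_eq_zero_of_eq _ (i := 0) (j := 1) rfl (by simp)
  have := hs (v + w)
  rw [map_add, add_mul, mul_add, mul_add, hs, hs] at this
  simp only [zero_add, add_zero] at this
  exact eq_neg_of_add_eq_zero_left this

/-- An operator that kills forms of degree `0`, vanishes in degree `0`, and commutes with all the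
contractions up to sign, vanishes. -/
theorem fibEnd_eq_zero_of_contr (P : FibEnd n) (ε : ℂ) (h0 : ∀ a, P a 0 = 0)
    (h : ∀ v, contr v * P = ε • (P * contr v)) : P = 0 := by
  have key : ∀ k : ℕ, ∀ a, P a k = 0 := by
    intro k
    induction k with
    | zero => exact h0
    | succ k ih =>
      intro a
      ext w
      have := congrArg (fun Q : FibEnd n => Q a k (Matrix.vecTail w)) (h (w 0))
      simp only [LinearMap.smul_apply, Module.End.mul_apply, contr_apply] at this
      rw [show Matrix.vecCons (w 0) (Matrix.vecTail w) = w from Matrix.cons_head_tail w] at this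
      rw [this]
      simp [ih]
  ext1 a
  funext k
  exact key k a

theorem ext₁_anticomm (α β : Cov n) : ext₁ α * ext₁ β = -(ext₁ β * ext₁ α) := by
  rw [eq_neg_iff_add_eq_zero]
  refine fibEnd_eq_zero_of_contr _ 1 (fun a => ?_) fun v => ?_
  · simp
  · have h1 := ext₁_contr α v
    have h2 := ext₁_contr β v
    have c1 := Algebra.commutes (α v) (ext₁ β)
    have c2 := Algebra.commutes (β v) (ext₁ α)
    rw [one_smul]
    linear_combination (norm := noncomm_ring) h1 * ext₁ β - ext₁ α * h2 + h2 * ext₁ α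
      - ext₁ β * h1 + c1 + c2

/-! ### Wedge products -/

/-- The underlying function of `wedgeL`. -/
def wedgeFun {p : ℕ} (α : Alt n p) (a : Fib n) : Fib n := fun m =>
  if hp : p ≤ m then wedge (Nat.add_sub_of_le hp) α (a (m - p)) else 0

theorem wedgeFun_apply {p q m : ℕ} (hm : p + q = m) (α : Alt n p) (a : Fib n) :
    wedgeFun α a m = wedge hm α (a q) := by
  have hp : p ≤ m := by omega
  obtain rfl : q = m - p := by omega
  simp [wedgeFun, hp]

theorem wedgeFun_of_lt {p m : ℕ} (hm : ¬p ≤ m) (α : Alt n p) (a : Fib n) :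
    wedgeFun α a m = 0 := by
  simp [wedgeFun, hm]

/-- The operator `α ∧ ·` of multiplication by a `p`-form. -/
def wedgeL {p : ℕ} : Alt n p →ₗ[ℂ] FibEnd n where
  toFun α :=
    { toFun := wedgeFun α
      map_add' := fun a b => Fib.ext fun m => by
        by_cases hp : p ≤ m
        · simp [wedgeFun_apply (Nat.add_sub_of_le hp), wedge_add_right]
        · simp [wedgeFun_of_lt hp]
      map_smul' := fun r a => Fib.ext fun m => by
        by_cases hp : p ≤ m
        · simp [wedgeFun_apply (Nat.add_sub_of_le hp), wedge_smul_right]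
        · simp [wedgeFun_of_lt hp] }
  map_add' α β := LinearMap.ext fun a => Fib.ext fun m => by
    change wedgeFun (α + β) a m = wedgeFun α a m + wedgeFun β a m
    by_cases hp : p ≤ m
    · simp [wedgeFun_apply (Nat.add_sub_of_le hp), wedge_add_left]
    · simp [wedgeFun_of_lt hp]
  map_smul' r α := LinearMap.ext fun a => Fib.ext fun m => by
    change wedgeFun (r • α) a m = r • wedgeFun α a m
    by_cases hp : p ≤ m
    · simp [wedgeFun_apply (Nat.add_sub_of_le hp), wedge_smul_left]
    · simp [wedgeFun_of_lt hp]

theorem wedgeL_apply {p q m : ℕ} (hm : p + q = m) (α : Alt n p) (a : Fib n) :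
    wedgeL α a m = wedge hm α (a q) :=
  wedgeFun_apply hm α a

theorem wedgeL_of_lt {p m : ℕ} (hm : m < p) (α : Alt n p) (a : Fib n) :
    wedgeL α a m = 0 :=
  wedgeFun_of_lt (by omega) α a

theorem wedgeL_extMul {p : ℕ} (α : Cov n) (a : Alt n p) :
    wedgeL (extMul α a) = ext₁ α * wedgeL a := by
  ext1 b
  funext m
  rw [Module.End.mul_apply]
  cases m with
  | zero => rw [wedgeL_of_lt (by omega), ext₁_zero_deg]
  | succ m =>
    rw [ext₁_succ]
    by_cases hp : p ≤ m
    · obtain ⟨q, hq⟩ := Nat.exists_eq_add_of_le hp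
      rw [wedgeL_apply (q := q) hq.symm, wedgeL_apply (q := q) (by omega), wedge_extMul]
    · rw [wedgeL_of_lt (by omega), wedgeL_of_lt (by omega)]
      ext v
      simp [extMul_apply]

theorem wedgeL_zero (α : Alt n 0) : wedgeL α = algebraMap ℂ (FibEnd n) (α ![]) := by
  ext1 b
  funext m
  rw [wedgeL_apply (zero_add m), wedge_zero_left _ rfl]
  rfl

/-! ### Bases and coframes -/

/-- The basis `∂/∂x_j`, `∂/∂y_j`. -/
def stdBasis (n : ℕ) : Module.Basis (Fin n ⊕ Fin n) ℝ (Cn n) :=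
  .ofEquivFun
    { toFun := fun v => Sum.elim (fun j => (v j).re) (fun j => (v j).im)
      map_add' := fun v w => by funext s; cases s <;> simp
      map_smul' := fun r v => by funext s; cases s <;> simp
      invFun := fun x j => ⟨x (.inl j), x (.inr j)⟩
      left_inv := fun v => by funext j; simp
      right_inv := fun x => by funext s; cases s <;> simp }

theorem stdBasis_apply (s : Fin n ⊕ Fin n) : stdBasis n s = realBasis n s := by
  rw [stdBasis, Module.Basis.coe_ofEquivFun]
  funext j
  cases s with
  | inl i =>
    by_cases h : j = i
    · subst h; apply Complex.ext <;> simp [realBasis]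
    · apply Complex.ext <;> simp [realBasis, h]
  | inr i =>
    by_cases h : j = i
    · subst h; apply Complex.ext <;> simp [realBasis]
    · apply Complex.ext <;> simp [realBasis, h]

/-- The dual coframe of a real basis of `ℂⁿ`, as complex-valued covectors. -/
def coframe (f : Module.Basis (Fin n ⊕ Fin n) ℝ (Cn n)) (s : Fin n ⊕ Fin n) : Cov n :=
  Complex.ofRealCLM.comp (f.coord s).toContinuousLinearMap

@[simp] theorem coframe_apply (f : Module.Basis (Fin n ⊕ Fin n) ℝ (Cn n)) (s : Fin n ⊕ Fin n)
    (v : Cn n) : coframe f s v = (f.repr v s : ℂ) := by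
  simp [coframe]

/-- Expansion of a real-linear map in a basis. -/
theorem sum_coframe_smul {M : Type*} [AddCommGroup M] [Module ℝ M] [Module ℂ M]
    [IsScalarTower ℝ ℂ M] (f : Module.Basis (Fin n ⊕ Fin n) ℝ (Cn n)) (T : Cn n →ₗ[ℝ] M)
    (v : Cn n) : ∑ s, coframe f s v • T (f s) = T v := by
  conv_rhs => rw [← f.sum_repr v]
  rw [map_sum]
  refine Finset.sum_congr rfl fun s _ => ?_
  rw [map_smul, coframe_apply]
  rw [← Complex.coe_algebraMap, algebraMap_smul]

theorem cov_expand (f : Module.Basis (Fin n ⊕ Fin n) ℝ (Cn n)) (α : Cov n) :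
    α = ∑ s, α (f s) • coframe f s := by
  ext1 v
  have := sum_coframe_smul f α.toLinearMap v
  rw [_root_.sum_apply]
  rw [show α v = α.toLinearMap v from rfl, ← this]
  exact Finset.sum_congr rfl fun s _ => by simp [mul_comm]

/-- The exterior product is `∑ f^s ∧ T(f_s)` on the alternatization of a linear map `T`. -/
theorem alternatizeUncurryFin_eq_sum {k : ℕ} (f : Module.Basis (Fin n ⊕ Fin n) ℝ (Cn n))
    (T : Cn n →L[ℝ] Alt n k) :
    ContinuousAlternatingMap.alternatizeUncurryFin T = ∑ s, extMul (coframe f s) (T (f s)) := by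
  have : T = ∑ s, (coframe f s).smulRight (T (f s)) := by
    ext1 v
    rw [_root_.sum_apply]
    exact (sum_coframe_smul f T.toLinearMap v).symm
  conv_lhs => rw [this]
  rw [← ContinuousAlternatingMap.alternatizeUncurryFinCLM_apply, map_sum]
  rfl

theorem alt_expand {p : ℕ} (f : Module.Basis (Fin n ⊕ Fin n) ℝ (Cn n)) (α : Alt n (p + 1)) :
    α = ((p : ℂ) + 1)⁻¹ • ∑ s, extMul (coframe f s) (α.curryLeft (f s)) := by
  rw [← alternatizeUncurryFin_eq_sum f, ContinuousAlternatingMap.alternatizeUncurryFin_curryLeft]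
  have h : (p : ℂ) + 1 ≠ 0 := by exact_mod_cast p.succ_ne_zero
  rw [eq_inv_smul_iff₀ h]
  ext v
  simp

theorem wedgeL_succ {p : ℕ} (f : Module.Basis (Fin n ⊕ Fin n) ℝ (Cn n)) (α : Alt n (p + 1)) :
    wedgeL α = ((p : ℂ) + 1)⁻¹ • ∑ s, ext₁ (coframe f s) * wedgeL (α.curryLeft (f s)) := by
  conv_lhs => rw [alt_expand f α]
  simp only [map_smul, map_sum, wedgeL_extMul]

/-- The covector underlying a `1`-form. -/
def toCov (α : Alt n 1) : Cov n :=
  (ContinuousAlternatingMap.ofSubsingleton ℝ (Cn n) ℂ (0 : Fin 1)).symm α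

theorem toCov_apply (α : Alt n 1) (v : Cn n) : toCov α v = α ![v] := by
  have : (![v] : Fin 1 → Cn n) = fun _ => v := by funext i; simp
  rw [this]
  rfl

theorem wedgeL_one (α : Alt n 1) : wedgeL α = ext₁ (toCov α) := by
  rw [wedgeL_succ (stdBasis n)]
  conv_rhs => rw [cov_expand (stdBasis n) (toCov α)]
  simp only [Nat.cast_zero, zero_add, inv_one, one_smul, map_sum, map_smul]
  refine Finset.sum_congr rfl fun s _ => ?_
  rw [wedgeL_zero, ← Algebra.commutes, ← Algebra.smul_def, toCov_apply]
  rfl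

theorem wedgeL_two (f : Module.Basis (Fin n ⊕ Fin n) ℝ (Cn n)) (η : Alt n 2) :
    wedgeL η = (2 : ℂ)⁻¹ • ∑ s, ext₁ (coframe f s) * ext₁ (toCov (η.curryLeft (f s))) := by
  rw [wedgeL_succ f]
  norm_num
  simp only [wedgeL_one]

theorem wedgeL_three (f : Module.Basis (Fin n ⊕ Fin n) ℝ (Cn n)) (θ : Alt n 3) :
    wedgeL θ = (6 : ℂ)⁻¹ • ∑ s, ∑ t, ∑ u, θ ![f s, f t, f u] •
      (ext₁ (coframe f s) * ext₁ (coframe f t) * ext₁ (coframe f u)) := by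
  rw [wedgeL_succ f]
  simp only [wedgeL_two f, Finset.mul_sum, Finset.smul_sum, mul_smul_comm, smul_smul]
  refine Finset.sum_congr rfl fun s _ => Finset.sum_congr rfl fun t _ => ?_
  rw [cov_expand f (toCov _), map_sum, Finset.mul_sum, Finset.mul_sum, Finset.smul_sum]
  refine Finset.sum_congr rfl fun u _ => ?_
  rw [toCov_apply, map_smul, mul_smul_comm, mul_smul_comm, smul_smul, mul_assoc]
  have e : ((θ.curryLeft (f s)).curryLeft (f t)) ![f u] = θ ![f s, f t, f u] := rfl
  rw [e, ← mul_assoc, ← mul_assoc]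
  congr 2
  push_cast
  norm_num

/-- The graded commutation of exterior multiplications. -/
theorem ext₁_wedgeL {p : ℕ} (β : Cov n) (α : Alt n p) :
    ext₁ β * wedgeL α = (-1 : ℂ) ^ p • (wedgeL α * ext₁ β) := by
  induction p with
  | zero => rw [wedgeL_zero, ← Algebra.commutes]; simp
  | succ p ih =>
    rw [wedgeL_succ (stdBasis n), mul_smul_comm, smul_mul_assoc, smul_comm]
    congr 1
    rw [Finset.mul_sum, Finset.sum_mul, Finset.smul_sum]
    refine Finset.sum_congr rfl fun s _ => ?_
    rw [← mul_assoc, ext₁_anticomm, neg_mul, mul_assoc, ih, mul_smul_comm, pow_succ, mul_neg_one,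
      neg_smul, mul_assoc]

theorem commute_ext₁_wedgeL_two (β : Cov n) (η : Alt n 2) :
    ext₁ β * wedgeL η = wedgeL η * ext₁ β := by
  rw [ext₁_wedgeL]; simp

theorem commute_wedgeL_two {p : ℕ} (η : Alt n 2) (α : Alt n p) :
    wedgeL η * wedgeL α = wedgeL α * wedgeL η := by
  induction p with
  | zero => rw [wedgeL_zero, ← Algebra.commutes]
  | succ p ih =>
    rw [wedgeL_succ (stdBasis n) α, mul_smul_comm, smul_mul_assoc, Finset.mul_sum, Finset.sum_mul]
    congr 1
    refine Finset.sum_congr rfl fun s _ => ?_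
    rw [← mul_assoc, ← commute_ext₁_wedgeL_two, mul_assoc, ih, mul_assoc]

/-- Contraction is a derivation of the product with a `2`-form. -/
theorem contr_wedgeL_two (v : Cn n) (η : Alt n 2) :
    contr v * wedgeL η - wedgeL η * contr v = ext₁ (toCov (η.curryLeft v)) := by
  have hs : ∀ s, contr v * (ext₁ (coframe (stdBasis n) s) *
      ext₁ (toCov (η.curryLeft (stdBasis n s)))) - (ext₁ (coframe (stdBasis n) s) *
      ext₁ (toCov (η.curryLeft (stdBasis n s)))) * contr v =
      coframe (stdBasis n) s v • ext₁ (toCov (η.curryLeft (stdBasis n s)))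
        - toCov (η.curryLeft (stdBasis n s)) v • ext₁ (coframe (stdBasis n) s) := by
    intro s
    have h1 := ext₁_contr (coframe (stdBasis n) s) v
    have h2 := ext₁_contr (toCov (η.curryLeft (stdBasis n s))) v
    have c := Algebra.commutes (toCov (η.curryLeft (stdBasis n s)) v)
      (ext₁ (coframe (stdBasis n) s))
    rw [Algebra.smul_def, Algebra.smul_def]
    linear_combination (norm := noncomm_ring) h1 * ext₁ (toCov (η.curryLeft (stdBasis n s))) -
      ext₁ (coframe (stdBasis n) s) * h2 + c
  rw [wedgeL_two (stdBasis n), mul_smul_comm, smul_mul_assoc, Finset.mul_sum, Finset.sum_mul,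
    ← smul_sub, ← Finset.sum_sub_distrib, Finset.sum_congr rfl fun s _ => hs s]
  rw [Finset.sum_sub_distrib]
  have e1 : ∑ s, coframe (stdBasis n) s v • ext₁ (toCov (η.curryLeft (stdBasis n s))) =
      ext₁ (toCov (η.curryLeft v)) := by
    simp only [← map_smul, ← map_sum]
    congr 1
    ext1 w
    simp only [_root_.sum_apply, _root_.smul_apply, toCov_apply]
    have := sum_coframe_smul (stdBasis n) (η.curryLeft.toLinearMap) v
    exact (congrArg (fun x : Alt n 1 => x ![w]) this.symm ▸ by
      simp [ContinuousAlternatingMap.sum_apply])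
  have e2 : ∑ s, toCov (η.curryLeft (stdBasis n s)) v • ext₁ (coframe (stdBasis n) s) =
      -ext₁ (toCov (η.curryLeft v)) := by
    rw [← map_neg, cov_expand (stdBasis n) (-toCov (η.curryLeft v)), map_sum]
    refine Finset.sum_congr rfl fun s _ => ?_
    rw [map_smul]
    congr 1
    rw [_root_.neg_apply, toCov_apply, toCov_apply]
    have := η.toAlternatingMap.map_swap ![v, stdBasis n s] (i := 0) (j := 1) (by simp)
    rw [show (![v, stdBasis n s] ∘ Equiv.swap (0 : Fin 2) 1) = ![stdBasis n s, v] by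
      funext i; fin_cases i <;> simp] at this
    exact this
  rw [e1, e2, sub_neg_eq_add, ← two_smul ℂ, smul_smul]
  norm_num

end
end HermitianForms

namespace HermitianForms
noncomputable section

variable {n : ℕ}

/-! ### The inner product attached to a cometric -/

/-- The sesquilinear form induced on `k`-forms by a symmetric matrix `Q`, thought of as a metric on
covectors; `fibreInner w` is the case where `Q` is the inverse of the Gram matrix of `w`. -/
def cometricInner {k : ℕ} (Q : Matrix (Fin n ⊕ Fin n) (Fin n ⊕ Fin n) ℝ) (a b : Alt n k) : ℂ :=
  ((k.factorial : ℂ)⁻¹) * ∑ s : Fin k → Fin n ⊕ Fin n, ∑ t : Fin k → Fin n ⊕ Fin n,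
    (∏ i, ((Q (s i) (t i) : ℝ) : ℂ)) *
      a (fun i => stdBasis n (s i)) * (starRingEnd ℂ) (b (fun i => stdBasis n (t i)))

theorem fibreInner_eq {k : ℕ} (w : Alt n 2) (a b : Alt n k) :
    fibreInner w a b = cometricInner (gramMatrix w)⁻¹ a b := by
  simp only [fibreInner, cometricInner, stdBasis_apply]

theorem cometricInner_add_left {k : ℕ} (Q : Matrix (Fin n ⊕ Fin n) (Fin n ⊕ Fin n) ℝ)
    (a a' b : Alt n k) :
    cometricInner Q (a + a') b = cometricInner Q a b + cometricInner Q a' b := by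
  simp only [cometricInner, ContinuousAlternatingMap.add_apply, mul_add, add_mul,
    Finset.sum_add_distrib]

theorem cometricInner_smul_left {k : ℕ} (Q : Matrix (Fin n ⊕ Fin n) (Fin n ⊕ Fin n) ℝ)
    (r : ℂ) (a b : Alt n k) : cometricInner Q (r • a) b = r * cometricInner Q a b := by
  simp only [cometricInner, ContinuousAlternatingMap.smul_apply, smul_eq_mul, Finset.mul_sum]
  exact Finset.sum_congr rfl fun s _ => Finset.sum_congr rfl fun t _ => by ring

theorem cometricInner_conj_symm {k : ℕ} {Q : Matrix (Fin n ⊕ Fin n) (Fin n ⊕ Fin n) ℝ}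
    (hQ : Q.IsSymm) (a b : Alt n k) :
    (starRingEnd ℂ) (cometricInner Q a b) = cometricInner Q b a := by
  simp only [cometricInner, map_mul, map_sum, map_prod, Complex.conj_ofReal, Complex.conj_conj,
    map_inv₀, map_natCast]
  rw [Finset.sum_comm]
  congr 1
  refine Finset.sum_congr rfl fun s _ => Finset.sum_congr rfl fun t _ => ?_
  simp only [hQ.apply (s _)]
  ring

theorem cometricInner_conjAlt {k : ℕ} (Q : Matrix (Fin n ⊕ Fin n) (Fin n ⊕ Fin n) ℝ)
    (a b : Alt n k) :
    cometricInner Q (conjAlt a) (conjAlt b) = (starRingEnd ℂ) (cometricInner Q a b) := by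
  simp only [cometricInner, map_mul, map_sum, map_prod, Complex.conj_ofReal, map_inv₀, map_natCast]
  rfl

/-- Change of frame: the form attached to `N P Nᵀ` is the pull-back, under the map with matrix `N`,
of the form attached to `P`. -/
theorem cometricInner_comp {k : ℕ} (N P : Matrix (Fin n ⊕ Fin n) (Fin n ⊕ Fin n) ℝ)
    (A : Cn n →L[ℝ] Cn n) (hA : ∀ t, A (stdBasis n t) = ∑ s, N s t • stdBasis n s)
    (a b : Alt n k) :
    cometricInner (N * P * N.transpose) a b =
      cometricInner P (a.compContinuousLinearMap A) (b.compContinuousLinearMap A) := by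
  have expand : ∀ (a : Alt n k) (t : Fin k → Fin n ⊕ Fin n),
      a.compContinuousLinearMap A (fun i => stdBasis n (t i)) =
        ∑ r : Fin k → Fin n ⊕ Fin n, (∏ i, ((N (r i) (t i) : ℝ) : ℂ)) *
          a (fun i => stdBasis n (r i)) := by
    intro a t
    rw [ContinuousAlternatingMap.compContinuousLinearMap_apply]
    simp only [Function.comp_def, hA]
    have := a.toContinuousMultilinearMap.map_sum
      (fun (i : Fin k) (s : Fin n ⊕ Fin n) => N s (t i) • stdBasis n s)
    refine this.trans (Finset.sum_congr rfl fun r _ => ?_)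
    rw [a.toContinuousMultilinearMap.map_smul_univ, Complex.real_smul]
    push_cast
    rfl
  have prodexp : ∀ s t : Fin k → Fin n ⊕ Fin n,
      (∏ i, (((N * P * N.transpose) (s i) (t i) : ℝ) : ℂ)) =
        ∑ q : Fin k → Fin n ⊕ Fin n, ∑ p : Fin k → Fin n ⊕ Fin n,
          (∏ i, ((N (s i) (p i) : ℝ) : ℂ)) * (∏ i, ((P (p i) (q i) : ℝ) : ℂ)) *
            (∏ i, ((N (t i) (q i) : ℝ) : ℂ)) := by
    intro s t
    simp only [Matrix.mul_apply, Matrix.transpose_apply]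
    push_cast
    rw [Finset.prod_univ_sum, Fintype.piFinset_univ]
    refine Finset.sum_congr rfl fun q _ => ?_
    rw [Finset.prod_mul_distrib, Finset.prod_univ_sum, Fintype.piFinset_univ, Finset.sum_mul]
    exact Finset.sum_congr rfl fun p _ => by rw [Finset.prod_mul_distrib]
  simp only [cometricInner, expand, prodexp, map_sum, map_mul, map_prod, Complex.conj_ofReal,
    Finset.mul_sum, Finset.sum_mul]
  -- both sides are sums over the same four multi-indices
  have L : ∀ F : (Fin k → Fin n ⊕ Fin n) → (Fin k → Fin n ⊕ Fin n) → (Fin k → Fin n ⊕ Fin n) →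
      (Fin k → Fin n ⊕ Fin n) → ℂ, ∑ s, ∑ t, ∑ q, ∑ p, F s t q p =
        ∑ p, ∑ q, ∑ t, ∑ s, F s t q p := by
    intro F
    calc ∑ s, ∑ t, ∑ q, ∑ p, F s t q p = ∑ s, ∑ t, ∑ p, ∑ q, F s t q p :=
          Finset.sum_congr rfl fun s _ => Finset.sum_congr rfl fun t _ => Finset.sum_comm
      _ = ∑ s, ∑ p, ∑ t, ∑ q, F s t q p := Finset.sum_congr rfl fun s _ => Finset.sum_comm
      _ = ∑ p, ∑ s, ∑ t, ∑ q, F s t q p := Finset.sum_comm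
      _ = ∑ p, ∑ s, ∑ q, ∑ t, F s t q p :=
          Finset.sum_congr rfl fun p _ => Finset.sum_congr rfl fun s _ => Finset.sum_comm
      _ = ∑ p, ∑ q, ∑ s, ∑ t, F s t q p := Finset.sum_congr rfl fun p _ => Finset.sum_comm
      _ = ∑ p, ∑ q, ∑ t, ∑ s, F s t q p :=
          Finset.sum_congr rfl fun p _ => Finset.sum_congr rfl fun q _ => Finset.sum_comm
  rw [L]
  refine Finset.sum_congr rfl fun p _ => Finset.sum_congr rfl fun q _ =>
    Finset.sum_congr rfl fun t _ => Finset.sum_congr rfl fun s _ => ?_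
  ring

theorem alt_ext_basis {k : ℕ} {a b : Alt n k}
    (h : ∀ s : Fin k → Fin n ⊕ Fin n, a (fun i => stdBasis n (s i)) =
      b (fun i => stdBasis n (s i))) : a = b := by
  apply ContinuousAlternatingMap.toAlternatingMap_injective
  apply AlternatingMap.coe_multilinearMap_injective
  exact Module.Basis.ext_multilinear (fun _ => stdBasis n) h

theorem alt_eq_zero_of_lt {k : ℕ} (hk : 2 * n < k) (a : Alt n k) : a = 0 := by
  refine alt_ext_basis fun s => ?_
  refine a.map_eq_zero_of_not_injective _ fun hinj => ?_
  have : Function.Injective s := fun i j h => hinj (by simp [h])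
  have := Fintype.card_le_of_injective s this
  simp at this
  omega

theorem cometricInner_one_self {k : ℕ} (a : Alt n k) :
    cometricInner 1 a a = (((k.factorial : ℝ)⁻¹ * ∑ s : Fin k → Fin n ⊕ Fin n,
      Complex.normSq (a (fun i => stdBasis n (s i))) : ℝ) : ℂ) := by
  simp only [cometricInner]
  push_cast
  congr 1
  refine Finset.sum_congr rfl fun s _ => ?_
  rw [Finset.sum_eq_single s]
  · simp [Complex.mul_conj]
  · intro t _ hst
    obtain ⟨i, hi⟩ := Function.ne_iff.mp hst
    rw [Finset.prod_eq_zero (Finset.mem_univ i)]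
    · simp
    · rw [Matrix.one_apply_ne (Ne.symm hi)]
      simp
  · simp

open scoped MatrixOrder in
theorem exists_conjTranspose_mul_self {Q : Matrix (Fin n ⊕ Fin n) (Fin n ⊕ Fin n) ℝ}
    (hQ : Q.PosSemidef) : ∃ B, Q = B.conjTranspose * B :=
  ⟨CFC.sqrt Q, by
    rw [(Matrix.nonneg_iff_posSemidef.1 (CFC.sqrt_nonneg Q)).isHermitian.eq]
    exact (CFC.sqrt_mul_sqrt_self Q hQ.nonneg).symm⟩

theorem cometricInner_self_nonneg {k : ℕ} {Q : Matrix (Fin n ⊕ Fin n) (Fin n ⊕ Fin n) ℝ}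
    (hQ : Q.PosDef) (a : Alt n k) :
    0 ≤ cometricInner Q a a ∧ (cometricInner Q a a = 0 → a = 0) := by
  obtain ⟨B, hB⟩ := exists_conjTranspose_mul_self hQ.posSemidef
  -- `B ᵀ` is the matrix of an orthonormal frame
  have hB' : Q = B.transpose * 1 * B.transpose.transpose := by
    rw [hB, Matrix.conjTranspose_eq_transpose_of_trivial]; simp
  let A : Cn n →L[ℝ] Cn n :=
    LinearMap.toContinuousLinearMap (Matrix.toLin (stdBasis n) (stdBasis n) B.transpose)
  have hA : ∀ t, A (stdBasis n t) = ∑ s, B.transpose s t • stdBasis n s := fun t =>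
    Matrix.toLin_self _ _ _ _
  rw [hB', cometricInner_comp _ _ A hA, cometricInner_one_self]
  refine ⟨?_, fun h => ?_⟩
  · rw [Complex.zero_le_real]
    exact mul_nonneg (by positivity) (Finset.sum_nonneg fun s _ => Complex.normSq_nonneg _)
  · rw [Complex.ofReal_eq_zero, mul_eq_zero] at h
    have h0 := h.resolve_left (by positivity)
    rw [Finset.sum_eq_zero_iff_of_nonneg fun s _ => Complex.normSq_nonneg _] at h0
    have hz : a.compContinuousLinearMap A = 0 := alt_ext_basis fun s => by
      simpa using h0 s (Finset.mem_univ s)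
    have hdet : IsUnit B.transpose.det := by
      have := hQ.det_pos.ne'
      rw [hB, Matrix.det_mul] at this
      rw [Matrix.det_transpose]
      exact isUnit_iff_ne_zero.2 (right_ne_zero_of_mul this)
    ext v
    have hv : v = fun i => A (Matrix.toLin (stdBasis n) (stdBasis n) (B.transpose)⁻¹ (v i)) := by
      funext i
      change v i = Matrix.toLin (stdBasis n) (stdBasis n) B.transpose _
      rw [← LinearMap.comp_apply, ← Matrix.toLin_mul, Matrix.mul_nonsing_inv _ hdet,
        Matrix.toLin_one, LinearMap.id_apply]
    rw [hv]
    exact congrArg (fun c : Alt n k => c fun i =>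
      Matrix.toLin (stdBasis n) (stdBasis n) (B.transpose)⁻¹ (v i)) hz

/-! ### The inner product on forms of mixed degree -/

/-- The inner product induced by a cometric on forms of mixed degree. -/
def fibInner (Q : Matrix (Fin n ⊕ Fin n) (Fin n ⊕ Fin n) ℝ) (a b : Fib n) : ℂ :=
  ∑ k ∈ Finset.range (2 * n + 1), cometricInner Q (a k) (b k)

section fibInner

variable {Q : Matrix (Fin n ⊕ Fin n) (Fin n ⊕ Fin n) ℝ}

theorem fibInner_add_left (a a' b : Fib n) :
    fibInner Q (a + a') b = fibInner Q a b + fibInner Q a' b := by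
  simp [fibInner, cometricInner_add_left, Finset.sum_add_distrib]

theorem fibInner_smul_left (r : ℂ) (a b : Fib n) :
    fibInner Q (r • a) b = r * fibInner Q a b := by
  simp [fibInner, cometricInner_smul_left, Finset.mul_sum]

theorem fibInner_conj_symm (hQ : Q.IsSymm) (a b : Fib n) :
    (starRingEnd ℂ) (fibInner Q a b) = fibInner Q b a := by
  simp [fibInner, cometricInner_conj_symm hQ]

theorem fibInner_add_right (hQ : Q.IsSymm) (a b b' : Fib n) :
    fibInner Q a (b + b') = fibInner Q a b + fibInner Q a b' := by
  rw [← fibInner_conj_symm hQ, fibInner_add_left, map_add, fibInner_conj_symm hQ,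
    fibInner_conj_symm hQ]

theorem fibInner_smul_right (hQ : Q.IsSymm) (r : ℂ) (a b : Fib n) :
    fibInner Q a (r • b) = (starRingEnd ℂ) r * fibInner Q a b := by
  rw [← fibInner_conj_symm hQ, fibInner_smul_left, map_mul, fibInner_conj_symm hQ]

theorem fibInner_zero_left (b : Fib n) : fibInner Q 0 b = 0 := by
  simpa using fibInner_smul_left (Q := Q) 0 0 b

theorem fibInner_zero_right (hQ : Q.IsSymm) (b : Fib n) : fibInner Q b 0 = 0 := by
  simpa using fibInner_smul_right hQ 0 b 0

theorem fibInner_neg_left (a b : Fib n) : fibInner Q (-a) b = -fibInner Q a b := by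
  simpa using fibInner_smul_left (Q := Q) (-1) a b

theorem fibInner_neg_right (hQ : Q.IsSymm) (a b : Fib n) :
    fibInner Q a (-b) = -fibInner Q a b := by
  simpa using fibInner_smul_right hQ (-1) a b

theorem fibInner_sub_left (a a' b : Fib n) :
    fibInner Q (a - a') b = fibInner Q a b - fibInner Q a' b := by
  rw [sub_eq_add_neg, fibInner_add_left, fibInner_neg_left, sub_eq_add_neg]

theorem fibInner_sub_right (hQ : Q.IsSymm) (a b b' : Fib n) :
    fibInner Q a (b - b') = fibInner Q a b - fibInner Q a b' := by
  rw [sub_eq_add_neg, fibInner_add_right hQ, fibInner_neg_right hQ, sub_eq_add_neg]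

theorem fibInner_sum_left {ι : Type*} (s : Finset ι) (a : ι → Fib n) (b : Fib n) :
    fibInner Q (∑ i ∈ s, a i) b = ∑ i ∈ s, fibInner Q (a i) b := by
  classical
  induction s using Finset.induction_on with
  | empty => simp [fibInner_zero_left]
  | insert i s hi ih => rw [Finset.sum_insert hi, Finset.sum_insert hi, fibInner_add_left, ih]

theorem fibInner_self_nonneg (hQ : Q.PosDef) (a : Fib n) : 0 ≤ fibInner Q a a :=
  Finset.sum_nonneg fun k _ => (cometricInner_self_nonneg hQ (a k)).1

theorem fibInner_self_eq_zero (hQ : Q.PosDef) {a : Fib n} (h : fibInner Q a a = 0) : a = 0 := by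
  rw [fibInner, Finset.sum_eq_zero_iff_of_nonneg
    fun k _ => (cometricInner_self_nonneg hQ (a k)).1] at h
  refine Fib.ext fun k => ?_
  by_cases hk : 2 * n < k
  · exact alt_eq_zero_of_lt hk _
  · exact (cometricInner_self_nonneg hQ (a k)).2 (h k (Finset.mem_range.2 (by omega)))

theorem fibInner_ext (hQ : Q.PosDef) {a a' : Fib n}
    (h : ∀ b, fibInner Q a b = fibInner Q a' b) : a = a' := by
  rw [← sub_eq_zero]
  apply fibInner_self_eq_zero hQ
  rw [fibInner_sub_left, h, sub_self]

end fibInner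

/-! ### Adjoints at a point -/

/-- Contraction with the vector dual to a covector `α` for the cometric `Q`. -/
def contrCov (Q : Matrix (Fin n ⊕ Fin n) (Fin n ⊕ Fin n) ℝ) : Cov n →ₗ[ℂ] FibEnd n where
  toFun α := ∑ s, ∑ t, ((Q s t : ℂ) * α (stdBasis n s)) • contr (stdBasis n t)
  map_add' α β := by
    simp only [_root_.add_apply, mul_add, add_smul, Finset.sum_add_distrib]
  map_smul' r α := by
    simp only [_root_.smul_apply, smul_eq_mul, RingHom.id_apply, Finset.smul_sum, smul_smul]
    exact Finset.sum_congr rfl fun s _ => Finset.sum_congr rfl fun t _ => by ring_nf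

theorem contrCov_apply (Q : Matrix (Fin n ⊕ Fin n) (Fin n ⊕ Fin n) ℝ) (α : Cov n) :
    contrCov Q α = ∑ s, ∑ t, ((Q s t : ℂ) * α (stdBasis n s)) • contr (stdBasis n t) := rfl

/-- The complex conjugate of a covector. -/
def conjCov (α : Cov n) : Cov n := (Complex.conjCLE : ℂ →L[ℝ] ℂ).comp α

@[simp] theorem conjCov_apply (α : Cov n) (v : Cn n) :
    conjCov α v = (starRingEnd ℂ) (α v) := rfl

@[simp] theorem conjCov_conjCov (α : Cov n) : conjCov (conjCov α) = α := by
  ext1 v; simp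

@[simp] theorem conjCov_coframe (f : Module.Basis (Fin n ⊕ Fin n) ℝ (Cn n)) (s : Fin n ⊕ Fin n) :
    conjCov (coframe f s) = coframe f s := by
  ext1 v; simp

theorem contrCov_eval (Q : Matrix (Fin n ⊕ Fin n) (Fin n ⊕ Fin n) ℝ) (α : Cov n) (b : Fib n)
    (k : ℕ) (v : Fin k → Cn n) :
    contrCov Q α b k v = ∑ s, ∑ t, ((Q s t : ℂ) * α (stdBasis n s)) *
      b (k + 1) (Matrix.vecCons (stdBasis n t) v) := by
  rw [contrCov_apply]
  simp only [LinearMap.sum_apply, LinearMap.smul_apply, Fib.sum_apply, Fib.smul_apply,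
    ContinuousAlternatingMap.sum_apply, ContinuousAlternatingMap.smul_apply, smul_eq_mul,
    contr_apply]

theorem cometricInner_extMul (Q : Matrix (Fin n ⊕ Fin n) (Fin n ⊕ Fin n) ℝ) (α : Cov n)
    {k : ℕ} (a : Alt n k) (b : Fib n) :
    cometricInner Q (extMul α a) (b (k + 1)) =
      cometricInner Q a (contrCov Q (conjCov α) b k) := by
  simp only [cometricInner, contrCov_eval, extMul_apply, conjCov_apply, map_sum, map_mul,
    Complex.conj_conj, Complex.conj_ofReal, Finset.mul_sum, Finset.sum_mul]
  -- the slot occupied by `α` may be moved to the front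
  have key : ∀ i : Fin (k + 1),
      ∑ s : Fin (k + 1) → Fin n ⊕ Fin n, ∑ t : Fin (k + 1) → Fin n ⊕ Fin n,
        (((k + 1).factorial : ℂ)⁻¹) * ((∏ j, ((Q (s j) (t j) : ℝ) : ℂ)) *
        ((-1) ^ (i : ℕ) * (α (stdBasis n (s i)) *
          a (i.removeNth fun j => stdBasis n (s j)))) *
        (starRingEnd ℂ) (b (k + 1) (fun j => stdBasis n (t j)))) =
      (((k + 1).factorial : ℂ)⁻¹) * ∑ s₀, ∑ s : Fin k → Fin n ⊕ Fin n, ∑ t₀,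
        ∑ t : Fin k → Fin n ⊕ Fin n,
        (∏ j, ((Q (s j) (t j) : ℝ) : ℂ)) * a (fun j => stdBasis n (s j)) *
          (Q s₀ t₀ * α (stdBasis n s₀) * (starRingEnd ℂ)
            (b (k + 1) (Matrix.vecCons (stdBasis n t₀) fun j => stdBasis n (t j)))) := by
    intro i
    rw [← (Fin.insertNthEquiv (fun _ => Fin n ⊕ Fin n) i).sum_comp, Fintype.sum_prod_type,
      Finset.mul_sum]
    refine Finset.sum_congr rfl fun s₀ _ => ?_
    rw [Finset.mul_sum]
    refine Finset.sum_congr rfl fun s _ => ?_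
    rw [← (Fin.insertNthEquiv (fun _ => Fin n ⊕ Fin n) i).sum_comp, Fintype.sum_prod_type,
      Finset.mul_sum]
    refine Finset.sum_congr rfl fun t₀ _ => ?_
    rw [Finset.mul_sum]
    refine Finset.sum_congr rfl fun t _ => ?_
    simp only [Fin.insertNthEquiv_apply, Fin.prod_univ_succAbove _ i, Fin.insertNth_apply_same,
      Fin.insertNth_apply_succAbove]
    have e1 : (fun j => stdBasis n ((i.insertNth t₀ t : Fin (k + 1) → Fin n ⊕ Fin n) j)) =
        i.insertNth (stdBasis n t₀) (fun j => stdBasis n (t j)) := by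
      funext j
      refine Fin.succAboveCases i ?_ (fun j => ?_) j <;> simp
    have e2 : (i.removeNth fun j =>
        stdBasis n ((i.insertNth s₀ s : Fin (k + 1) → Fin n ⊕ Fin n) j)) =
        fun j => stdBasis n (s j) := by
      funext j; simp [Fin.removeNth]
    rw [e1, e2, (b (k + 1)).map_insertNth]
    have h2 : ((-1 : ℂ) ^ (i : ℕ)) * (-1) ^ (i : ℕ) = 1 := by rw [← mul_pow]; simp
    simp only [zsmul_eq_mul, map_mul, Int.cast_pow, Int.cast_neg, Int.cast_one, map_pow, map_neg,
      map_one]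
    linear_combination ((((k + 1).factorial : ℂ)⁻¹) * (Q s₀ t₀ * (∏ j, ((Q (s j) (t j) : ℝ) : ℂ))) *
      (α (stdBasis n s₀) * a (fun j => stdBasis n (s j))) * (starRingEnd ℂ)
            (b (k + 1) (Matrix.vecCons (stdBasis n t₀) fun j => stdBasis n (t j)))) * h2
  have step : ∀ F : (Fin (k + 1) → Fin n ⊕ Fin n) → (Fin (k + 1) → Fin n ⊕ Fin n) →
      Fin (k + 1) → ℂ, ∑ s, ∑ t, ∑ i, F s t i = ∑ i, ∑ s, ∑ t, F s t i := by
    intro F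
    rw [Finset.sum_congr rfl fun s _ => Finset.sum_comm, Finset.sum_comm]
  rw [step, Finset.sum_congr rfl fun i _ => key i]
  simp only [Finset.sum_const, Finset.card_univ, Fintype.card_fin, nsmul_eq_mul]
  rw [← mul_assoc, Nat.factorial_succ]
  have h3 : ((k + 1 : ℕ) : ℂ) ≠ 0 := by exact_mod_cast k.succ_ne_zero
  rw [show ((k + 1 : ℕ) : ℂ) * (((k + 1) * k.factorial : ℕ) : ℂ)⁻¹ = (k.factorial : ℂ)⁻¹ by
    push_cast at h3 ⊢
    field_simp]
  rw [Finset.sum_comm]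
  simp only [Finset.mul_sum]
  refine Finset.sum_congr rfl fun s _ => ?_
  -- reorder `s₀ t₀ t` into `t s₀ t₀`
  rw [Finset.sum_congr rfl fun s₀ _ => Finset.sum_comm, Finset.sum_comm]

/-- `P` and `P'` are adjoint for the inner product of the cometric `Q`. -/
def IsAdjAt (Q : Matrix (Fin n ⊕ Fin n) (Fin n ⊕ Fin n) ℝ) (P P' : FibEnd n) : Prop :=
  ∀ a b, fibInner Q (P a) b = fibInner Q a (P' b)

theorem isAdjAt_ext₁ (Q : Matrix (Fin n ⊕ Fin n) (Fin n ⊕ Fin n) ℝ) (α : Cov n) :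
    IsAdjAt Q (ext₁ α) (contrCov Q (conjCov α)) := by
  intro a b
  rw [fibInner, Finset.sum_range_succ', fibInner, Finset.sum_range_succ]
  have h0 : cometricInner Q (ext₁ α a 0) (b 0) = 0 := by
    simpa using cometricInner_smul_left Q 0 0 (b 0)
  have h1 : contrCov Q (conjCov α) b (2 * n) = 0 := by
    ext v
    rw [contrCov_eval, alt_eq_zero_of_lt (by omega) (b (2 * n + 1))]
    simp
  have h2 : cometricInner Q (a (2 * n)) (0 : Alt n (2 * n)) = 0 := by
    simp [cometricInner]
  rw [h0, h1, h2, add_zero, add_zero]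
  exact Finset.sum_congr rfl fun k _ => cometricInner_extMul Q α (a k) b

end
end HermitianForms

namespace HermitianForms
noncomputable section

variable {n : ℕ}

/-! ### Adjoint pairs -/

section IsAdjAt

variable {Q : Matrix (Fin n ⊕ Fin n) (Fin n ⊕ Fin n) ℝ} {P P' R R' : FibEnd n}

theorem IsAdjAt.symm (hQ : Q.IsSymm) (h : IsAdjAt Q P P') : IsAdjAt Q P' P := fun a b => by
  rw [← fibInner_conj_symm hQ, ← h, fibInner_conj_symm hQ]

theorem IsAdjAt.mul (h : IsAdjAt Q P P') (h' : IsAdjAt Q R R') : IsAdjAt Q (P * R) (R' * P') :=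
  fun a b => by
    rw [Module.End.mul_apply, h, h', Module.End.mul_apply]

theorem IsAdjAt.add (hQ : Q.IsSymm) (h : IsAdjAt Q P P') (h' : IsAdjAt Q R R') :
    IsAdjAt Q (P + R) (P' + R') := fun a b => by
  rw [LinearMap.add_apply, fibInner_add_left, h, h', ← fibInner_add_right hQ]
  rfl

theorem IsAdjAt.sub (hQ : Q.IsSymm) (h : IsAdjAt Q P P') (h' : IsAdjAt Q R R') :
    IsAdjAt Q (P - R) (P' - R') := fun a b => by
  rw [LinearMap.sub_apply, fibInner_sub_left, h, h', ← fibInner_sub_right hQ]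
  rfl

theorem IsAdjAt.smul (hQ : Q.IsSymm) (r : ℂ) (h : IsAdjAt Q P P') :
    IsAdjAt Q (r • P) ((starRingEnd ℂ) r • P') := fun a b => by
  rw [LinearMap.smul_apply, fibInner_smul_left, h, LinearMap.smul_apply, fibInner_smul_right hQ,
    Complex.conj_conj]

theorem isAdjAt_zero (hQ : Q.IsSymm) : IsAdjAt Q 0 0 := fun a b => by
  rw [LinearMap.zero_apply, LinearMap.zero_apply, fibInner_zero_left, fibInner_zero_right hQ]

theorem IsAdjAt.sum (hQ : Q.IsSymm) {ι : Type*} (s : Finset ι) (P P' : ι → FibEnd n)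
    (h : ∀ i ∈ s, IsAdjAt Q (P i) (P' i)) : IsAdjAt Q (∑ i ∈ s, P i) (∑ i ∈ s, P' i) := by
  classical
  induction s using Finset.induction_on with
  | empty => exact isAdjAt_zero hQ
  | insert i s hi ih =>
    rw [Finset.sum_insert hi, Finset.sum_insert hi]
    exact (h i (Finset.mem_insert_self _ _)).add hQ
      (ih fun j hj => h j (Finset.mem_insert_of_mem hj))

theorem IsAdjAt.left_unique (hQ : Q.PosDef) (h : IsAdjAt Q P R) (h' : IsAdjAt Q P' R) : P = P' :=
  LinearMap.ext fun a => fibInner_ext hQ fun b => by rw [h, h']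

theorem _root_.Matrix.PosDef.isSymm' (hQ : Q.PosDef) : Q.IsSymm := by
  have := hQ.isHermitian
  rwa [Matrix.IsHermitian, Matrix.conjTranspose_eq_transpose_of_trivial] at this

theorem IsAdjAt.right_unique (hQ : Q.PosDef) (h : IsAdjAt Q R P) (h' : IsAdjAt Q R P') : P = P' :=
  (h.symm hQ.isSymm').left_unique hQ (h'.symm hQ.isSymm')

end IsAdjAt

/-- The adjoint of `α ∧ ·` for the cometric `Q`, defined by recursion on the degree of `α` along
`α = (p + 1)⁻¹ ∑ b^s ∧ ι_s α`. -/
def wedgeAdj (Q : Matrix (Fin n ⊕ Fin n) (Fin n ⊕ Fin n) ℝ) : ∀ {p : ℕ}, Alt n p → FibEnd n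
  | 0, α => algebraMap ℂ (FibEnd n) ((starRingEnd ℂ) (α ![]))
  | p + 1, α => ((p : ℂ) + 1)⁻¹ • ∑ s, wedgeAdj Q (α.curryLeft (stdBasis n s)) *
      contrCov Q (coframe (stdBasis n) s)

theorem wedgeAdj_zero (Q : Matrix (Fin n ⊕ Fin n) (Fin n ⊕ Fin n) ℝ) (α : Alt n 0) :
    wedgeAdj Q α = algebraMap ℂ (FibEnd n) ((starRingEnd ℂ) (α ![])) := rfl

theorem wedgeAdj_succ (Q : Matrix (Fin n ⊕ Fin n) (Fin n ⊕ Fin n) ℝ) {p : ℕ}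
    (α : Alt n (p + 1)) :
    wedgeAdj Q α = ((p : ℂ) + 1)⁻¹ • ∑ s, wedgeAdj Q (α.curryLeft (stdBasis n s)) *
      contrCov Q (coframe (stdBasis n) s) := rfl

theorem isAdjAt_wedgeL {Q : Matrix (Fin n ⊕ Fin n) (Fin n ⊕ Fin n) ℝ} (hQ : Q.IsSymm) {p : ℕ}
    (α : Alt n p) : IsAdjAt Q (wedgeL α) (wedgeAdj Q α) := by
  induction p with
  | zero =>
    rw [wedgeL_zero, wedgeAdj_zero, Algebra.algebraMap_eq_smul_one, Algebra.algebraMap_eq_smul_one]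
    exact IsAdjAt.smul hQ _ fun a b => rfl
  | succ p ih =>
    rw [wedgeL_succ (stdBasis n), wedgeAdj_succ]
    have := IsAdjAt.smul hQ ((p : ℂ) + 1)⁻¹ (IsAdjAt.sum hQ Finset.univ _ _ fun s _ =>
      (isAdjAt_ext₁ Q (coframe (stdBasis n) s)).mul (ih (α.curryLeft (stdBasis n s))))
    simpa using this

theorem wedgeAdj_three (Q : Matrix (Fin n ⊕ Fin n) (Fin n ⊕ Fin n) ℝ) (θ : Alt n 3) :
    wedgeAdj Q θ = (6 : ℂ)⁻¹ • ∑ s, ∑ t, ∑ u,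
      (starRingEnd ℂ) (θ ![stdBasis n s, stdBasis n t, stdBasis n u]) •
      (contrCov Q (coframe (stdBasis n) u) * contrCov Q (coframe (stdBasis n) t) *
        contrCov Q (coframe (stdBasis n) s)) := by
  simp only [wedgeAdj_succ, wedgeAdj_zero, Finset.sum_mul, smul_mul_assoc, Finset.smul_sum,
    smul_smul, ← Algebra.smul_def]
  refine Finset.sum_congr rfl fun s _ => Finset.sum_congr rfl fun t _ =>
    Finset.sum_congr rfl fun u _ => ?_
  congr 1
  have e : (((θ.curryLeft (stdBasis n s)).curryLeft (stdBasis n t)).curryLeft (stdBasis n u)) ![] =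
    θ ![stdBasis n s, stdBasis n t, stdBasis n u] := rfl
  rw [e, ← mul_assoc, ← mul_assoc]
  congr 1
  push_cast
  norm_num

/-! ### Generation by exterior multiplications -/

/-- The constant form `1`. -/
def vac (n : ℕ) : Fib n
  | 0 => ContinuousAlternatingMap.constOfIsEmpty ℝ (Cn n) (Fin 0) 1
  | _ + 1 => 0

/-- The form concentrated in degree `k`. -/
def single (k : ℕ) (a : Alt n k) : Fib n := fun m =>
  if h : k = m then h ▸ a else 0

theorem single_same (k : ℕ) (a : Alt n k) : single k a k = a := by simp [single]

theorem single_ne {k m : ℕ} (h : m ≠ k) (a : Alt n k) : single k a m = 0 := by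
  simp [single, Ne.symm h]

theorem sum_single (a : Fib n) : a = ∑ k ∈ Finset.range (2 * n + 1), single k (a k) := by
  refine Fib.ext fun m => ?_
  rw [Fib.sum_apply]
  by_cases hm : m < 2 * n + 1
  · rw [Finset.sum_eq_single_of_mem m (Finset.mem_range.2 hm), single_same]
    exact fun k _ hk => single_ne (Ne.symm hk) _
  · rw [alt_eq_zero_of_lt (by omega) (a m), Finset.sum_eq_zero]
    intro k hk
    exact single_ne (by have := Finset.mem_range.1 hk; omega) _

/-- Forms are generated from the constant form `1` by exterior multiplications. -/
theorem fib_span (S : Submodule ℂ (Fib n)) (h0 : vac n ∈ S)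
    (h : ∀ α a, a ∈ S → ext₁ α a ∈ S) (a : Fib n) : a ∈ S := by
  have key : ∀ (k : ℕ) (b : Alt n k), single k b ∈ S := by
    intro k
    induction k with
    | zero =>
      intro b
      have : single 0 b = b ![] • vac n := by
        refine Fib.ext fun m => ?_
        cases m with
        | zero =>
          rw [single_same]
          ext v
          rw [Subsingleton.elim v ![]]
          simp [vac]
        | succ m => rw [single_ne (by omega)]; simp [vac]
      rw [this]
      exact S.smul_mem _ h0
    | succ k ih =>
      intro b
      have : single (k + 1) b = ((k : ℂ) + 1)⁻¹ • ∑ s, ext₁ (coframe (stdBasis n) s)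
          (single k (b.curryLeft (stdBasis n s))) := by
        refine Fib.ext fun m => ?_
        rw [Fib.smul_apply, Fib.sum_apply]
        cases m with
        | zero => rw [single_ne (by omega)]; simp
        | succ m =>
          by_cases hm : m = k
          · subst hm
            rw [single_same]
            conv_lhs => rw [alt_expand (stdBasis n) b]
            simp only [ext₁_succ, single_same]
          · rw [single_ne (by omega), Finset.sum_eq_zero, alt_smul_zero]
            intro s _
            rw [ext₁_succ, single_ne hm]
            ext v
            simp [extMul_apply]
      rw [this]
      exact S.smul_mem _ (S.sum_mem fun s _ => h _ _ (ih _))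
  rw [sum_single a]
  exact S.sum_mem fun k _ => key k _

/-- An operator that commutes with exterior multiplications and kills `1` vanishes. -/
theorem fibEnd_eq_zero_of_ext₁ (P : FibEnd n) (h0 : P (vac n) = 0)
    (h : ∀ α, P * ext₁ α = ext₁ α * P) : P = 0 := by
  refine LinearMap.ext fun a => ?_
  refine LinearMap.mem_ker.1 (fib_span (LinearMap.ker P) h0 (fun α a ha => ?_) a)
  rw [LinearMap.mem_ker] at ha ⊢
  have := congrArg (fun R : FibEnd n => R a) (h α)
  simp only [Module.End.mul_apply, ha, map_zero] at this
  exact this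

theorem contr_vac (v : Cn n) : contr v (vac n) = 0 := by
  refine Fib.ext fun k => ?_
  ext w
  rw [contr_apply]
  rfl

theorem contrCov_vac (Q : Matrix (Fin n ⊕ Fin n) (Fin n ⊕ Fin n) ℝ) (α : Cov n) :
    contrCov Q α (vac n) = 0 := by
  simp only [contrCov_apply, LinearMap.sum_apply, LinearMap.smul_apply, contr_vac, smul_zero,
    Finset.sum_const_zero]

theorem wedgeAdj_vac (Q : Matrix (Fin n ⊕ Fin n) (Fin n ⊕ Fin n) ℝ) {p : ℕ} (α : Alt n (p + 1)) :
    wedgeAdj Q α (vac n) = 0 := by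
  simp only [wedgeAdj_succ, LinearMap.smul_apply, LinearMap.sum_apply, Module.End.mul_apply,
    contrCov_vac, map_zero, Finset.sum_const_zero, smul_zero]

/-- The operator multiplying `k`-forms by `k`. -/
def degOp (n : ℕ) : FibEnd n where
  toFun a := fun k => (k : ℂ) • a k
  map_add' a b := Fib.ext fun k => smul_add (k : ℂ) (a k) (b k)
  map_smul' r a := Fib.ext fun k => smul_comm (k : ℂ) r (a k)

theorem degOp_apply (a : Fib n) (k : ℕ) : degOp n a k = (k : ℂ) • a k := rfl

theorem degOp_wedgeL {p : ℕ} (α : Alt n p) :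
    degOp n * wedgeL α - wedgeL α * degOp n = (p : ℂ) • wedgeL α := by
  refine LinearMap.ext fun a => Fib.ext fun m => ?_
  rw [LinearMap.sub_apply, Fib.sub_apply, Module.End.mul_apply, Module.End.mul_apply, degOp_apply,
    LinearMap.smul_apply, Fib.smul_apply]
  by_cases hm : p ≤ m
  · obtain ⟨q, hq⟩ := Nat.exists_eq_add_of_le hm
    rw [wedgeL_apply hq.symm, wedgeL_apply hq.symm, degOp_apply, wedge_smul_right]
    generalize wedge hq.symm α (a q) = c
    ext v
    simp only [ContinuousAlternatingMap.sub_apply, ContinuousAlternatingMap.smul_apply,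
      smul_eq_mul, hq]
    push_cast
    ring
  · rw [wedgeL_of_lt (by omega), wedgeL_of_lt (by omega)]
    simp

theorem degOp_ext₁ (α : Cov n) :
    degOp n * ext₁ α - ext₁ α * degOp n = ext₁ α := by
  have h := degOp_wedgeL (ContinuousAlternatingMap.ofSubsingleton ℝ (Cn n) ℂ (0 : Fin 1) α)
  have e : toCov (ContinuousAlternatingMap.ofSubsingleton ℝ (Cn n) ℂ (0 : Fin 1) α) = α :=
    Equiv.symm_apply_apply _ _
  simpa [wedgeL_one, e] using h

theorem degOp_vac : degOp n (vac n) = 0 := by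
  refine Fib.ext fun k => ?_
  rw [degOp_apply]
  cases k with
  | zero =>
    generalize vac n 0 = a
    ext v
    simp
  | succ k => exact alt_smul_zero _

theorem isAdjAt_degOp {Q : Matrix (Fin n ⊕ Fin n) (Fin n ⊕ Fin n) ℝ} (hQ : Q.IsSymm) :
    IsAdjAt Q (degOp n) (degOp n) := by
  intro a b
  refine Finset.sum_congr rfl fun k _ => ?_
  rw [degOp_apply, degOp_apply, cometricInner_smul_left]
  generalize a k = a
  generalize b k = b
  rw [← cometricInner_conj_symm hQ ((k : ℂ) • b), cometricInner_smul_left, map_mul,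
    cometricInner_conj_symm hQ, Complex.conj_natCast]

/-! ### Clifford relations -/

section Clifford

variable (Q : Matrix (Fin n ⊕ Fin n) (Fin n ⊕ Fin n) ℝ)

/-- The `ℂ`-bilinear extension of the cometric to covectors. -/
def covPair (α β : Cov n) : ℂ :=
  ∑ s, ∑ t, (Q s t : ℂ) * β (stdBasis n s) * α (stdBasis n t)

theorem ext₁_contrCov (α β : Cov n) :
    ext₁ α * contrCov Q β + contrCov Q β * ext₁ α = algebraMap ℂ (FibEnd n) (covPair Q α β) := by
  simp only [contrCov_apply, Finset.mul_sum, Finset.sum_mul, mul_smul_comm, smul_mul_assoc,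
    ← Finset.sum_add_distrib, ← smul_add, ext₁_contr, covPair, map_sum, map_mul]
  refine Finset.sum_congr rfl fun s _ => Finset.sum_congr rfl fun t _ => ?_
  rw [Algebra.smul_def, map_mul]

/-- Contraction of a `2`-form with the vector dual to a covector `β`. -/
def contrTwo (β : Cov n) (η : Alt n 2) : Cov n :=
  ∑ s, ∑ t, ((Q s t : ℂ) * β (stdBasis n s)) • toCov (η.curryLeft (stdBasis n t))

theorem contrTwo_apply (β : Cov n) (η : Alt n 2) (v : Cn n) :
    contrTwo Q β η v = ∑ s, ∑ t, ((Q s t : ℂ) * β (stdBasis n s)) * η ![stdBasis n t, v] := by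
  simp only [contrTwo, _root_.sum_apply, _root_.smul_apply, smul_eq_mul, toCov_apply]
  rfl

theorem contrCov_wedgeL_two (β : Cov n) (η : Alt n 2) :
    contrCov Q β * wedgeL η - wedgeL η * contrCov Q β = ext₁ (contrTwo Q β η) := by
  simp only [contrCov_apply, Finset.mul_sum, Finset.sum_mul, mul_smul_comm, smul_mul_assoc,
    ← Finset.sum_sub_distrib, ← smul_sub, contr_wedgeL_two, contrTwo, map_sum, map_smul]

theorem contrCov_anticomm (α β : Cov n) :
    contrCov Q α * contrCov Q β = -(contrCov Q β * contrCov Q α) := by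
  simp only [contrCov_apply, Finset.mul_sum, Finset.sum_mul, mul_smul_comm, smul_mul_assoc,
    Finset.smul_sum, smul_smul, ← Finset.sum_neg_distrib]
  have L : ∀ F : (Fin n ⊕ Fin n) → (Fin n ⊕ Fin n) → (Fin n ⊕ Fin n) → (Fin n ⊕ Fin n) →
      FibEnd n, ∑ s, ∑ t, ∑ q, ∑ p, F s t q p = ∑ q, ∑ p, ∑ s, ∑ t, F s t q p := by
    intro F
    rw [Finset.sum_congr rfl fun s _ => Finset.sum_comm, Finset.sum_comm]
    refine Finset.sum_congr rfl fun q _ => ?_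
    rw [Finset.sum_congr rfl fun s _ => Finset.sum_comm, Finset.sum_comm]
  rw [L]
  refine Finset.sum_congr rfl fun q _ => Finset.sum_congr rfl fun p _ =>
    Finset.sum_congr rfl fun s _ => Finset.sum_congr rfl fun t _ => ?_
  rw [contr_anticomm, smul_neg, mul_comm]

end Clifford

end
end HermitianForms

namespace HermitianForms
noncomputable section

variable {n : ℕ}

/-! ### Real `(1,1)`-forms and Hermitian metrics at a point -/

/-- Multiplication by `i` on `ℂⁿ`, as a real-linear map. -/
def mulI (n : ℕ) : Cn n →L[ℝ] Cn n := Complex.I • ContinuousLinearMap.id ℝ (Cn n)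

@[simp] theorem mulI_apply (v : Cn n) : mulI n v = Complex.I • v := rfl

theorem mulI_mulI (v : Cn n) : mulI n (mulI n v) = -v := by
  simp [smul_smul]

/-- A real form of type `(1,1)` on `ℂⁿ`. -/
structure IsRealOneOne (η : Alt n 2) : Prop where
  real : ∀ v w, (η ![v, w]).im = 0
  type : ∀ v w, η ![Complex.I • v, Complex.I • w] = η ![v, w]

/-- The fundamental form of a Hermitian metric on the vector space `ℂⁿ`. -/
structure IsHermitianAt (w : Alt n 2) : Prop extends IsRealOneOne w where
  pos : ∀ v, v ≠ 0 → 0 < (w ![v, Complex.I • v]).re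

/-- A `2`-form as a bilinear form. -/
def bil (η : Alt n 2) : Cn n →ₗ[ℝ] Cn n →ₗ[ℝ] ℂ :=
  LinearMap.mk₂ ℝ (fun v w => toCov (η.curryLeft v) w)
    (fun v v' w => by
      rw [toCov_apply, toCov_apply, toCov_apply, map_add]; rfl)
    (fun r v w => by
      rw [toCov_apply, toCov_apply, map_smul]; rfl)
    (fun v w w' => map_add _ _ _)
    (fun r v w => map_smul _ _ _)

theorem bil_apply (η : Alt n 2) (v w : Cn n) : bil η v w = η ![v, w] :=
  toCov_apply (η.curryLeft v) w

theorem bil_swap (η : Alt n 2) (v w : Cn n) : bil η v w = -bil η w v := by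
  have := η.toAlternatingMap.map_swap ![w, v] (i := 0) (j := 1) (by simp)
  rw [show (![w, v] ∘ Equiv.swap (0 : Fin 2) 1) = ![v, w] by
    funext i; fin_cases i <;> simp] at this
  rw [bil_apply, bil_apply]
  exact this

theorem sum_stdBasis_smul {M : Type*} [AddCommGroup M] [Module ℝ M] (T : Cn n →ₗ[ℝ] M)
    (v : Cn n) : ∑ s, (stdBasis n).repr v s • T (stdBasis n s) = T v := by
  conv_rhs => rw [← (stdBasis n).sum_repr v]
  simp only [map_sum, map_smul]

/-- The matrix of multiplication by `i`. -/
def mulIMatrix (n : ℕ) : Matrix (Fin n ⊕ Fin n) (Fin n ⊕ Fin n) ℝ :=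
  Matrix.of fun s t => (stdBasis n).repr (mulI n (stdBasis n t)) s

theorem mulI_stdBasis (t : Fin n ⊕ Fin n) :
    mulI n (stdBasis n t) = ∑ s, mulIMatrix n s t • stdBasis n s :=
  ((stdBasis n).sum_repr _).symm

section OneOne

variable {η : Alt n 2}

theorem gramMatrix_apply (η : Alt n 2) (s t : Fin n ⊕ Fin n) :
    gramMatrix η s t = (bil η (stdBasis n s) (mulI n (stdBasis n t))).re := by
  simp only [gramMatrix, Matrix.of_apply, stdBasis_apply, bil_apply, mulI_apply]

theorem IsRealOneOne.ofReal_re (h : IsRealOneOne η) (v w : Cn n) :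
    (((bil η v w).re : ℝ) : ℂ) = bil η v w :=
  Complex.ext rfl (by rw [bil_apply, h.real]; rfl)

theorem IsRealOneOne.bil_mulI (h : IsRealOneOne η) (v w : Cn n) :
    bil η (mulI n v) (mulI n w) = bil η v w := by
  rw [bil_apply, bil_apply]; exact h.type v w

theorem IsRealOneOne.bil_mulI_left (h : IsRealOneOne η) (v w : Cn n) :
    bil η (mulI n v) w = -bil η v (mulI n w) := by
  rw [← h.bil_mulI v, mulI_mulI, map_neg, neg_neg]

theorem IsRealOneOne.ofReal_gramMatrix (h : IsRealOneOne η) (s t : Fin n ⊕ Fin n) :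
    ((gramMatrix η s t : ℝ) : ℂ) = bil η (stdBasis n s) (mulI n (stdBasis n t)) := by
  rw [gramMatrix_apply, h.ofReal_re]

theorem IsRealOneOne.gramMatrix_isSymm (h : IsRealOneOne η) : (gramMatrix η).IsSymm := by
  ext s t
  rw [Matrix.transpose_apply, gramMatrix_apply, gramMatrix_apply, bil_swap, h.bil_mulI_left,
    neg_neg]

theorem IsHermitianAt.gramMatrix_posDef {w : Alt n 2} (h : IsHermitianAt w) :
    (gramMatrix w).PosDef := by
  refine Matrix.PosDef.of_dotProduct_mulVec_pos ?_ fun x hx => ?_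
  · rw [Matrix.IsHermitian, Matrix.conjTranspose_eq_transpose_of_trivial]
    exact h.toIsRealOneOne.gramMatrix_isSymm
  · have e : (star x ⬝ᵥ (gramMatrix w).mulVec x) =
        (bil w (∑ s, x s • stdBasis n s) (mulI n (∑ s, x s • stdBasis n s))).re := by
      simp only [map_sum, map_smul, LinearMap.sum_apply, LinearMap.smul_apply, Complex.re_sum,
        dotProduct, Matrix.mulVec, gramMatrix_apply, Finset.mul_sum, Finset.smul_sum]
      rw [Finset.sum_comm]
      refine Finset.sum_congr rfl fun s _ => Finset.sum_congr rfl fun t _ => ?_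
      simp only [Complex.real_smul, Complex.re_ofReal_mul, Pi.star_apply, star_trivial]
      ring
    rw [e, bil_apply]
    refine h.pos _ fun h0 => hx ?_
    funext s
    have := congrArg (fun v => (stdBasis n).repr v s) h0
    rwa [Module.Basis.repr_sum_self, map_zero] at this

end OneOne

/-- The cometric of a Hermitian metric: the inverse of its Gram matrix. -/
def cometric (w : Alt n 2) : Matrix (Fin n ⊕ Fin n) (Fin n ⊕ Fin n) ℝ := (gramMatrix w)⁻¹

/-- The covector `α ∘ i`. -/
def covI (α : Cov n) : Cov n := α.comp (mulI n)

@[simp] theorem covI_apply (α : Cov n) (v : Cn n) : covI α v = α (Complex.I • v) := rfl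

theorem covI_covI (α : Cov n) : covI (covI α) = -α := by
  ext1 v
  change α (mulI n (mulI n v)) = -α v
  rw [mulI_mulI, map_neg]

theorem conjCov_covI (α : Cov n) : conjCov (covI α) = covI (conjCov α) := rfl

/-- The Lefschetz operator at a point. -/
def lefAt (w : Alt n 2) : FibEnd n := wedgeL w

/-- The adjoint of the Lefschetz operator at a point. -/
def lamAt (w : Alt n 2) : FibEnd n := wedgeAdj (cometric w) w

section Metric

variable {w : Alt n 2}

theorem IsHermitianAt.cometric_posDef (h : IsHermitianAt w) : (cometric w).PosDef := h.gramMatrix_posDef.inv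

theorem IsHermitianAt.cometric_isSymm (h : IsHermitianAt w) : (cometric w).IsSymm := h.cometric_posDef.isSymm'

theorem IsHermitianAt.det_isUnit (h : IsHermitianAt w) : IsUnit (gramMatrix w).det :=
  isUnit_iff_ne_zero.2 h.gramMatrix_posDef.det_pos.ne'

/-- `∑ Q_{st} β(b_s) w(b_t, ·) = -β ∘ i`. -/
theorem IsHermitianAt.contrTwo_self (h : IsHermitianAt w) (β : Cov n) :
    contrTwo (cometric w) β w = -covI β := by
  ext1 v
  obtain ⟨u, rfl⟩ : ∃ u, v = mulI n u := ⟨-mulI n v, by rw [map_neg, mulI_mulI, neg_neg]⟩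
  rw [contrTwo_apply, _root_.neg_apply]
  change _ = -β (mulI n (mulI n u))
  rw [mulI_mulI, map_neg, neg_neg]
  have hu : ∀ t, (w ![stdBasis n t, mulI n u]) =
      ∑ r, ((gramMatrix w t r : ℝ) : ℂ) * ((stdBasis n).repr u r : ℝ) := by
    intro t
    rw [← bil_apply]
    conv_lhs => rw [← (stdBasis n).sum_repr u]
    simp only [map_sum, map_smul, h.toIsRealOneOne.ofReal_gramMatrix, Complex.real_smul]
    exact Finset.sum_congr rfl fun r _ => mul_comm _ _
  have hQ : cometric w * gramMatrix w = 1 := Matrix.nonsing_inv_mul _ h.det_isUnit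
  calc ∑ s, ∑ t, ((cometric w s t : ℝ) : ℂ) * β (stdBasis n s) * w ![stdBasis n t, mulI n u]
      = ∑ s, ∑ r, (((cometric w * gramMatrix w) s r : ℝ) : ℂ) * β (stdBasis n s) *
          ((stdBasis n).repr u r : ℝ) := by
        refine Finset.sum_congr rfl fun s _ => ?_
        simp only [hu, Finset.mul_sum, Matrix.mul_apply, Complex.ofReal_sum, Finset.sum_mul]
        rw [Finset.sum_comm]
        refine Finset.sum_congr rfl fun r _ => Finset.sum_congr rfl fun t _ => ?_
        push_cast
        ring
    _ = ∑ s, β (stdBasis n s) * ((stdBasis n).repr u s : ℝ) := by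
        refine Finset.sum_congr rfl fun s _ => ?_
        rw [hQ, Finset.sum_eq_single s]
        · simp
        · intro r _ hr
          simp [Matrix.one_apply_ne (Ne.symm hr)]
        · simp
    _ = β u := by
        rw [← β.coe_coe, ← sum_stdBasis_smul β.toLinearMap u]
        refine Finset.sum_congr rfl fun s _ => ?_
        rw [Complex.real_smul, mul_comm]

/-- The cometric is `i`-invariant. -/
theorem IsHermitianAt.sum_cometric_mulI (h : IsHermitianAt w) (B : Cn n →ₗ[ℝ] Cn n →ₗ[ℝ] ℂ) :
    ∑ s, ∑ t, ((cometric w s t : ℝ) : ℂ) * B (mulI n (stdBasis n s)) (stdBasis n t) =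
      -∑ s, ∑ t, ((cometric w s t : ℝ) : ℂ) * B (stdBasis n s) (mulI n (stdBasis n t)) := by
  have hG : gramMatrix w * mulIMatrix n = -((mulIMatrix n).transpose * gramMatrix w) := by
    ext s t
    rw [Matrix.mul_apply, Matrix.neg_apply, Matrix.mul_apply]
    have e1 : ∑ r, gramMatrix w s r * mulIMatrix n r t =
        (bil w (stdBasis n s) (mulI n (mulI n (stdBasis n t)))).re := by
      rw [mulI_stdBasis t]
      simp only [map_sum, map_smul, Complex.re_sum, gramMatrix_apply]
      exact Finset.sum_congr rfl fun r _ => by simp [mul_comm]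
    have e2 : ∑ r, (mulIMatrix n).transpose s r * gramMatrix w r t =
        (bil w (mulI n (stdBasis n s)) (mulI n (stdBasis n t))).re := by
      conv_rhs => rw [mulI_stdBasis s]
      simp only [map_sum, map_smul, LinearMap.sum_apply, LinearMap.smul_apply, Complex.re_sum,
        gramMatrix_apply, Matrix.transpose_apply]
      exact Finset.sum_congr rfl fun r _ => by simp
    rw [e1, e2, h.bil_mulI, mulI_mulI, map_neg, Complex.neg_re]
  have hQ1 : cometric w * gramMatrix w = 1 := Matrix.nonsing_inv_mul _ h.det_isUnit
  have hQ2 : gramMatrix w * cometric w = 1 := Matrix.mul_nonsing_inv _ h.det_isUnit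
  have hJ : mulIMatrix n * cometric w = -(cometric w * (mulIMatrix n).transpose) := by
    calc mulIMatrix n * cometric w = cometric w * (gramMatrix w * mulIMatrix n) * cometric w := by
          rw [← Matrix.mul_assoc, hQ1, Matrix.one_mul]
      _ = -(cometric w * (mulIMatrix n).transpose * (gramMatrix w * cometric w)) := by
          rw [hG]; simp only [Matrix.mul_neg, Matrix.neg_mul, Matrix.mul_assoc]
      _ = _ := by rw [hQ2, Matrix.mul_one]
  have e1 : ∑ s, ∑ t, ((cometric w s t : ℝ) : ℂ) * B (mulI n (stdBasis n s)) (stdBasis n t) =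
      ∑ r, ∑ t, (((mulIMatrix n * cometric w) r t : ℝ) : ℂ) * B (stdBasis n r) (stdBasis n t) := by
    simp only [mulI_stdBasis, map_sum, map_smul, LinearMap.sum_apply, LinearMap.smul_apply,
      Matrix.mul_apply, Complex.ofReal_sum, Finset.sum_mul, Finset.mul_sum, Complex.real_smul]
    rw [Finset.sum_congr rfl fun s _ => Finset.sum_comm, Finset.sum_comm]
    refine Finset.sum_congr rfl fun r _ => ?_
    rw [Finset.sum_comm]
    refine Finset.sum_congr rfl fun t _ => Finset.sum_congr rfl fun s _ => ?_
    push_cast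
    ring
  have e2 : ∑ s, ∑ t, ((cometric w s t : ℝ) : ℂ) * B (stdBasis n s) (mulI n (stdBasis n t)) =
      ∑ s, ∑ r, (((cometric w * (mulIMatrix n).transpose) s r : ℝ) : ℂ) *
        B (stdBasis n s) (stdBasis n r) := by
    simp only [mulI_stdBasis, map_sum, map_smul, Matrix.transpose_apply,
      Matrix.mul_apply, Complex.ofReal_sum, Finset.sum_mul, Finset.mul_sum, Complex.real_smul]
    refine Finset.sum_congr rfl fun s _ => ?_
    rw [Finset.sum_comm]
    refine Finset.sum_congr rfl fun t _ => Finset.sum_congr rfl fun r _ => ?_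
    push_cast
    ring
  rw [e1, e2, hJ, ← Finset.sum_neg_distrib]
  refine Finset.sum_congr rfl fun s _ => ?_
  rw [← Finset.sum_neg_distrib]
  exact Finset.sum_congr rfl fun t _ => by simp

/-! ### The Lefschetz algebra at a point -/

theorem IsHermitianAt.isAdjAt_lef (h : IsHermitianAt w) :
    IsAdjAt (cometric w) (lefAt w) (lamAt w) :=
  isAdjAt_wedgeL h.cometric_isSymm w

theorem lefAt_ext₁ (α : Cov n) : lefAt w * ext₁ α = ext₁ α * lefAt w :=
  (commute_ext₁_wedgeL_two α w).symm

/-- `[α^♯ ⌟ ·, L] = -(α ∘ i) ∧ ·`. -/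
theorem IsHermitianAt.contrCov_lef (h : IsHermitianAt w) (β : Cov n) :
    contrCov (cometric w) β * lefAt w - lefAt w * contrCov (cometric w) β = -ext₁ (covI β) := by
  rw [lefAt, contrCov_wedgeL_two, h.contrTwo_self, map_neg]

theorem isAdjAt_contrCov {Q : Matrix (Fin n ⊕ Fin n) (Fin n ⊕ Fin n) ℝ} (hQ : Q.IsSymm)
    (β : Cov n) : IsAdjAt Q (contrCov Q β) (ext₁ (conjCov β)) := by
  have := (isAdjAt_ext₁ Q (conjCov β)).symm hQ
  rwa [conjCov_conjCov] at this

/-- `[Λ, α ∧ ·] = -(α ∘ i)^♯ ⌟ ·`. -/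
theorem IsHermitianAt.lam_ext₁ (h : IsHermitianAt w) (α : Cov n) :
    lamAt w * ext₁ α - ext₁ α * lamAt w = -contrCov (cometric w) (covI α) := by
  have hs := h.cometric_isSymm
  have hL := h.isAdjAt_lef.symm hs
  have he := isAdjAt_ext₁ (cometric w) α
  refine IsAdjAt.left_unique h.cometric_posDef (R := -ext₁ (conjCov (covI α))) ?_ ?_
  · have := (hL.mul he).sub hs (he.mul hL)
    rwa [h.contrCov_lef, ← conjCov_covI] at this
  · have := (isAdjAt_zero hs).sub hs (isAdjAt_contrCov hs (covI α))
    simpa using this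

theorem IsHermitianAt.lam_contrCov (h : IsHermitianAt w) (α : Cov n) :
    lamAt w * contrCov (cometric w) α = contrCov (cometric w) α * lamAt w := by
  have hs := h.cometric_isSymm
  have hL := h.isAdjAt_lef.symm hs
  have hc := isAdjAt_contrCov hs α
  refine IsAdjAt.left_unique h.cometric_posDef (hL.mul hc) ?_
  rw [← lefAt_ext₁]
  exact hc.mul hL

/-- The commutator `[η ∧ ·, Λ]` of multiplication by a `2`-form with `Λ`. -/
def lefComm (w η : Alt n 2) : FibEnd n := wedgeL η * lamAt w - lamAt w * wedgeL η

/-- The trace of a real `(1,1)`-form with respect to the metric, up to a factor `2`. -/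
def gramTrace (w η : Alt n 2) : ℝ := (cometric w * gramMatrix η).trace

/-- On constants, `Λ (η ∧ ·)` is half the trace of `η`. -/
theorem IsHermitianAt.lam_wedgeL_vac (h : IsHermitianAt w) {η : Alt n 2} (hη : IsRealOneOne η) :
    lamAt w (wedgeL η (vac n)) = ((gramTrace w η / 2 : ℝ) : ℂ) • vac n := by
  have h1 : ∀ α β : Cov n, lamAt w (ext₁ α (ext₁ β (vac n))) =
      -(covPair (cometric w) β (covI α)) • vac n := by
    intro α β
    have e1 := congrArg (fun P : FibEnd n => P (ext₁ β (vac n))) (h.lam_ext₁ α)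
    have e2 := congrArg (fun P : FibEnd n => P (vac n)) (h.lam_ext₁ β)
    have e3 := congrArg (fun P : FibEnd n => P (vac n)) (ext₁_contrCov (cometric w) β (covI α))
    simp only [LinearMap.sub_apply, LinearMap.add_apply, LinearMap.neg_apply,
      Module.End.mul_apply, contrCov_vac, map_zero, neg_zero, zero_add,
      Module.algebraMap_end_apply] at e1 e2 e3
    have e4 : lamAt w (vac n) = 0 := wedgeAdj_vac _ _
    rw [e4, map_zero, sub_zero] at e2
    rw [e2, map_zero, sub_zero, e3] at e1
    rw [e1, neg_smul]
  rw [wedgeL_two (stdBasis n), LinearMap.smul_apply, LinearMap.sum_apply, map_smul, map_sum]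
  simp only [Module.End.mul_apply, h1]
  rw [← Finset.sum_smul, smul_smul]
  congr 1
  have e : ∀ s, covPair (cometric w) (toCov (η.curryLeft (stdBasis n s)))
      (covI (coframe (stdBasis n) s)) = ∑ p, ∑ q, ((cometric w p q : ℝ) : ℂ) *
        (((stdBasis n).repr (mulI n (stdBasis n p)) s : ℝ) • bil η (stdBasis n s))
          (stdBasis n q) := by
    intro s
    refine Finset.sum_congr rfl fun p _ => Finset.sum_congr rfl fun q _ => ?_
    rw [covI_apply, coframe_apply, LinearMap.smul_apply, Complex.real_smul, mul_assoc]
    rfl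
  have e' : ∑ s, covPair (cometric w) (toCov (η.curryLeft (stdBasis n s)))
      (covI (coframe (stdBasis n) s)) = -(gramTrace w η : ℝ) := by
    simp only [e]
    rw [Finset.sum_comm, gramTrace, Matrix.trace, Complex.ofReal_sum, ← Finset.sum_neg_distrib]
    refine Finset.sum_congr rfl fun p _ => ?_
    rw [Finset.sum_comm, Matrix.diag_apply, Matrix.mul_apply, Complex.ofReal_sum,
      ← Finset.sum_neg_distrib]
    refine Finset.sum_congr rfl fun q _ => ?_
    rw [← Finset.mul_sum, ← LinearMap.sum_apply, sum_stdBasis_smul (bil η), bil_swap]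
    push_cast
    rw [hη.ofReal_gramMatrix]
    ring
  rw [Finset.sum_neg_distrib, e']
  push_cast
  ring

/-- `[L, Λ] = k - n` on `k`-forms. -/
theorem IsHermitianAt.lef_lam (h : IsHermitianAt w) :
    lefAt w * lamAt w - lamAt w * lefAt w = degOp n - algebraMap ℂ (FibEnd n) n := by
  rw [← sub_eq_zero]
  refine fibEnd_eq_zero_of_ext₁ _ ?_ fun α => ?_
  · have e4 : lamAt w (vac n) = 0 := wedgeAdj_vac _ _
    have ht : gramTrace w w = 2 * n := by
      rw [gramTrace, cometric, Matrix.nonsing_inv_mul _ h.det_isUnit, Matrix.trace_one]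
      simp
      ring
    simp only [LinearMap.sub_apply, Module.End.mul_apply, e4, map_zero, lefAt,
      h.lam_wedgeL_vac h.toIsRealOneOne, degOp_vac, Module.algebraMap_end_apply, ht]
    push_cast
    simp
  · have e1 := h.lam_ext₁ α
    have e2 := lefAt_ext₁ (w := w) α
    have e3 := h.contrCov_lef (covI α)
    rw [covI_covI, map_neg, neg_neg] at e3
    have e4 := degOp_ext₁ α
    have e5 := Algebra.commutes (n : ℂ) (ext₁ α)
    linear_combination (norm := noncomm_ring) lefAt w * e1 + e2 * lamAt w - lamAt w * e2
      - e1 * lefAt w + e3 - e4 + e5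

theorem IsHermitianAt.degOp_lam (h : IsHermitianAt w) :
    degOp n * lamAt w - lamAt w * degOp n = -(2 : ℂ) • lamAt w := by
  have hs := h.cometric_isSymm
  have hL := h.isAdjAt_lef
  have hK := isAdjAt_degOp (n := n) hs
  refine IsAdjAt.right_unique h.cometric_posDef ((hL.mul hK).sub hs (hK.mul hL)) ?_
  have e := degOp_wedgeL w
  have e2 : lefAt w * degOp n - degOp n * lefAt w = -(2 : ℂ) • lefAt w := by
    rw [lefAt, ← neg_sub, e, neg_smul]
    norm_num
  rw [e2]
  have := IsAdjAt.smul hs (-2 : ℂ) hL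
  rwa [map_neg, map_ofNat] at this

/-- `[[η ∧ ·, Λ], L] = 2 η ∧ ·`. -/
theorem IsHermitianAt.lefComm_lef (h : IsHermitianAt w) (η : Alt n 2) :
    lefComm w η * lefAt w - lefAt w * lefComm w η = (2 : ℂ) • wedgeL η := by
  have e1 := h.lef_lam
  have e2 := degOp_wedgeL η
  have e3 : lefAt w * wedgeL η = wedgeL η * lefAt w := commute_wedgeL_two w η
  have e4 := Algebra.commutes (n : ℂ) (wedgeL η)
  rw [lefComm]
  push_cast at e2
  rw [← e2]
  linear_combination (norm := noncomm_ring) e1 * wedgeL η - wedgeL η * e1 - e3 * lamAt w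
    + lamAt w * e3 - e4

/-- `[[η ∧ ·, Λ], α ∧ ·] = [(α ∘ i)^♯ ⌟ ·, η ∧ ·]`. -/
theorem IsHermitianAt.lefComm_ext₁ (h : IsHermitianAt w) (η : Alt n 2) (α : Cov n) :
    lefComm w η * ext₁ α - ext₁ α * lefComm w η =
      contrCov (cometric w) (covI α) * wedgeL η - wedgeL η * contrCov (cometric w) (covI α) := by
  have e1 := h.lam_ext₁ α
  have e2 := commute_ext₁_wedgeL_two α η
  rw [lefComm]
  linear_combination (norm := noncomm_ring) wedgeL η * e1 - e1 * wedgeL η - e2 * lamAt w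
    + lamAt w * e2

end Metric

/-! ### The torsion form -/

/-- The form `θ` satisfies `θ(i·, i·, i·) = i θ`, as `(2,1)`-forms do. -/
def IsTypeTwoOne (θ : Alt n 3) : Prop :=
  ∀ u v w, θ ![Complex.I • u, Complex.I • v, Complex.I • w] = Complex.I * θ ![u, v, w]

/-- The basis `i b_s`. -/
def stdBasisI (n : ℕ) : Module.Basis (Fin n ⊕ Fin n) ℝ (Cn n) :=
  (stdBasis n).map
    { toFun := mulI n
      map_add' := map_add _
      map_smul' := map_smul _
      invFun := fun v => -mulI n v
      left_inv := fun v => by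
        change -mulI n (mulI n v) = v
        rw [mulI_mulI, neg_neg]
      right_inv := fun v => by
        change mulI n (-mulI n v) = v
        rw [map_neg, mulI_mulI, neg_neg] }

theorem stdBasisI_apply (s : Fin n ⊕ Fin n) : stdBasisI n s = Complex.I • stdBasis n s := by
  simp [stdBasisI]

theorem covI_coframe_stdBasisI (s : Fin n ⊕ Fin n) :
    covI (coframe (stdBasisI n) s) = coframe (stdBasis n) s := by
  ext1 v
  rw [covI_apply, coframe_apply, coframe_apply, stdBasisI, Module.Basis.map_repr]
  change (((stdBasis n).repr (-mulI n (mulI n v)) s : ℝ) : ℂ) = _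
  rw [mulI_mulI, neg_neg]

/-- If `[A, ·]` is a derivation sending `e₁, e₂, e₃` to `f₁, f₂, f₃` and killing the `fᵢ`, its cube
sends `e₁ e₂ e₃` to `6 f₁ f₂ f₃`. -/
theorem triple_commutator {R : Type*} [Ring R] {A e₁ e₂ e₃ f₁ f₂ f₃ : R}
    (h₁ : A * e₁ = e₁ * A + f₁) (h₂ : A * e₂ = e₂ * A + f₂) (h₃ : A * e₃ = e₃ * A + f₃)
    (k₁ : A * f₁ = f₁ * A) (k₂ : A * f₂ = f₂ * A) (k₃ : A * f₃ = f₃ * A) :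
    A * (A * (A * (e₁ * e₂ * e₃) - (e₁ * e₂ * e₃) * A) - (A * (e₁ * e₂ * e₃) - (e₁ * e₂ * e₃) * A)
      * A) - (A * (A * (e₁ * e₂ * e₃) - (e₁ * e₂ * e₃) * A) - (A * (e₁ * e₂ * e₃) - (e₁ * e₂ * e₃)
      * A) * A) * A = 6 • (f₁ * f₂ * f₃) := by
  have d : ∀ {x y z x' y' z' : R}, A * x = x * A + x' → A * y = y * A + y' → A * z = z * A + z' →
      A * (x * y * z) - (x * y * z) * A = x' * y * z + x * y' * z + x * y * z' := by
    intro x y z x' y' z' hx hy hz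
    linear_combination (norm := noncomm_ring) hx * (y * z) + x * hy * z + x * y * hz
  have z₁ : A * f₁ = f₁ * A + 0 := by rw [k₁, add_zero]
  have z₂ : A * f₂ = f₂ * A + 0 := by rw [k₂, add_zero]
  have z₃ : A * f₃ = f₃ * A + 0 := by rw [k₃, add_zero]
  have s2 : A * (f₁ * e₂ * e₃ + e₁ * f₂ * e₃ + e₁ * e₂ * f₃) -
      (f₁ * e₂ * e₃ + e₁ * f₂ * e₃ + e₁ * e₂ * f₃) * A =
      2 • (f₁ * f₂ * e₃ + f₁ * e₂ * f₃ + e₁ * f₂ * f₃) := by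
    linear_combination (norm := noncomm_ring) d z₁ h₂ h₃ + d h₁ z₂ h₃ + d h₁ h₂ z₃
  have s3 : A * (f₁ * f₂ * e₃ + f₁ * e₂ * f₃ + e₁ * f₂ * f₃) -
      (f₁ * f₂ * e₃ + f₁ * e₂ * f₃ + e₁ * f₂ * f₃) * A = 3 • (f₁ * f₂ * f₃) := by
    linear_combination (norm := noncomm_ring) d z₁ z₂ h₃ + d z₁ h₂ z₃ + d h₁ z₂ z₃
  rw [d h₁ h₂ h₃, s2]
  linear_combination (norm := noncomm_ring) 2 • s3

/-- `sl₂`-representation theory: a vector `T` of weight `3` killed by `ad L` satisfies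
`ad L (ad Λ)³ T = 3 (ad Λ)² T`. -/
theorem sl2_weight_three {R : Type*} [Ring R] {L A T : R} (hT : L * T = T * L)
    (hH : (L * A - A * L) * T - T * (L * A - A * L) = 3 • T)
    (hA : (L * A - A * L) * A - A * (L * A - A * L) = -(2 • A)) :
    L * (A * (A * (A * T - T * A) - (A * T - T * A) * A)
      - (A * (A * T - T * A) - (A * T - T * A) * A) * A)
      - (A * (A * (A * T - T * A) - (A * T - T * A) * A)
      - (A * (A * T - T * A) - (A * T - T * A) * A) * A) * L =
    3 • (A * (A * T - T * A) - (A * T - T * A) * A) := by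
  set H := L * A - A * L with hHdef
  set D1 := A * T - T * A with hD1
  have l1 : L * D1 - D1 * L = 3 • T := by
    rw [hD1]
    linear_combination (norm := (rw [hHdef]; noncomm_ring)) hH + A * hT - hT * A
  have w1 : H * D1 - D1 * H = D1 := by
    rw [hD1]
    linear_combination (norm := noncomm_ring) A * hH - hH * A + hA * T - T * hA
  set D2 := A * D1 - D1 * A with hD2
  have l2 : L * D2 - D2 * L = 4 • D1 := by
    rw [hD2]
    linear_combination (norm := (rw [hHdef, hD1]; noncomm_ring)) w1 + A * l1 - l1 * A
  have w2 : H * D2 - D2 * H = -D2 := by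
    rw [hD2]
    linear_combination (norm := noncomm_ring) A * w1 - w1 * A + hA * D1 - D1 * hA
  linear_combination (norm := (rw [hHdef, hD2]; noncomm_ring)) w2 + A * l2 - l2 * A

section Torsion

variable {w : Alt n 2}

/-- For a `(2,1)`-form `θ`, `[Λ, [Λ, [Λ, θ ∧ ·]]] = 6 i (θ̄ ∧ ·)^⋆`. -/
theorem IsHermitianAt.lam_cube (h : IsHermitianAt w) {θ : Alt n 3} (hθ : IsTypeTwoOne θ) :
    lamAt w * (lamAt w * (lamAt w * wedgeL θ - wedgeL θ * lamAt w) -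
        (lamAt w * wedgeL θ - wedgeL θ * lamAt w) * lamAt w) -
      (lamAt w * (lamAt w * wedgeL θ - wedgeL θ * lamAt w) -
        (lamAt w * wedgeL θ - wedgeL θ * lamAt w) * lamAt w) * lamAt w =
      (6 * Complex.I) • wedgeAdj (cometric w) (conjAlt θ) := by
  have he : ∀ s, lamAt w * ext₁ (coframe (stdBasisI n) s) =
      ext₁ (coframe (stdBasisI n) s) * lamAt w +
        -contrCov (cometric w) (coframe (stdBasis n) s) := by
    intro s
    rw [← covI_coframe_stdBasisI, ← h.lam_ext₁]
    abel
  have hf : ∀ s, lamAt w * -contrCov (cometric w) (coframe (stdBasis n) s) =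
      -contrCov (cometric w) (coframe (stdBasis n) s) * lamAt w := by
    intro s
    rw [mul_neg, h.lam_contrCov, neg_mul]
  let D : FibEnd n →ₗ[ℂ] FibEnd n :=
    LinearMap.mulLeft ℂ (lamAt w) - LinearMap.mulRight ℂ (lamAt w)
  change D (D (D (wedgeL θ))) = _
  rw [wedgeL_three (stdBasisI n), wedgeAdj_three]
  simp only [map_smul, map_sum]
  rw [smul_comm (6 * Complex.I) ((6 : ℂ)⁻¹)]
  congr 1
  rw [Finset.smul_sum]
  refine Finset.sum_congr rfl fun s _ => ?_
  rw [Finset.smul_sum]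
  refine Finset.sum_congr rfl fun t _ => ?_
  rw [Finset.smul_sum]
  refine Finset.sum_congr rfl fun u _ => ?_
  have e : D (D (D (ext₁ (coframe (stdBasisI n) s) * ext₁ (coframe (stdBasisI n) t) *
      ext₁ (coframe (stdBasisI n) u)))) = _ :=
    triple_commutator (he s) (he t) (he u) (hf s) (hf t) (hf u)
  rw [e, stdBasisI_apply, stdBasisI_apply, stdBasisI_apply, hθ]
  have a1 := contrCov_anticomm (cometric w) (coframe (stdBasis n) s) (coframe (stdBasis n) t)
  have a2 := contrCov_anticomm (cometric w) (coframe (stdBasis n) s) (coframe (stdBasis n) u)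
  have a3 := contrCov_anticomm (cometric w) (coframe (stdBasis n) t) (coframe (stdBasis n) u)
  set x := contrCov (cometric w) (coframe (stdBasis n) s)
  set y := contrCov (cometric w) (coframe (stdBasis n) t)
  set z := contrCov (cometric w) (coframe (stdBasis n) u)
  have e2 : (6 : ℕ) • (-x * -y * -z) = (6 : ℂ) • (z * y * x) := by
    have : -x * -y * -z = z * y * x := by
      linear_combination (norm := noncomm_ring) -a1 * z + y * a2 - a3 * x
    rw [this, ← Nat.cast_smul_eq_nsmul ℂ 6 (z * y * x)]
    norm_num
  have e3 : (starRingEnd ℂ) (conjAlt θ ![stdBasis n s, stdBasis n t, stdBasis n u]) =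
      θ ![stdBasis n s, stdBasis n t, stdBasis n u] := Complex.conj_conj _
  rw [e2, e3, smul_smul, smul_smul]
  congr 1
  ring

theorem IsHermitianAt.lef_lam_wedgeL (h : IsHermitianAt w) (θ : Alt n 3) :
    (lefAt w * lamAt w - lamAt w * lefAt w) * wedgeL θ -
      wedgeL θ * (lefAt w * lamAt w - lamAt w * lefAt w) = 3 • wedgeL θ := by
  have e := degOp_wedgeL θ
  have e' := Algebra.commutes (n : ℂ) (wedgeL θ)
  rw [h.lef_lam]
  rw [← Nat.cast_smul_eq_nsmul ℂ 3 (wedgeL θ), ← e]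
  linear_combination (norm := noncomm_ring) -e'

/-- `[Λ, [Λ, θ ∧ ·]] = 2 i [L, (θ̄ ∧ ·)^⋆]` for a `(2,1)`-form `θ`. -/
theorem IsHermitianAt.lam_torsion (h : IsHermitianAt w) {θ : Alt n 3} (hθ : IsTypeTwoOne θ) :
    lamAt w * (lamAt w * wedgeL θ - wedgeL θ * lamAt w) -
        (lamAt w * wedgeL θ - wedgeL θ * lamAt w) * lamAt w =
      (2 * Complex.I) • (lefAt w * wedgeAdj (cometric w) (conjAlt θ) -
        wedgeAdj (cometric w) (conjAlt θ) * lefAt w) := by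
  have e1 : lefAt w * wedgeL θ = wedgeL θ * lefAt w := commute_wedgeL_two w θ
  have e2 := h.lef_lam_wedgeL θ
  have e3 : (lefAt w * lamAt w - lamAt w * lefAt w) * lamAt w -
      lamAt w * (lefAt w * lamAt w - lamAt w * lefAt w) = -(2 • lamAt w) := by
    have a := h.degOp_lam
    have b := Algebra.commutes (n : ℂ) (lamAt w)
    rw [h.lef_lam]
    have c : -(2 • lamAt w) = -(2 : ℂ) • lamAt w := by
      rw [neg_smul, ← Nat.cast_smul_eq_nsmul ℂ 2 (lamAt w)]; norm_num
    rw [c, ← a]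
    linear_combination (norm := noncomm_ring) -b
  have key := sl2_weight_three e1 e2 e3
  rw [h.lam_cube hθ] at key
  rw [← Nat.cast_smul_eq_nsmul ℂ 3] at key
  have h3 : ((3 : ℕ) : ℂ) ≠ 0 := by norm_num
  rw [eq_comm, ← eq_inv_smul_iff₀ h3] at key
  rw [key, mul_smul_comm, smul_mul_assoc, ← smul_sub, smul_smul]
  congr 1
  push_cast
  ring

/-- `[L, [Λ, θ ∧ ·]] = 3 θ ∧ ·` for a `3`-form `θ`. -/
theorem IsHermitianAt.lef_torsion (h : IsHermitianAt w) (θ : Alt n 3) :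
    lefAt w * (lamAt w * wedgeL θ - wedgeL θ * lamAt w) -
      (lamAt w * wedgeL θ - wedgeL θ * lamAt w) * lefAt w = 3 • wedgeL θ := by
  have e1 : lefAt w * wedgeL θ = wedgeL θ * lefAt w := commute_wedgeL_two w θ
  have e2 := h.lef_lam_wedgeL θ
  linear_combination (norm := noncomm_ring) e2 + lamAt w * e1 - e1 * lamAt w

end Torsion

end
end HermitianForms

namespace HermitianForms
noncomputable section

variable {n : ℕ}

/-! ### Variation of the metric -/

theorem contDiff_det {ι : Type*} [Fintype ι] [DecidableEq ι] {r : WithTop ℕ∞} :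
    ContDiff ℝ r (fun A : ι → ι → ℝ => Matrix.det (Matrix.of A)) := by
  simp only [Matrix.det_apply]
  refine ContDiff.sum fun σ _ => ?_
  refine ContDiff.const_smul _ (contDiff_prod fun i _ => ?_)
  simp only [Matrix.of_apply]
  fun_prop

/-- Jacobi's formula. -/
theorem hasDerivAt_det {ι : Type*} [Fintype ι] [DecidableEq ι] {G : ℝ → Matrix ι ι ℝ}
    {G' : Matrix ι ι ℝ} (hG : ∀ i j, HasDerivAt (fun t => G t i j) (G' i j) 0)
    (h0 : IsUnit (G 0).det) :
    HasDerivAt (fun t => (G t).det) ((G 0).det * ((G 0)⁻¹ * G').trace) 0 := by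
  have hd : DifferentiableAt ℝ (fun A : ι → ι → ℝ => Matrix.det (Matrix.of A)) (G 0) :=
    (contDiff_det (r := 1)).differentiable (by norm_num) _
  have h1 : ∀ H : ℝ → ι → ι → ℝ, H 0 = G 0 → (∀ i j, HasDerivAt (fun t => H t i j) (G' i j) 0) →
      HasDerivAt (fun t => (Matrix.of (H t)).det)
        (fderiv ℝ (fun A : ι → ι → ℝ => Matrix.det (Matrix.of A)) (G 0) G') 0 := by
    intro H hH hH'
    have h2 : HasDerivAt H G' 0 := hasDerivAt_pi.2 fun i => hasDerivAt_pi.2 fun j => hH' i j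
    rw [← hH] at hd ⊢
    exact hd.hasFDerivAt.comp_hasDerivAt 0 h2
  have h3 := h1 (fun t => (G 0 + t • G' : Matrix ι ι ℝ)) (by simp; rfl) fun i j => by
    simpa using ((hasDerivAt_id (0 : ℝ)).mul_const (G' i j)).const_add (G 0 i j)
  have h4 : (fun t : ℝ => (Matrix.of (G 0 + t • G' : Matrix ι ι ℝ)).det) = fun t : ℝ =>
      (G 0).det * (1 + ((G 0)⁻¹ * G').trace * t + (((1 : Matrix ι ι (Polynomial ℝ)) +
        (Polynomial.X : Polynomial ℝ) • ((G 0)⁻¹ * G').map Polynomial.C).det.divX.divX).eval t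
          * t ^ 2) := by
    funext t
    rw [← Matrix.det_one_add_smul, ← Matrix.det_mul, Matrix.mul_add, Matrix.mul_smul,
      ← Matrix.mul_assoc, Matrix.mul_nonsing_inv _ h0, Matrix.one_mul, Matrix.mul_one]
    rfl
  have h5 : HasDerivAt (fun t : ℝ => (Matrix.of (G 0 + t • G' : Matrix ι ι ℝ)).det)
      ((G 0).det * ((G 0)⁻¹ * G').trace) 0 := by
    rw [h4]
    refine HasDerivAt.const_mul _ ?_
    have a := ((hasDerivAt_id (0 : ℝ)).const_mul ((G 0)⁻¹ * G').trace).const_add 1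
    have b := (Polynomial.hasDerivAt (((1 : Matrix ι ι (Polynomial ℝ)) +
        (Polynomial.X : Polynomial ℝ) • ((G 0)⁻¹ * G').map Polynomial.C).det.divX.divX) 0).mul
          (hasDerivAt_pow 2 (0 : ℝ))
    refine (a.add b).congr_deriv ?_
    simp
  rw [← h3.unique h5]
  exact h1 G rfl hG

theorem hasDerivAt_inv {ι : Type*} [Fintype ι] [DecidableEq ι] {G : ℝ → Matrix ι ι ℝ}
    {G' : Matrix ι ι ℝ} (hG : ∀ i j, HasDerivAt (fun t => G t i j) (G' i j) 0)
    (h0 : IsUnit (G 0).det) (i j : ι) :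
    HasDerivAt (fun t => (G t)⁻¹ i j) (-((G 0)⁻¹ * G' * (G 0)⁻¹) i j) 0 := by
  have hdet := hasDerivAt_det hG h0
  have hne : (G 0).det ≠ 0 := h0.ne_zero
  have hd : ∀ i j, DifferentiableAt ℝ (fun t => (G t)⁻¹ i j) 0 := by
    intro i j
    simp only [Matrix.inv_def, Matrix.smul_apply, Ring.inverse_eq_inv', Matrix.adjugate_apply,
      smul_eq_mul]
    refine (hdet.differentiableAt.inv hne).mul ?_
    have hH : DifferentiableAt ℝ (fun t => ((G t).updateRow j (Pi.single i 1) : ι → ι → ℝ)) 0 := by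
      refine differentiableAt_pi.2 fun k => differentiableAt_pi.2 fun l => ?_
      by_cases hk : k = j
      · subst hk
        simp
      · simp only [Matrix.updateRow_ne hk]
        exact (hG k l).differentiableAt
    exact ((contDiff_det (r := 1)).differentiable (by norm_num) _).comp 0 hH
  have hev : ∀ᶠ t in nhds (0 : ℝ), (G t).det ≠ 0 :=
    hdet.continuousAt.eventually_ne hne
  set D : Matrix ι ι ℝ := Matrix.of fun i j => deriv (fun t => (G t)⁻¹ i j) 0 with hD
  have hprod : D * G 0 + (G 0)⁻¹ * G' = 0 := by
    ext i j
    have e : HasDerivAt (fun t => ((G t)⁻¹ * G t) i j) ((D * G 0 + (G 0)⁻¹ * G') i j) 0 := by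
      simp only [Matrix.mul_apply, Matrix.add_apply, ← Finset.sum_add_distrib]
      exact HasDerivAt.fun_sum fun k _ => ((hd i k).hasDerivAt.mul (hG k j))
    have e2 : (fun t => ((G t)⁻¹ * G t) i j) =ᶠ[nhds 0] fun _ => (1 : Matrix ι ι ℝ) i j := by
      filter_upwards [hev] with t ht
      rw [Matrix.nonsing_inv_mul _ (isUnit_iff_ne_zero.2 ht)]
    exact (e.congr_of_eventuallyEq e2.symm).unique (hasDerivAt_const _ _)
  have hD' : D = -((G 0)⁻¹ * G' * (G 0)⁻¹) := by
    calc D = D * (G 0 * (G 0)⁻¹) := by rw [Matrix.mul_nonsing_inv _ h0, Matrix.mul_one]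
      _ = _ := by rw [← Matrix.mul_assoc, eq_neg_of_add_eq_zero_left hprod, Matrix.neg_mul]
  have := (hd i j).hasDerivAt
  rw [← Matrix.neg_apply, ← hD']
  exact this

/-- The density of the Riemannian volume of a Hermitian metric. -/
def volDensity (w : Alt n 2) : ℝ := Real.sqrt (gramMatrix w).det

section Curve

variable {w : ℝ → Alt n 2} {η : Alt n 2}

theorem hasDerivAt_gramMatrix (hw : HasDerivAt w η 0) (s t : Fin n ⊕ Fin n) :
    HasDerivAt (fun r => gramMatrix (w r) s t) (gramMatrix η s t) 0 := by
  have h1 : HasDerivAt (fun r => (w r) ![realBasis n s, Complex.I • realBasis n t])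
      (η ![realBasis n s, Complex.I • realBasis n t]) 0 :=
    ((ContinuousAlternatingMap.apply ℝ (Cn n) ℂ
      ![realBasis n s, Complex.I • realBasis n t]).hasFDerivAt.comp_hasDerivAt 0 hw)
  exact Complex.reCLM.hasFDerivAt.comp_hasDerivAt 0 h1

theorem hasDerivAt_volDensity (h : IsHermitianAt (w 0)) (hw : HasDerivAt w η 0) :
    HasDerivAt (fun t => volDensity (w t)) (volDensity (w 0) * (gramTrace (w 0) η / 2)) 0 := by
  have hp := h.gramMatrix_posDef.det_pos
  have := (hasDerivAt_det (hasDerivAt_gramMatrix hw) h.det_isUnit).sqrt hp.ne'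
  refine this.congr_deriv ?_
  have h2 : Real.sqrt (gramMatrix (w 0)).det ≠ 0 := (Real.sqrt_pos.2 hp).ne'
  symm
  change Real.sqrt (gramMatrix (w 0)).det * (((gramMatrix (w 0))⁻¹ * gramMatrix η).trace / 2) = _
  field_simp
  rw [Real.sq_sqrt hp.le, mul_comm]

theorem hasDerivAt_cometric (h : IsHermitianAt (w 0)) (hw : HasDerivAt w η 0)
    (s t : Fin n ⊕ Fin n) : HasDerivAt (fun r => cometric (w r) s t)
      (-(cometric (w 0) * gramMatrix η * cometric (w 0)) s t) 0 :=
  hasDerivAt_inv (hasDerivAt_gramMatrix hw) h.det_isUnit s t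

theorem fibInner_vac (Q : Matrix (Fin n ⊕ Fin n) (Fin n ⊕ Fin n) ℝ) (b : Fib n) :
    fibInner Q (vac n) b = (starRingEnd ℂ) (b 0 ![]) := by
  rw [fibInner, Finset.sum_range_succ']
  have h1 : ∀ k ∈ Finset.range (2 * n), cometricInner Q (vac n (k + 1)) (b (k + 1)) = 0 := by
    intro k _
    have := cometricInner_smul_left Q 0 (0 : Alt n (k + 1)) (b (k + 1))
    rwa [alt_smul_zero, zero_mul] at this
  rw [Finset.sum_eq_zero h1, zero_add]
  simp only [cometricInner, Finset.univ_unique, Finset.sum_singleton, vac]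
  simp
  congr 2
  exact Subsingleton.elim _ _

theorem fibInner_contrCov (Q Q' : Matrix (Fin n ⊕ Fin n) (Fin n ⊕ Fin n) ℝ) (β : Cov n)
    (a b : Fib n) : fibInner Q a (contrCov Q' β b) = ∑ p, ∑ q, ((Q' p q : ℝ) : ℂ) *
      (starRingEnd ℂ) (β (stdBasis n p)) * fibInner Q a (contr (stdBasis n q) b) := by
  let f : Fib n →ₛₗ[starRingEnd ℂ] ℂ :=
    { toFun := fun c => fibInner Q a c
      map_add' := fun c c' => by
        simp only [fibInner, cometricInner, Fib.add_apply, ContinuousAlternatingMap.add_apply,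
          map_add, mul_add, Finset.sum_add_distrib]
      map_smul' := fun r c => by
        simp only [fibInner, cometricInner, Fib.smul_apply, ContinuousAlternatingMap.smul_apply,
          smul_eq_mul, map_mul, Finset.mul_sum]
        refine Finset.sum_congr rfl fun k _ => Finset.sum_congr rfl fun s _ =>
          Finset.sum_congr rfl fun t _ => ?_
        ring }
  change f _ = ∑ p, ∑ q, _ * f _
  simp only [contrCov_apply, LinearMap.sum_apply, LinearMap.smul_apply, map_sum,
    LinearMap.map_smulₛₗ, smul_eq_mul, map_mul, Complex.conj_ofReal]

/-- Contraction for the derivative of the cometric. -/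
theorem IsHermitianAt.contrCov_deriv {w η : Alt n 2} (h : IsHermitianAt w) (hη : IsRealOneOne η)
    (β : Cov n) : contrCov (-(cometric w * gramMatrix η * cometric w)) β =
      -contrCov (cometric w) (contrTwo (cometric w) (covI β) η) := by
  have hγ : ∀ r, contrTwo (cometric w) (covI β) η (stdBasis n r) =
      ∑ s, ∑ p, (cometric w s p : ℂ) * β (stdBasis n s) * (gramMatrix η p r : ℂ) := by
    intro r
    rw [contrTwo_apply]
    let B : Cn n →ₗ[ℝ] Cn n →ₗ[ℝ] ℂ := LinearMap.mk₂ ℝ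
      (fun u v => β u * bil η v (stdBasis n r))
      (fun u u' v => by rw [map_add, add_mul]) (fun c u v => by
        rw [map_smul, smul_mul_assoc])
      (fun u v v' => by rw [map_add, LinearMap.add_apply, mul_add]) (fun c u v => by
        rw [map_smul, LinearMap.smul_apply, mul_smul_comm])
    have := h.sum_cometric_mulI B
    simp only [B, LinearMap.mk₂_apply, hη.bil_mulI_left, ← hη.ofReal_gramMatrix] at this
    calc _ = ∑ s, ∑ t, ((cometric w s t : ℝ) : ℂ) *
          (β (mulI n (stdBasis n s)) * bil η (stdBasis n t) (stdBasis n r)) := by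
            refine Finset.sum_congr rfl fun s _ => Finset.sum_congr rfl fun t _ => ?_
            rw [bil_apply, mul_assoc]
            rfl
      _ = _ := by
        rw [this, ← Finset.sum_neg_distrib]
        refine Finset.sum_congr rfl fun s _ => ?_
        rw [← Finset.sum_neg_distrib]
        exact Finset.sum_congr rfl fun t _ => by ring
  have hM : ∀ s t, (-(cometric w * gramMatrix η * cometric w)) s t =
      -∑ r, ∑ p, cometric w s p * gramMatrix η p r * cometric w r t := by
    intro s t
    rw [Matrix.neg_apply, Matrix.mul_apply]
    simp only [Matrix.mul_apply, Finset.sum_mul]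
  rw [contrCov_apply, contrCov_apply, Finset.sum_comm,
    ← neg_one_smul ℂ (∑ s, ∑ t, (_ : ℂ) • contr (stdBasis n t)),
    Finset.sum_comm (f := fun s t => ((cometric w s t : ℂ) * _) • contr (stdBasis n t)),
    Finset.smul_sum]
  refine Finset.sum_congr rfl fun t _ => ?_
  rw [← Finset.sum_smul, ← Finset.sum_smul, smul_smul]
  congr 1
  simp only [hγ, hM, Complex.ofReal_neg, Complex.ofReal_sum, Complex.ofReal_mul, Finset.mul_sum,
    Finset.sum_mul, ← Finset.sum_neg_distrib]
  rw [Finset.sum_comm]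
  refine Finset.sum_congr rfl fun r _ => Finset.sum_congr rfl fun s _ =>
    Finset.sum_congr rfl fun p _ => ?_
  ring

/-- The derivative of the weighted inner product of two fixed forms. -/
theorem hasDerivAt_weighted (h : IsHermitianAt (w 0)) (hη : IsRealOneOne η)
    (hw : HasDerivAt w η 0) (a b : Fib n) :
    HasDerivAt (fun t => (volDensity (w t) : ℂ) * fibInner (cometric (w t)) a b)
      (-(volDensity (w 0) * fibInner (cometric (w 0)) (lefComm (w 0) η a) b)) 0 := by
  let S : Submodule ℂ (Fib n) :=
    { carrier := {a | ∀ b, HasDerivAt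
        (fun t => (volDensity (w t) : ℂ) * fibInner (cometric (w t)) a b)
        (-(volDensity (w 0) * fibInner (cometric (w 0)) (lefComm (w 0) η a) b)) 0}
      add_mem' := fun {a a'} ha ha' b => by
        refine (((ha b).add (ha' b)).congr_of_eventuallyEq (.of_forall fun t => ?_)).congr_deriv ?_
        · simp only [fibInner_add_left, Pi.add_apply]
          ring
        · rw [map_add, fibInner_add_left]
          ring
      zero_mem' := fun b => by
        simp only [fibInner_zero_left, map_zero, mul_zero, neg_zero]
        exact hasDerivAt_const _ _
      smul_mem' := fun c a ha b => by
        refine (((ha b).const_mul c).congr_of_eventuallyEq (.of_forall fun t => ?_)).congr_deriv ?_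
        · simp only [fibInner_smul_left]
          ring
        · rw [map_smul, fibInner_smul_left]
          ring }
  suffices hS : a ∈ S from hS b
  refine fib_span S (fun b => ?_) (fun α a ha b => ?_) a
  · simp only [fibInner_vac]
    have e : lefComm (w 0) η (vac n) = -((gramTrace (w 0) η / 2 : ℝ) : ℂ) • vac n := by
      have e4 : lamAt (w 0) (vac n) = 0 := wedgeAdj_vac _ _
      rw [lefComm, LinearMap.sub_apply, Module.End.mul_apply, Module.End.mul_apply, e4, map_zero,
        h.lam_wedgeL_vac hη, zero_sub, neg_smul]
    rw [e, fibInner_smul_left, fibInner_vac]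
    refine (((hasDerivAt_volDensity h hw).ofReal_comp).mul_const
      ((starRingEnd ℂ) (b 0 ![]))).congr_deriv ?_
    push_cast
    ring
  · -- differentiate `⟨α ∧ a, b⟩ = ⟨a, α^♯ ⌟ b⟩`, where `♯` varies with the metric
    have e1 : ∀ t, (volDensity (w t) : ℂ) * fibInner (cometric (w t)) (ext₁ α a) b =
        ∑ p, ∑ q, ((cometric (w t) p q : ℝ) : ℂ) * (α (stdBasis n p) *
          ((volDensity (w t) : ℂ) * fibInner (cometric (w t)) a (contr (stdBasis n q) b))) := by
      intro t
      rw [isAdjAt_ext₁, fibInner_contrCov, Finset.mul_sum]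
      refine Finset.sum_congr rfl fun p _ => ?_
      rw [Finset.mul_sum]
      refine Finset.sum_congr rfl fun q _ => ?_
      rw [conjCov_apply, Complex.conj_conj]
      ring
    refine ((HasDerivAt.fun_sum fun p _ => HasDerivAt.fun_sum fun q _ =>
      (hasDerivAt_cometric h hw p q).ofReal_comp.mul ((ha (contr (stdBasis n q) b)).const_mul
        (α (stdBasis n p)))).congr_of_eventuallyEq (.of_forall e1)).congr_deriv ?_
    have hs := h.cometric_isSymm
    have e2 : lefComm (w 0) η * ext₁ α =
        ext₁ α * lefComm (w 0) η + ext₁ (contrTwo (cometric (w 0)) (covI α) η) := by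
      rw [← contrCov_wedgeL_two, ← h.lefComm_ext₁]
      abel
    have e3 : conjCov (contrTwo (cometric (w 0)) (covI α) η) =
        contrTwo (cometric (w 0)) (covI (conjCov α)) η := by
      ext1 v
      rw [conjCov_apply, contrTwo_apply, contrTwo_apply]
      simp only [map_sum, map_mul, Complex.conj_ofReal]
      refine Finset.sum_congr rfl fun p _ => Finset.sum_congr rfl fun q _ => ?_
      congr 1
      exact Complex.conj_eq_iff_im.2 (hη.real _ _)
    have e4 : fibInner (cometric (w 0)) (ext₁ (contrTwo (cometric (w 0)) (covI α) η) a) b =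
        -fibInner (cometric (w 0)) a
          (contrCov (-(cometric (w 0) * gramMatrix η * cometric (w 0))) (conjCov α) b) := by
      rw [isAdjAt_ext₁, h.contrCov_deriv hη, e3, LinearMap.neg_apply, fibInner_neg_right hs,
        neg_neg]
    have e5 : lefComm (w 0) η (ext₁ α a) = ext₁ α (lefComm (w 0) η a) +
        ext₁ (contrTwo (cometric (w 0)) (covI α) η) a :=
      congrArg (fun P : FibEnd n => P a) e2
    rw [e5, fibInner_add_left, e4, isAdjAt_ext₁, fibInner_contrCov, fibInner_contrCov]
    simp only [Finset.sum_add_distrib, conjCov_apply, Complex.conj_conj]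
    rw [mul_add, neg_add, add_comm, mul_neg, neg_neg]
    congr 1
    · rw [Finset.mul_sum, ← Finset.sum_neg_distrib]
      refine Finset.sum_congr rfl fun p _ => ?_
      rw [Finset.mul_sum, ← Finset.sum_neg_distrib]
      exact Finset.sum_congr rfl fun q _ => by ring
    · rw [Finset.mul_sum]
      refine Finset.sum_congr rfl fun p _ => ?_
      rw [Finset.mul_sum]
      refine Finset.sum_congr rfl fun q _ => ?_
      rw [Matrix.neg_apply]
      ring

/-- The derivative of the weighted inner product of two forms. -/
theorem hasDerivAt_volDensity_mul_fibInner (h : IsHermitianAt (w 0)) (hη : IsRealOneOne η)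
    (hw : HasDerivAt w η 0) {a b : ℝ → Fib n} {a' b' : Fib n}
    (ha : ∀ k, HasDerivAt (fun t => a t k) (a' k) 0)
    (hb : ∀ k, HasDerivAt (fun t => b t k) (b' k) 0) :
    HasDerivAt (fun t => (volDensity (w t) : ℂ) * fibInner (cometric (w t)) (a t) (b t))
      (volDensity (w 0) * (-fibInner (cometric (w 0)) (lefComm (w 0) η (a 0)) (b 0) +
        fibInner (cometric (w 0)) a' (b 0) + fibInner (cometric (w 0)) (a 0) b')) 0 := by
  -- the coefficients of the weighted inner product
  let M : (k : ℕ) → (Fin k → Fin n ⊕ Fin n) → (Fin k → Fin n ⊕ Fin n) → ℝ → ℂ := fun k s t r =>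
    (volDensity (w r) : ℂ) * ∏ i, ((cometric (w r) (s i) (t i) : ℝ) : ℂ)
  have hM : ∀ k s t, HasDerivAt (M k s t) (deriv (M k s t) 0) 0 := fun k s t => by
    refine DifferentiableAt.hasDerivAt ?_
    refine (hasDerivAt_volDensity h hw).ofReal_comp.differentiableAt.mul ?_
    exact DifferentiableAt.fun_finsetProd fun i _ =>
      (hasDerivAt_cometric h hw (s i) (t i)).ofReal_comp.differentiableAt
  have hF : ∀ r a b, (volDensity (w r) : ℂ) * fibInner (cometric (w r)) a b =
      ∑ k ∈ Finset.range (2 * n + 1), ∑ s : Fin k → Fin n ⊕ Fin n, ∑ t : Fin k → Fin n ⊕ Fin n,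
        ((k.factorial : ℂ)⁻¹) * (M k s t r * (a k (fun i => stdBasis n (s i)) *
          (starRingEnd ℂ) (b k (fun i => stdBasis n (t i))))) := by
    intro r a b
    simp only [fibInner, cometricInner, M, Finset.mul_sum]
    refine Finset.sum_congr rfl fun k _ => Finset.sum_congr rfl fun s _ =>
      Finset.sum_congr rfl fun t _ => ?_
    ring
  have ea : ∀ k (s : Fin k → Fin n ⊕ Fin n), HasDerivAt
      (fun r => a r k (fun i => stdBasis n (s i))) (a' k (fun i => stdBasis n (s i))) 0 :=
    fun k s => (ContinuousAlternatingMap.apply ℝ (Cn n) ℂ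
      (fun i => stdBasis n (s i))).hasFDerivAt.comp_hasDerivAt 0 (ha k)
  have eb : ∀ k (s : Fin k → Fin n ⊕ Fin n), HasDerivAt
      (fun r => (starRingEnd ℂ) (b r k (fun i => stdBasis n (s i))))
      ((starRingEnd ℂ) (b' k (fun i => stdBasis n (s i)))) 0 :=
    fun k s => (Complex.conjCLE : ℂ →L[ℝ] ℂ).hasFDerivAt.comp_hasDerivAt 0
      ((ContinuousAlternatingMap.apply ℝ (Cn n) ℂ
        (fun i => stdBasis n (s i))).hasFDerivAt.comp_hasDerivAt 0 (hb k))
  have h1 := hasDerivAt_weighted h hη hw (a 0) (b 0)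
  have h2 : HasDerivAt (fun r => (volDensity (w r) : ℂ) *
      fibInner (cometric (w r)) (a 0) (b 0)) _ 0 :=
    (HasDerivAt.fun_sum fun k (_ : k ∈ Finset.range (2 * n + 1)) =>
      HasDerivAt.fun_sum fun s (_ : s ∈ Finset.univ) =>
      HasDerivAt.fun_sum fun t (_ : t ∈ Finset.univ) => ((hM k s t).mul_const
        (a 0 k (fun i => stdBasis n (s i)) * (starRingEnd ℂ)
          (b 0 k (fun i => stdBasis n (t i))))).const_mul
        ((k.factorial : ℂ)⁻¹)).congr_of_eventuallyEq (.of_forall fun r => hF r (a 0) (b 0))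
  have h3 := h1.unique h2
  refine ((HasDerivAt.fun_sum fun k (_ : k ∈ Finset.range (2 * n + 1)) =>
    HasDerivAt.fun_sum fun s (_ : s ∈ Finset.univ) =>
    HasDerivAt.fun_sum fun t (_ : t ∈ Finset.univ) => ((hM k s t).mul
      ((ea k s).mul (eb k t))).const_mul
      ((k.factorial : ℂ)⁻¹)).congr_of_eventuallyEq
      (.of_forall fun r => hF r (a r) (b r))).congr_deriv ?_
  rw [mul_add, mul_add, mul_neg, h3, hF, hF, ← Finset.sum_add_distrib, ← Finset.sum_add_distrib]
  refine Finset.sum_congr rfl fun k _ => ?_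
  rw [← Finset.sum_add_distrib, ← Finset.sum_add_distrib]
  refine Finset.sum_congr rfl fun s _ => ?_
  rw [← Finset.sum_add_distrib, ← Finset.sum_add_distrib]
  refine Finset.sum_congr rfl fun t _ => ?_
  simp only [Pi.mul_apply]
  ring

end Curve

end
end HermitianForms

namespace HermitianForms
noncomputable section

variable {n : ℕ}

/-! ### Differential operators on domains of `ℂⁿ` -/

instance finiteDimensional_alt (k : ℕ) : FiniteDimensional ℝ (Alt n k) := by
  let T : Alt n k →ₗ[ℝ] ((Fin k → Fin n ⊕ Fin n) → ℂ) :=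
    { toFun := fun a s => a fun i => stdBasis n (s i)
      map_add' := fun a b => rfl
      map_smul' := fun r a => rfl }
  exact FiniteDimensional.of_injective T fun a b hab => alt_ext_basis fun s => congrFun hab s

/-- Every component of `U` is differentiable at `y`. -/
def FibDiffAt (U : Cn n → Fib n) (y : Cn n) : Prop := ∀ k, DifferentiableAt ℝ (fun x => U x k) y

/-- Every component of `U` is `C^∞` on `O`. -/
def FibSmoothOn (U : Cn n → Fib n) (O : Set (Cn n)) : Prop :=
  ∀ k, ContDiffOn ℝ ∞ (fun x => U x k) O

/-- The derivative of the coefficients of `U` in the direction `v`. -/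
def dirD (U : Cn n → Fib n) (y v : Cn n) : Fib n := fun k => fderiv ℝ (fun x => U x k) y v

theorem dirD_apply (U : Cn n → Fib n) (y v : Cn n) (k : ℕ) :
    dirD U y v k = fderiv ℝ (fun x => U x k) y v := rfl

theorem FibSmoothOn.fibDiffAt {U : Cn n → Fib n} {O : Set (Cn n)} (hU : FibSmoothOn U O)
    (hO : IsOpen O) {y : Cn n} (hy : y ∈ O) : FibDiffAt U y := fun k =>
  ((hU k).contDiffAt (hO.mem_nhds hy)).differentiableAt (by simp)

section Family

variable {M : Type*} [NormedAddCommGroup M] [NormedSpace ℝ M] [FiniteDimensional ℝ M]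

/-- The part of a linear family of operators that goes from degree `j` to degree `k`. -/
def blockB (F : M →ₗ[ℝ] FibEnd n) (j k : ℕ) : M →L[ℝ] Alt n j →L[ℝ] Alt n k :=
  LinearMap.toContinuousLinearMap
    { toFun := fun m => LinearMap.toContinuousLinearMap
        { toFun := fun a => F m (single j a) k
          map_add' := fun a b => by
            have : single j (a + b) = single j a + single j b := by
              refine Fib.ext fun i => ?_
              by_cases h : i = j
              · subst h; rw [Fib.add_apply, single_same, single_same, single_same]
              · rw [Fib.add_apply, single_ne h, single_ne h, single_ne h, add_zero]
            rw [this, map_add, Fib.add_apply]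
          map_smul' := fun r a => by
            have : single j (r • a) = (r : ℂ) • single j a := by
              refine Fib.ext fun i => ?_
              by_cases h : i = j
              · subst h; rw [Fib.smul_apply, single_same, single_same]; rfl
              · rw [Fib.smul_apply, single_ne h, single_ne h, alt_smul_zero]
            rw [this, map_smul, Fib.smul_apply]; rfl }
      map_add' := fun m m' => by
        ext1 a
        change F (m + m') (single j a) k = F m (single j a) k + F m' (single j a) k
        rw [map_add]; rfl
      map_smul' := fun r m => by
        ext1 a
        change F (r • m) (single j a) k = r • F m (single j a) k
        rw [map_smul]; rfl }

theorem sum_blockB (F : M →ₗ[ℝ] FibEnd n) (m : M) (a : Fib n) (k : ℕ) :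
    F m a k = ∑ j ∈ Finset.range (2 * n + 1), blockB F j k m (a j) := by
  conv_lhs => rw [sum_single a]
  rw [map_sum, Fib.sum_apply]
  rfl

theorem FibSmoothOn.family (F : M →ₗ[ℝ] FibEnd n) {m : Cn n → M} {U : Cn n → Fib n}
    {O : Set (Cn n)} (hm : ContDiffOn ℝ ∞ m O) (hU : FibSmoothOn U O) :
    FibSmoothOn (fun y => F (m y) (U y)) O := fun k => by
  simp only [sum_blockB]
  exact ContDiffOn.sum fun j _ => ContDiffOn.clm_apply (f := fun x => blockB F j k (m x))
    (ContDiff.comp_contDiffOn (g := fun m' => blockB F j k m')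
      (by fun_prop) hm)
    (hU j)

theorem FibDiffAt.family (F : M →ₗ[ℝ] FibEnd n) {m : Cn n → M} {U : Cn n → Fib n}
    {y : Cn n} (hm : DifferentiableAt ℝ m y) (hU : FibDiffAt U y) :
    FibDiffAt (fun y => F (m y) (U y)) y := fun k => by
  simp only [sum_blockB]
  exact DifferentiableAt.fun_sum fun j _ => DifferentiableAt.clm_apply
    (c := fun x => blockB F j k (m x)) 
    ((ContinuousLinearMap.differentiableAt (F := Alt n j →L[ℝ] Alt n k) (blockB F j k)).comp y hm)
    (hU j)

theorem dirD_family (F : M →ₗ[ℝ] FibEnd n) {m : Cn n → M} {U : Cn n → Fib n}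
    {y : Cn n} (hm : DifferentiableAt ℝ m y) (hU : FibDiffAt U y) (v : Cn n) :
    dirD (fun y => F (m y) (U y)) y v = F (fderiv ℝ m y v) (U y) + F (m y) (dirD U y v) := by
  refine Fib.ext fun k => ?_
  have h1 := HasFDerivAt.fun_sum fun j (_ : j ∈ Finset.range (2 * n + 1)) => HasFDerivAt.clm_apply
    (c := fun x => blockB F j k (m x))
    ((ContinuousLinearMap.hasFDerivAt (F := Alt n j →L[ℝ] Alt n k) (blockB F j k)).comp y
      hm.hasFDerivAt) (hU j).hasFDerivAt
  rw [dirD_apply, funext fun x => sum_blockB F (m x) (U x) k, h1.fderiv, Fib.add_apply, sum_blockB, sum_blockB, ← Finset.sum_add_distrib,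
    _root_.sum_apply]
  refine Finset.sum_congr rfl fun j _ => ?_
  rw [add_comm]
  rfl

end Family

theorem FibSmoothOn.const_map (P : FibEnd n) {U : Cn n → Fib n} {O : Set (Cn n)}
    (hU : FibSmoothOn U O) : FibSmoothOn (fun y => P (U y)) O := by
  have := FibSmoothOn.family (M := ℝ) (LinearMap.toSpanSingleton ℝ _ P) (m := fun _ => 1)
    contDiffOn_const hU
  simpa using this

theorem FibDiffAt.const_map (P : FibEnd n) {U : Cn n → Fib n} {y : Cn n}
    (hU : FibDiffAt U y) : FibDiffAt (fun y => P (U y)) y := by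
  have := FibDiffAt.family (M := ℝ) (LinearMap.toSpanSingleton ℝ _ P) (m := fun _ => 1)
    (differentiableAt_const _) hU
  simpa using this

theorem dirD_const_map (P : FibEnd n) {U : Cn n → Fib n} {y : Cn n}
    (hU : FibDiffAt U y) (v : Cn n) : dirD (fun y => P (U y)) y v = P (dirD U y v) := by
  have := dirD_family (M := ℝ) (LinearMap.toSpanSingleton ℝ _ P) (m := fun _ => 1)
    (differentiableAt_const _) hU v
  simpa using this

/-- The projections `(b^s)^{1,0}` (for `ε = i`) and `(b^s)^{0,1}` (for `ε = -i`) of the coframe. -/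
def covP (ε : ℂ) (s : Fin n ⊕ Fin n) : Cov n :=
  (1 / 2 : ℂ) • (coframe (stdBasis n) s - ε • covI (coframe (stdBasis n) s))

theorem covI_covP {ε : ℂ} (hε : ε * ε = -1) (s : Fin n ⊕ Fin n) :
    covI (covP ε s) = ε • covP ε s := by
  ext1 v
  have h : coframe (stdBasis n) s (Complex.I • Complex.I • v) = -coframe (stdBasis n) s v := by
    rw [smul_smul, Complex.I_mul_I, neg_one_smul, map_neg]
  simp only [covP, covI_apply, _root_.smul_apply, _root_.sub_apply, h, smul_eq_mul]
  linear_combination (coframe (stdBasis n) s (Complex.I • v) / 2) * hε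

theorem conjCov_covP (ε : ℂ) (s : Fin n ⊕ Fin n) :
    conjCov (covP ε s) = covP ((starRingEnd ℂ) ε) s := by
  ext1 v
  simp only [covP, conjCov_apply, _root_.smul_apply, _root_.sub_apply, smul_eq_mul, map_mul,
    map_sub, covI_apply, coframe_apply, Complex.conj_ofReal, map_div₀, map_one, map_ofNat]

/-- The operators `∂` (for `ε = i`) and `∂̄` (for `ε = -i`) on a domain of `ℂⁿ`. -/
def dFlat (ε : ℂ) {k : ℕ} (u : Cn n → Alt n k) (y : Cn n) : Alt n (k + 1) :=
  ContinuousAlternatingMap.alternatizeUncurryFin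
    ((1 / 2 : ℂ) • (fderiv ℝ u y - ε • (fderiv ℝ u y).comp (mulI n)))

theorem delbarFlat_eq {k : ℕ} (u : Cn n → Alt n k) : delbarFlat u = dFlat (-Complex.I) u := by
  funext y
  rw [delbarFlat, dFlat]
  congr 1
  ext v w
  simp only [antilinPart, _root_.add_apply, _root_.smul_apply, _root_.sub_apply,
    ContinuousAlternatingMap.add_apply, ContinuousAlternatingMap.smul_apply,
    ContinuousAlternatingMap.sub_apply, smul_eq_mul, neg_mul, sub_neg_eq_add]
  rfl

/-- `∂ = ½ (d + i J^{-1} d J)`, where `J` acts on forms by `(J u)(v, w, …) = u(iv, iw, …)`. -/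
theorem dFlat_eq_extDeriv (ε : ℂ) {k : ℕ} {u : Cn n → Alt n k} {y : Cn n}
    (hu : DifferentiableAt ℝ u y) :
    dFlat ε u y = (1 / 2 : ℂ) • (extDeriv u y + ε •
      (extDeriv (fun x => (u x).compContinuousLinearMap (mulI n)) y).compContinuousLinearMap
        (-mulI n)) := by
  have h : fderiv ℝ (fun x => (u x).compContinuousLinearMap (mulI n)) y =
      (ContinuousAlternatingMap.compContinuousLinearMapCLM (mulI n)).comp (fderiv ℝ u y) :=
    ((ContinuousAlternatingMap.compContinuousLinearMapCLM (ι := Fin k) (F := ℂ)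
      (mulI n)).hasFDerivAt.comp y hu.hasFDerivAt).fderiv
  ext v
  rw [dFlat, ContinuousAlternatingMap.alternatizeUncurryFin_apply, extDeriv, extDeriv, h]
  simp only [ContinuousAlternatingMap.smul_apply, ContinuousAlternatingMap.add_apply,
    ContinuousAlternatingMap.compContinuousLinearMap_apply,
    ContinuousAlternatingMap.alternatizeUncurryFin_apply, smul_eq_mul, Finset.mul_sum,
    ← Finset.sum_add_distrib]
  refine Finset.sum_congr rfl fun i _ => ?_
  have e : ((ContinuousAlternatingMap.compContinuousLinearMapCLM (mulI n)).comp (fderiv ℝ u y))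
      ((⇑(-mulI n) ∘ v) i) (i.removeNth (⇑(-mulI n) ∘ v)) =
      -fderiv ℝ u y (mulI n (v i)) (i.removeNth v) := by
    change (fderiv ℝ u y ((-mulI n) (v i))) (fun j => mulI n ((-mulI n) (v (i.succAbove j)))) = _
    have e2 : ∀ x, mulI n ((-mulI n) x) = x := fun x => by
      rw [_root_.neg_apply, map_neg, mulI_mulI, neg_neg]
    simp only [e2]
    rw [_root_.neg_apply, map_neg]
    rfl
  rw [e]
  change ((-1) ^ (i : ℕ) : ℤ) • ((1 / 2 : ℂ) * (fderiv ℝ u y (v i) (i.removeNth v) -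
    ε * fderiv ℝ u y (mulI n (v i)) (i.removeNth v))) = _
  simp only [zsmul_eq_mul]
  ring

theorem alternatizeUncurryFin_comp_mulI {k : ℕ} (T : Cn n →L[ℝ] Alt n k) :
    ContinuousAlternatingMap.alternatizeUncurryFin (T.comp (mulI n)) =
      ∑ s, extMul (covI (coframe (stdBasis n) s)) (T (stdBasis n s)) := by
  rw [alternatizeUncurryFin_eq_sum (stdBasisI n)]
  refine Finset.sum_congr rfl fun s _ => ?_
  have e1 : (T.comp (mulI n)) (stdBasisI n s) = -T (stdBasis n s) := by
    change T (mulI n (stdBasisI n s)) = _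
    rw [stdBasisI_apply, ← mulI_apply, mulI_mulI, map_neg]
  have e2 : covI (coframe (stdBasis n) s) = -coframe (stdBasisI n) s := by
    rw [← covI_coframe_stdBasisI, covI_covI]
  rw [e1, e2]
  ext v
  simp only [extMul_apply, ContinuousAlternatingMap.neg_apply, _root_.neg_apply]
  exact Finset.sum_congr rfl fun i _ => by ring

theorem dFlat_eq_sum (ε : ℂ) {k : ℕ} (u : Cn n → Alt n k) (y : Cn n) :
    dFlat ε u y = ∑ s, extMul (covP ε s) (fderiv ℝ u y (stdBasis n s)) := by
  have h : dFlat ε u y = (1 / 2 : ℂ) • (ContinuousAlternatingMap.alternatizeUncurryFin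
      (fderiv ℝ u y) - ε • ContinuousAlternatingMap.alternatizeUncurryFin
        ((fderiv ℝ u y).comp (mulI n))) := by
    ext v
    simp only [dFlat, ContinuousAlternatingMap.alternatizeUncurryFin_apply,
      ContinuousAlternatingMap.sub_apply, ContinuousAlternatingMap.smul_apply,
      _root_.sub_apply, _root_.smul_apply, smul_eq_mul, zsmul_eq_mul, Finset.mul_sum,
      ← Finset.sum_sub_distrib]
    exact Finset.sum_congr rfl fun i _ => by ring
  rw [h, alternatizeUncurryFin_comp_mulI, alternatizeUncurryFin_eq_sum (stdBasis n)]
  ext v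
  simp only [covP, ContinuousAlternatingMap.smul_apply, ContinuousAlternatingMap.sub_apply,
    ContinuousAlternatingMap.sum_apply, extMul_apply, smul_eq_mul, _root_.smul_apply,
    _root_.sub_apply, Finset.mul_sum, ← Finset.sum_sub_distrib]
  exact Finset.sum_congr rfl fun s _ => Finset.sum_congr rfl fun i _ => by ring

theorem extDeriv_eq_dFlat_add {k : ℕ} (u : Cn n → Alt n k) (y : Cn n) :
    extDeriv u y = dFlat Complex.I u y + dFlat (-Complex.I) u y := by
  rw [extDeriv, dFlat, dFlat, ← ContinuousAlternatingMap.alternatizeUncurryFin_add]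
  congr 1
  ext v w
  simp only [_root_.add_apply, _root_.smul_apply, _root_.sub_apply,
    ContinuousAlternatingMap.add_apply, ContinuousAlternatingMap.smul_apply,
    ContinuousAlternatingMap.sub_apply, smul_eq_mul]
  ring

theorem extMul_anticomm {k : ℕ} (α β : Cov n) (a : Alt n k) :
    extMul α (extMul β a) = -extMul β (extMul α a) := by
  have := congrArg (fun P : FibEnd n => P (single k a) (k + 2)) (ext₁_anticomm α β)
  simpa [single_same] using this

/-- `extMul α` as a continuous linear map. -/
def extMulL {k : ℕ} (α : Cov n) : Alt n k →L[ℝ] Alt n (k + 1) :=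
  LinearMap.toContinuousLinearMap
    { toFun := extMul α
      map_add' := extMul_add_right α
      map_smul' := fun r a => extMul_smul_right (r : ℂ) α a }

theorem extMulL_apply {k : ℕ} (α : Cov n) (a : Alt n k) : extMulL α a = extMul α a := rfl

theorem ContDiffOn.dFlat (ε : ℂ) {k : ℕ} {u : Cn n → Alt n k} {O : Set (Cn n)} (hO : IsOpen O)
    (hu : ContDiffOn ℝ ∞ u O) : ContDiffOn ℝ ∞ (dFlat ε u) O := by
  have h : HermitianForms.dFlat ε u =
      fun y => ∑ s, extMulL (covP ε s) (fderiv ℝ u y (stdBasis n s)) :=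
    funext fun y => dFlat_eq_sum ε u y
  rw [h]
  exact ContDiffOn.sum fun s _ => (extMulL (covP ε s)).contDiff.comp_contDiffOn
    ((hu.fderiv_of_isOpen hO (by simp)).clm_apply contDiffOn_const)

/-- `∂ ∂ = 0`, `∂̄ ∂̄ = 0` and `∂ ∂̄ = - ∂̄ ∂`. -/
theorem dFlat_dFlat (ε ε' : ℂ) {k : ℕ} {u : Cn n → Alt n k} {y : Cn n}
    (hu : ContDiffAt ℝ 2 u y) : dFlat ε (dFlat ε' u) y = -dFlat ε' (dFlat ε u) y := by
  have hd : DifferentiableAt ℝ (fderiv ℝ u) y :=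
    (hu.fderiv_right (m := 1) (by norm_num)).differentiableAt (by norm_num)
  have h : ∀ ε ε' : ℂ, dFlat ε (dFlat ε' u) y = ∑ s, ∑ t, extMul (covP ε s)
      (extMul (covP ε' t) (fderiv ℝ (fderiv ℝ u) y (stdBasis n s) (stdBasis n t))) := by
    intro ε ε'
    rw [dFlat_eq_sum]
    refine Finset.sum_congr rfl fun s _ => ?_
    have e : dFlat ε' u = fun y => ∑ t, extMulL (covP ε' t) (fderiv ℝ u y (stdBasis n t)) :=
      funext fun y => dFlat_eq_sum ε' u y
    have e2 := HasFDerivAt.fun_sum fun t (_ : t ∈ Finset.univ) =>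
      (extMulL (covP ε' t)).hasFDerivAt.comp y
        (hd.hasFDerivAt.clm_apply (hasFDerivAt_const (stdBasis n t) y))
    simp only [Function.comp_apply] at e2
    rw [e, e2.fderiv, _root_.sum_apply, ← extMulL_apply, map_sum]
    refine Finset.sum_congr rfl fun t _ => ?_
    simp [extMulL_apply]
  have hs : IsSymmSndFDerivAt ℝ u y := hu.isSymmSndFDerivAt (by simp)
  rw [h, h, Finset.sum_comm, ← Finset.sum_neg_distrib]
  refine Finset.sum_congr rfl fun s _ => ?_
  rw [← Finset.sum_neg_distrib]
  refine Finset.sum_congr rfl fun t _ => ?_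
  rw [extMul_anticomm, hs.eq]

/-- `∂` and `∂̄` commute with holomorphic changes of variables. -/
theorem dFlat_pullback (ε : ℂ) {k : ℕ} {u : Cn n → Alt n k} {ψ : Cn n → Cn n} {y : Cn n}
    (hu : DifferentiableAt ℝ u (ψ y)) (hψ : ContDiffAt ℝ 2 ψ y)
    (hI : ∀ᶠ x in nhds y, (fderiv ℝ ψ x).comp (mulI n) = (mulI n).comp (fderiv ℝ ψ x)) :
    dFlat ε (fun x => (u (ψ x)).compContinuousLinearMap (fderiv ℝ ψ x)) y =
      (dFlat ε u (ψ y)).compContinuousLinearMap (fderiv ℝ ψ y) := by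
  have hr : minSmoothness ℝ 2 ≤ (2 : WithTop ℕ∞) := by simp
  have hd : DifferentiableAt ℝ (fderiv ℝ ψ) y :=
    (hψ.fderiv_right (m := 1) (by norm_num)).differentiableAt (by norm_num)
  have hpd : DifferentiableAt ℝ (fun x => (u (ψ x)).compContinuousLinearMap (fderiv ℝ ψ x)) y :=
    (hu.comp y (hψ.differentiableAt (by norm_num))).continuousAlternatingMapCompContinuousLinearMap
      hd
  have huJ : DifferentiableAt ℝ (fun x => (u x).compContinuousLinearMap (mulI n)) (ψ y) :=
    (ContinuousAlternatingMap.compContinuousLinearMapCLM (ι := Fin k) (F := ℂ)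
      (mulI n)).differentiableAt.comp (ψ y) hu
  rw [dFlat_eq_extDeriv ε hpd, dFlat_eq_extDeriv ε hu, extDeriv_pullback hu hψ hr]
  have e : (fun x => ((u (ψ x)).compContinuousLinearMap (fderiv ℝ ψ x)).compContinuousLinearMap
      (mulI n)) =ᶠ[nhds y] fun x => ((u (ψ x)).compContinuousLinearMap
        (mulI n)).compContinuousLinearMap (fderiv ℝ ψ x) := by
    filter_upwards [hI] with x hx
    ext v
    change u (ψ x) (fun i => ((fderiv ℝ ψ x).comp (mulI n)) (v i)) =
      u (ψ x) (fun i => ((mulI n).comp (fderiv ℝ ψ x)) (v i))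
    rw [hx]
  rw [e.extDeriv_eq, extDeriv_pullback huJ hψ hr]
  ext v
  have hc : ∀ x, fderiv ℝ ψ y ((-mulI n) x) = (-mulI n) (fderiv ℝ ψ y x) := fun x => by
    rw [_root_.neg_apply, _root_.neg_apply, map_neg]
    exact congrArg (fun T : Cn n →L[ℝ] Cn n => -T x) hI.self_of_nhds
  simp only [ContinuousAlternatingMap.smul_apply, ContinuousAlternatingMap.add_apply,
    ContinuousAlternatingMap.compContinuousLinearMap_apply, Function.comp_def, hc]

/-! ### The same operators on forms of mixed degree -/

/-- `dFlat` on forms of mixed degree. -/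
def dFib (ε : ℂ) (U : Cn n → Fib n) (y : Cn n) : Fib n
  | 0 => 0
  | k + 1 => dFlat ε (fun x => U x k) y

theorem dFib_eq_sum (ε : ℂ) (U : Cn n → Fib n) (y : Cn n) :
    dFib ε U y = ∑ s, ext₁ (covP ε s) (dirD U y (stdBasis n s)) := by
  refine Fib.ext fun k => ?_
  rw [Fib.sum_apply]
  cases k with
  | zero => simp [dFib]
  | succ k =>
    simp only [ext₁_succ, dirD_apply]
    exact dFlat_eq_sum ε _ y

theorem wedgeL_dFlat (ε : ℂ) {p : ℕ} (α : Cn n → Alt n p) (y : Cn n) :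
    wedgeL (dFlat ε α y) = ∑ s, ext₁ (covP ε s) * wedgeL (fderiv ℝ α y (stdBasis n s)) := by
  rw [dFlat_eq_sum, map_sum]
  simp only [wedgeL_extMul]

/-- The Leibniz rule. -/
theorem dFib_wedgeL (ε : ℂ) {p : ℕ} {α : Cn n → Alt n p} {U : Cn n → Fib n} {y : Cn n}
    (hα : DifferentiableAt ℝ α y) (hU : FibDiffAt U y) :
    dFib ε (fun x => wedgeL (α x) (U x)) y = wedgeL (dFlat ε α y) (U y) +
      (-1 : ℂ) ^ p • wedgeL (α y) (dFib ε U y) := by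
  rw [dFib_eq_sum, dFib_eq_sum, wedgeL_dFlat, LinearMap.sum_apply, map_sum, Finset.smul_sum,
    ← Finset.sum_add_distrib]
  refine Finset.sum_congr rfl fun s _ => ?_
  have h := dirD_family ((wedgeL (n := n) (p := p)).restrictScalars ℝ) hα hU (stdBasis n s)
  simp only [LinearMap.coe_restrictScalars] at h
  rw [h, map_add]
  congr 1
  exact congrArg (fun P : FibEnd n => P (dirD U y (stdBasis n s))) (ext₁_wedgeL (covP ε s) (α y))

/-- The complex conjugate of a form of mixed degree. -/
def conjFib (a : Fib n) : Fib n := fun k => conjAlt (a k)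

theorem dFlat_conjAlt (ε : ℂ) {k : ℕ} {u : Cn n → Alt n k} {y : Cn n}
    (hu : DifferentiableAt ℝ u y) :
    dFlat ε (fun x => conjAlt (u x)) y = conjAlt (dFlat ((starRingEnd ℂ) ε) u y) := by
  let C : Alt n k →L[ℝ] Alt n k := LinearMap.toContinuousLinearMap
    { toFun := conjAlt
      map_add' := fun a b => by ext v; simp [conjAlt]
      map_smul' := fun r a => by ext v; simp [conjAlt] }
  have h : fderiv ℝ (fun x => conjAlt (u x)) y = C.comp (fderiv ℝ u y) :=
    (C.hasFDerivAt.comp y hu.hasFDerivAt).fderiv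
  rw [dFlat_eq_sum, dFlat_eq_sum, h]
  ext v
  have hc : ∀ {j : ℕ} (a : Alt n j) (v : Fin j → Cn n), conjAlt a v = (starRingEnd ℂ) (a v) :=
    fun _ _ => rfl
  simp only [hc, ContinuousAlternatingMap.sum_apply, extMul_apply, map_sum, map_mul, map_pow,
    map_neg, map_one, ← conjCov_apply, conjCov_covP, Complex.conj_conj]
  rfl

end
end HermitianForms

namespace HermitianForms
noncomputable section

variable {n : ℕ}

/-! ### The Kähler identity with torsion, in divergence form -/

/-- The torsion operator `[Λ, θ ∧ ·]` at a point, where `θ` stands for `∂ω`. -/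
def torAt (w : Alt n 2) (θ : Alt n 3) : FibEnd n := lamAt w * wedgeL θ - wedgeL θ * lamAt w

theorem isRealOneOne_fderiv {w : Cn n → Alt n 2} {y : Cn n} (hw : DifferentiableAt ℝ w y)
    (h : ∀ᶠ x in nhds y, IsRealOneOne (w x)) (v : Cn n) : IsRealOneOne (fderiv ℝ w y v) := by
  have e : ∀ m : Fin 2 → Cn n, HasFDerivAt (fun x => w x m)
      ((ContinuousAlternatingMap.apply ℝ (Cn n) ℂ m).comp (fderiv ℝ w y)) y := fun m =>
    (ContinuousAlternatingMap.apply ℝ (Cn n) ℂ m).hasFDerivAt.comp y hw.hasFDerivAt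
  refine ⟨fun a b => ?_, fun a b => ?_⟩
  · have h1 : HasFDerivAt (fun x => (w x ![a, b]).im) _ y :=
      Complex.imCLM.hasFDerivAt.comp y (e ![a, b])
    have h2 : (fun x => (w x ![a, b]).im) =ᶠ[nhds y] fun _ => 0 := by
      filter_upwards [h] with x hx using hx.real a b
    have h3 := h1.unique ((hasFDerivAt_const (0 : ℝ) y).congr_of_eventuallyEq h2)
    exact congrArg (fun T : Cn n →L[ℝ] ℝ => T v) h3
  · have h2 : (fun x => w x ![Complex.I • a, Complex.I • b]) =ᶠ[nhds y] fun x => w x ![a, b] := by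
      filter_upwards [h] with x hx using hx.type a b
    have h3 := (e _).unique ((e ![a, b]).congr_of_eventuallyEq h2)
    exact congrArg (fun T : Cn n →L[ℝ] ℂ => T v) h3

section Divergence

variable {w : Cn n → Alt n 2} {U V : Cn n → Fib n} {y : Cn n}

theorem hasLineDerivAt_weighted (hw : DifferentiableAt ℝ w y)
    (h : ∀ᶠ x in nhds y, IsHermitianAt (w x)) (hU : FibDiffAt U y) (hV : FibDiffAt V y)
    (v : Cn n) : HasLineDerivAt ℝ
      (fun x => (volDensity (w x) : ℂ) * fibInner (cometric (w x)) (U x) (V x))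
      (volDensity (w y) * (-fibInner (cometric (w y)) (lefComm (w y) (fderiv ℝ w y v) (U y)) (V y)
        + fibInner (cometric (w y)) (dirD U y v) (V y)
        + fibInner (cometric (w y)) (U y) (dirD V y v))) y v := by
  have h0 : y + (0 : ℝ) • v = y := by rw [zero_smul, add_zero]
  have hη := isRealOneOne_fderiv hw (h.mono fun x hx => hx.toIsRealOneOne) v
  have line : ∀ {F : Type _} [NormedAddCommGroup F] [NormedSpace ℝ F] {f : Cn n → F},
      DifferentiableAt ℝ f y → HasDerivAt (fun t : ℝ => f (y + t • v)) (fderiv ℝ f y v) 0 :=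
    fun {F} _ _ {f} hf => hf.hasFDerivAt.hasLineDerivAt v
  have key := hasDerivAt_volDensity_mul_fibInner (w := fun t : ℝ => w (y + t • v))
    (a := fun t => U (y + t • v)) (b := fun t => V (y + t • v)) (a' := dirD U y v)
    (b' := dirD V y v) (by simpa only [h0] using h.self_of_nhds) hη (line hw)
    (fun k => line (hU k)) (fun k => line (hV k))
  simp only [h0] at key
  exact key

/-- The derivative of `Λ`: `[D_v, Λ] = -(D_v ω ∧ ·)^⋆`. -/
theorem fibInner_dirD_lam (hw : DifferentiableAt ℝ w y)
    (h : ∀ᶠ x in nhds y, IsHermitianAt (w x)) (hV : FibDiffAt V y)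
    (hΛ : FibDiffAt (fun x => lamAt (w x) (V x)) y) (a : Fib n) (v : Cn n) :
    fibInner (cometric (w y)) a (dirD (fun x => lamAt (w x) (V x)) y v) =
      fibInner (cometric (w y)) a (lamAt (w y) (dirD V y v)) -
        fibInner (cometric (w y)) (wedgeL (fderiv ℝ w y v) a) (V y) := by
  have hc : FibDiffAt (fun _ => a) y := fun k => differentiableAt_const _
  have hL : FibDiffAt (fun x => wedgeL (w x) a) y :=
    FibDiffAt.family ((wedgeL (n := n) (p := 2)).restrictScalars ℝ) hw hc
  have d0 : dirD (fun _ => a) y v = 0 := Fib.ext fun k => by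
    simp [dirD_apply]
  have dL : dirD (fun x => wedgeL (w x) a) y v = wedgeL (fderiv ℝ w y v) a := by
    have := dirD_family ((wedgeL (n := n) (p := 2)).restrictScalars ℝ) hw hc v
    simp only [LinearMap.coe_restrictScalars, d0, map_zero, add_zero] at this
    exact this
  have k1 := hasLineDerivAt_weighted hw h hc hΛ v
  have k2 := hasLineDerivAt_weighted hw h hL hV v
  have hy := h.self_of_nhds
  have e : (fun x => (volDensity (w x) : ℂ) * fibInner (cometric (w x)) a (lamAt (w x) (V x)))
      =ᶠ[nhds y] fun x => (volDensity (w x) : ℂ) *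
        fibInner (cometric (w x)) (wedgeL (w x) a) (V x) := by
    filter_upwards [h] with x hx
    exact congrArg _ (hx.isAdjAt_lef a (V x)).symm
  have k3 := k1.unique (k2.congr_of_eventuallyEq e)
  have hv : (volDensity (w y) : ℂ) ≠ 0 :=
    Complex.ofReal_ne_zero.2 (Real.sqrt_pos.2 hy.gramMatrix_posDef.det_pos).ne'
  have k4 := mul_left_cancel₀ hv k3
  have adj : ∀ b c, fibInner (cometric (w y)) (wedgeL (w y) b) c =
      fibInner (cometric (w y)) b (lamAt (w y) c) := hy.isAdjAt_lef
  rw [d0, fibInner_zero_left, dL, adj, ← adj (lefComm (w y) (fderiv ℝ w y v) a)] at k4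
  have k5 := congrArg (fun P : FibEnd n => fibInner (cometric (w y)) (P a) (V y))
    (hy.lefComm_lef (fderiv ℝ w y v))
  simp only [LinearMap.sub_apply, Module.End.mul_apply, LinearMap.smul_apply, fibInner_sub_left,
    fibInner_smul_left, lefAt] at k5
  linear_combination k4 - k5

/-- The terms of the divergence of the vector field with components `⟨(b^s)^{1,0} ∧ U, V⟩`. -/
def divTerm (w : Cn n → Alt n 2) (U V : Cn n → Fib n) (y : Cn n) (s : Fin n ⊕ Fin n) : ℂ :=
  volDensity (w y) * (-fibInner (cometric (w y)) (lefComm (w y) (fderiv ℝ w y (stdBasis n s))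
      (ext₁ (covP Complex.I s) (U y))) (V y)
    + fibInner (cometric (w y)) (ext₁ (covP Complex.I s) (dirD U y (stdBasis n s))) (V y)
    + fibInner (cometric (w y)) (ext₁ (covP Complex.I s) (U y)) (dirD V y (stdBasis n s)))

theorem hasLineDerivAt_divTerm (hw : DifferentiableAt ℝ w y)
    (h : ∀ᶠ x in nhds y, IsHermitianAt (w x)) (hU : FibDiffAt U y) (hV : FibDiffAt V y)
    (s : Fin n ⊕ Fin n) : HasLineDerivAt ℝ (fun x => (volDensity (w x) : ℂ) *
      fibInner (cometric (w x)) (ext₁ (covP Complex.I s) (U x)) (V x))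
      (divTerm w U V y s) y (stdBasis n s) := by
  have := hasLineDerivAt_weighted hw h (hU.const_map (ext₁ (covP Complex.I s))) hV (stdBasis n s)
  rwa [dirD_const_map _ hU] at this

/-- The pointwise form of `(∂ + τ)^⋆ = i [Λ, ∂̄]`: the two sides differ by a divergence. -/
theorem sum_divTerm (hw : DifferentiableAt ℝ w y)
    (h : ∀ᶠ x in nhds y, IsHermitianAt (w x)) (hV : FibDiffAt V y)
    (hΛ : FibDiffAt (fun x => lamAt (w x) (V x)) y) :
    ∑ s, divTerm w U V y s = volDensity (w y) *
      (fibInner (cometric (w y))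
          (dFib Complex.I U y + torAt (w y) (dFlat Complex.I w y) (U y)) (V y) -
        fibInner (cometric (w y)) (U y) (Complex.I • (lamAt (w y) (dFib (-Complex.I) V y) -
          dFib (-Complex.I) (fun x => lamAt (w x) (V x)) y))) := by
  have hy := h.self_of_nhds
  have hs := hy.cometric_isSymm
  have term : ∀ s, divTerm w U V y s = volDensity (w y) *
      (fibInner (cometric (w y)) (ext₁ (covP Complex.I s) (dirD U y (stdBasis n s)) +
        (lamAt (w y) * (ext₁ (covP Complex.I s) * wedgeL (fderiv ℝ w y (stdBasis n s))) -
          (ext₁ (covP Complex.I s) * wedgeL (fderiv ℝ w y (stdBasis n s))) * lamAt (w y)) (U y))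
          (V y) -
        fibInner (cometric (w y)) (U y) (Complex.I • (lamAt (w y)
          (ext₁ (covP (-Complex.I) s) (dirD V y (stdBasis n s))) -
          ext₁ (covP (-Complex.I) s)
            (dirD (fun x => lamAt (w x) (V x)) y (stdBasis n s))))) := by
    intro s
    rw [divTerm]
    set e := covP Complex.I s
    set e' := covP (-Complex.I) s
    set η := fderiv ℝ w y (stdBasis n s)
    set DV := dirD V y (stdBasis n s)
    have he : conjCov e = e' := by
      rw [conjCov_covP, Complex.conj_I]
    have h1 : lamAt (w y) * ext₁ e - ext₁ e * lamAt (w y) =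
        -(Complex.I • contrCov (cometric (w y)) e) := by
      rw [hy.lam_ext₁, covI_covP (by simp), map_smul]
    have h2 : lamAt (w y) * ext₁ e' - ext₁ e' * lamAt (w y) =
        Complex.I • contrCov (cometric (w y)) e' := by
      rw [hy.lam_ext₁, covI_covP (by simp), map_smul, neg_smul, neg_neg]
    have h1' : contrCov (cometric (w y)) e (U y) =
        Complex.I • (lamAt (w y) (ext₁ e (U y)) - ext₁ e (lamAt (w y) (U y))) := by
      have := congrArg (fun P : FibEnd n => Complex.I • P (U y)) h1
      simp only [LinearMap.sub_apply, Module.End.mul_apply, LinearMap.neg_apply,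
        LinearMap.smul_apply, smul_neg, smul_smul, Complex.I_mul_I, neg_smul, one_smul,
        neg_neg] at this
      exact this.symm
    have h2' : contrCov (cometric (w y)) e' DV =
        -(Complex.I • (lamAt (w y) (ext₁ e' DV) - ext₁ e' (lamAt (w y) DV))) := by
      have := congrArg (fun P : FibEnd n => Complex.I • P DV) h2
      simp only [LinearMap.sub_apply, Module.End.mul_apply,
        LinearMap.smul_apply, smul_smul, Complex.I_mul_I, neg_smul, one_smul] at this
      rw [this, neg_neg]
    have h3 : fibInner (cometric (w y)) (U y) (ext₁ e' (lamAt (w y) DV)) =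
        fibInner (cometric (w y)) (U y)
          (ext₁ e' (dirD (fun x => lamAt (w x) (V x)) y (stdBasis n s))) +
        fibInner (cometric (w y)) (wedgeL η (contrCov (cometric (w y)) e (U y))) (V y) := by
      have a := isAdjAt_contrCov hs e
      rw [he] at a
      rw [← a, ← a, fibInner_dirD_lam hw h hV hΛ]
      ring
    have h4 : fibInner (cometric (w y)) (ext₁ e (U y)) DV =
        fibInner (cometric (w y)) (U y) (contrCov (cometric (w y)) e' DV) := by
      rw [isAdjAt_ext₁, he]
    have h5 : ∀ a, wedgeL η (ext₁ e a) = ext₁ e (wedgeL η a) := fun a =>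
      congrArg (fun P : FibEnd n => P a) (commute_ext₁_wedgeL_two e η).symm
    rw [h4, h2', fibInner_neg_right hs, fibInner_smul_right hs, fibInner_smul_right hs,
      fibInner_sub_right hs, fibInner_sub_right hs, h3, h1', map_smul, map_sub, h5, lefComm]
    simp only [LinearMap.sub_apply, Module.End.mul_apply, fibInner_smul_left, fibInner_sub_left,
      fibInner_add_left, Complex.conj_I, h5]
    linear_combination -(volDensity (w y) : ℂ) * (fibInner (cometric (w y))
      (wedgeL η (lamAt (w y) (ext₁ e (U y)))) (V y) - fibInner (cometric (w y))
      (ext₁ e (wedgeL η (lamAt (w y) (U y)))) (V y)) * Complex.I_mul_I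
  simp only [term]
  rw [← Finset.mul_sum, Finset.sum_sub_distrib, ← fibInner_sum_left, torAt, wedgeL_dFlat,
    dFib_eq_sum, dFib_eq_sum, dFib_eq_sum]
  have hr : ∀ b : (Fin n ⊕ Fin n) → Fib n, ∑ s, fibInner (cometric (w y)) (U y) (b s) =
      fibInner (cometric (w y)) (U y) (∑ s, b s) := by
    intro b
    simp only [← fibInner_conj_symm hs _ (U y)]
    rw [fibInner_sum_left, map_sum]
  rw [hr]
  congr 3
  · rw [Finset.sum_add_distrib]
    congr 1
    rw [Finset.mul_sum, Finset.sum_mul, ← Finset.sum_sub_distrib, LinearMap.sum_apply]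
  · rw [← Finset.smul_sum, Finset.sum_sub_distrib, map_sum]

end Divergence

end
end HermitianForms

namespace HermitianForms
noncomputable section

variable {n : ℕ}

/-! ### Linear changes of coordinates -/

/-- Pull-back of forms of mixed degree by a linear map. -/
def pullFib (A : Cn n →L[ℝ] Cn n) : Fib n →ₗ[ℂ] Fib n where
  toFun a := fun k => (a k).compContinuousLinearMap A
  map_add' _ _ := rfl
  map_smul' _ _ := rfl

theorem pullFib_apply (A : Cn n →L[ℝ] Cn n) (a : Fib n) (k : ℕ) :
    pullFib A a k = (a k).compContinuousLinearMap A := rfl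

theorem pullFib_comp (A B : Cn n →L[ℝ] Cn n) (a : Fib n) :
    pullFib (A.comp B) a = pullFib B (pullFib A a) := rfl

theorem pullFib_id (a : Fib n) : pullFib (ContinuousLinearMap.id ℝ (Cn n)) a = a := rfl

theorem pullFib_wedgeL (A : Cn n →L[ℝ] Cn n) {p : ℕ} (α : Alt n p) (a : Fib n) :
    pullFib A (wedgeL α a) = wedgeL (α.compContinuousLinearMap A) (pullFib A a) := by
  refine Fib.ext fun m => ?_
  rw [pullFib_apply]
  by_cases hp : p ≤ m
  · rw [wedgeL_apply (Nat.add_sub_of_le hp), wedgeL_apply (Nat.add_sub_of_le hp), pullFib_apply,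
      wedge_compContinuousLinearMap]
  · rw [wedgeL_of_lt (by omega), wedgeL_of_lt (by omega)]
    rfl

/-- The matrix of a real-linear map in the standard basis. -/
def matOf (A : Cn n →L[ℝ] Cn n) : Matrix (Fin n ⊕ Fin n) (Fin n ⊕ Fin n) ℝ :=
  LinearMap.toMatrix (stdBasis n) (stdBasis n) A

theorem apply_stdBasis (A : Cn n →L[ℝ] Cn n) (t : Fin n ⊕ Fin n) :
    A (stdBasis n t) = ∑ s, matOf A s t • stdBasis n s := by
  rw [← (stdBasis n).sum_repr (A (stdBasis n t))]
  simp [matOf, LinearMap.toMatrix_apply]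

theorem det_matOf (A : Cn n →L[ℝ] Cn n) : (matOf A).det = A.det :=
  LinearMap.det_toMatrix _ _

theorem gramMatrix_comp (w : Alt n 2) (A : Cn n →L[ℂ] Cn n) :
    gramMatrix (w.compContinuousLinearMap (A.restrictScalars ℝ)) =
      (matOf (A.restrictScalars ℝ)).transpose * gramMatrix w * matOf (A.restrictScalars ℝ) := by
  ext s t
  have e : gramMatrix (w.compContinuousLinearMap (A.restrictScalars ℝ)) s t =
      (bil w (A.restrictScalars ℝ (stdBasis n s))
        (mulI n (A.restrictScalars ℝ (stdBasis n t)))).re := by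
    rw [gramMatrix_apply, bil_apply, bil_apply]
    have e2 : (A.restrictScalars ℝ ∘ ![stdBasis n s, mulI n (stdBasis n t)]) =
        ![A.restrictScalars ℝ (stdBasis n s), mulI n (A.restrictScalars ℝ (stdBasis n t))] := by
      funext i
      fin_cases i
      · rfl
      · exact map_smul A Complex.I (stdBasis n t)
    rw [← e2]
    rfl
  rw [e, apply_stdBasis, apply_stdBasis]
  simp only [map_sum, map_smul, LinearMap.sum_apply, LinearMap.smul_apply, Complex.re_sum,
    Matrix.mul_apply, Matrix.transpose_apply, gramMatrix_apply, Complex.real_smul,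
    Complex.re_ofReal_mul, Finset.sum_mul, Finset.mul_sum]
  refine Finset.sum_congr rfl fun q _ => Finset.sum_congr rfl fun p _ => ?_
  ring

section Iso

variable {w : Alt n 2} {A : Cn n →L[ℂ] Cn n}

theorem IsRealOneOne.comp (h : IsRealOneOne w) (A : Cn n →L[ℂ] Cn n) :
    IsRealOneOne (w.compContinuousLinearMap (A.restrictScalars ℝ)) := by
  have e : ∀ u v, (w.compContinuousLinearMap (A.restrictScalars ℝ)) ![u, v] = w ![A u, A v] := by
    intro u v
    rw [ContinuousAlternatingMap.compContinuousLinearMap_apply]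
    congr 1
    funext i
    fin_cases i <;> rfl
  refine ⟨fun u v => ?_, fun u v => ?_⟩
  · rw [e, h.real]
  · rw [e, e, map_smul, map_smul, h.type]

theorem IsHermitianAt.comp (h : IsHermitianAt w) (hA : Function.Injective A) :
    IsHermitianAt (w.compContinuousLinearMap (A.restrictScalars ℝ)) := by
  refine ⟨h.toIsRealOneOne.comp A, fun v hv => ?_⟩
  have e : (w.compContinuousLinearMap (A.restrictScalars ℝ)) ![v, Complex.I • v] =
      w ![A v, Complex.I • A v] := by
    rw [ContinuousAlternatingMap.compContinuousLinearMap_apply]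
    congr 1
    funext i
    fin_cases i
    · rfl
    · exact map_smul A Complex.I v
  rw [e]
  exact h.pos _ fun h0 => hv (hA (by rw [h0, map_zero]))

theorem IsHermitianAt.matOf_det_ne_zero (h : IsHermitianAt w) (hA : Function.Injective A) :
    (matOf (A.restrictScalars ℝ)).det ≠ 0 := by
  have h1 := (h.comp hA).gramMatrix_posDef.det_pos.ne'
  rw [gramMatrix_comp, Matrix.det_mul] at h1
  exact right_ne_zero_of_mul h1

theorem volDensity_comp (w : Alt n 2) (A : Cn n →L[ℂ] Cn n) :
    volDensity (w.compContinuousLinearMap (A.restrictScalars ℝ)) =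
      |(A.restrictScalars ℝ).det| * volDensity w := by
  rw [volDensity, gramMatrix_comp, Matrix.det_mul, Matrix.det_mul, Matrix.det_transpose,
    det_matOf, show (A.restrictScalars ℝ).det * (gramMatrix w).det * (A.restrictScalars ℝ).det =
      (A.restrictScalars ℝ).det ^ 2 * (gramMatrix w).det by ring,
    Real.sqrt_mul (sq_nonneg _), Real.sqrt_sq_eq_abs]
  rfl

theorem IsHermitianAt.cometric_comp (h : IsHermitianAt w) (hA : Function.Injective A) :
    cometric w = matOf (A.restrictScalars ℝ) *
      cometric (w.compContinuousLinearMap (A.restrictScalars ℝ)) *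
        (matOf (A.restrictScalars ℝ)).transpose := by
  have hM : IsUnit (matOf (A.restrictScalars ℝ)).det :=
    isUnit_iff_ne_zero.2 (h.matOf_det_ne_zero hA)
  have hMt : IsUnit (matOf (A.restrictScalars ℝ)).transpose.det := by rwa [Matrix.det_transpose]
  rw [cometric, cometric, gramMatrix_comp, Matrix.mul_inv_rev, Matrix.mul_inv_rev]
  set M := matOf (A.restrictScalars ℝ)
  calc (gramMatrix w)⁻¹ = (M * M⁻¹) * (gramMatrix w)⁻¹ * ((M.transpose)⁻¹ * M.transpose) := by
        rw [Matrix.mul_nonsing_inv _ hM, Matrix.nonsing_inv_mul _ hMt, Matrix.one_mul,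
          Matrix.mul_one]
    _ = _ := by simp only [Matrix.mul_assoc]

/-- Pull-back by an isomorphism is an isometry for the pulled back metric. -/
theorem IsHermitianAt.cometricInner_pull (h : IsHermitianAt w) (hA : Function.Injective A) {k : ℕ}
    (a b : Alt n k) :
    cometricInner (cometric (w.compContinuousLinearMap (A.restrictScalars ℝ)))
      (a.compContinuousLinearMap (A.restrictScalars ℝ))
      (b.compContinuousLinearMap (A.restrictScalars ℝ)) = cometricInner (cometric w) a b := by
  rw [h.cometric_comp hA]
  exact (cometricInner_comp _ _ _ (apply_stdBasis _) a b).symm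

theorem IsHermitianAt.fibInner_pull (h : IsHermitianAt w) (hA : Function.Injective A)
    (a b : Fib n) :
    fibInner (cometric (w.compContinuousLinearMap (A.restrictScalars ℝ)))
      (pullFib (A.restrictScalars ℝ) a) (pullFib (A.restrictScalars ℝ) b) =
        fibInner (cometric w) a b :=
  Finset.sum_congr rfl fun k _ => h.cometricInner_pull hA (a k) (b k)

theorem pullFib_surjective (hA : Function.Bijective A) :
    Function.Surjective (pullFib (A.restrictScalars ℝ)) := by
  let e : Cn n ≃ₗ[ℝ] Cn n := LinearEquiv.ofBijective (A.restrictScalars ℝ).toLinearMap hA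
  let B : Cn n →L[ℝ] Cn n := LinearMap.toContinuousLinearMap e.symm.toLinearMap
  intro a
  refine ⟨pullFib B a, ?_⟩
  rw [← pullFib_comp]
  have : B.comp (A.restrictScalars ℝ) = ContinuousLinearMap.id ℝ (Cn n) := by
    ext1 v
    exact e.symm_apply_apply v
  rw [this, pullFib_id]

/-- Adjoints of exterior multiplications are natural. -/
theorem IsHermitianAt.pullFib_wedgeAdj (h : IsHermitianAt w) (hA : Function.Bijective A) {p : ℕ}
    (α : Alt n p) (b : Fib n) :
    pullFib (A.restrictScalars ℝ) (wedgeAdj (cometric w) α b) =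
      wedgeAdj (cometric (w.compContinuousLinearMap (A.restrictScalars ℝ)))
        (α.compContinuousLinearMap (A.restrictScalars ℝ)) (pullFib (A.restrictScalars ℝ) b) := by
  have h' := h.comp hA.injective
  have hs' := h'.cometric_isSymm
  apply fibInner_ext h'.cometric_posDef
  intro c
  obtain ⟨a, rfl⟩ := pullFib_surjective hA c
  rw [h.fibInner_pull hA.injective, (isAdjAt_wedgeL h.cometric_isSymm α).symm h.cometric_isSymm,
    (isAdjAt_wedgeL hs' _).symm hs', ← pullFib_wedgeL, h.fibInner_pull hA.injective]

end Iso

/-! ### Smooth families of operators -/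

/-- A family of operators that sends `C^∞` forms on `O` to `C^∞` forms. -/
def SmoothFam (P : Cn n → FibEnd n) (O : Set (Cn n)) : Prop :=
  ∀ U, FibSmoothOn U O → FibSmoothOn (fun y => P y (U y)) O

section SmoothFam

variable {O : Set (Cn n)} {P R : Cn n → FibEnd n}

theorem SmoothFam.mul (hP : SmoothFam P O) (hR : SmoothFam R O) :
    SmoothFam (fun y => P y * R y) O := fun U hU => hP _ (hR U hU)

theorem smoothFam_sum {ι : Type*} (s : Finset ι) {P : ι → Cn n → FibEnd n}
    (h : ∀ i ∈ s, SmoothFam (P i) O) : SmoothFam (fun y => ∑ i ∈ s, P i y) O := fun U hU k => by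
  simp only [LinearMap.sum_apply, Fib.sum_apply]
  exact ContDiffOn.sum fun i hi => h i hi U hU k

theorem SmoothFam.smul {f : Cn n → ℂ} (hf : ContDiffOn ℝ ∞ f O) (hP : SmoothFam P O) :
    SmoothFam (fun y => f y • P y) O := fun U hU k => by
  simp only [LinearMap.smul_apply, Fib.smul_apply]
  exact hf.smul (hP U hU k)

theorem smoothFam_const (P : FibEnd n) : SmoothFam (fun _ => P) O := fun _ hU => hU.const_map P

theorem smoothFam_wedgeL {p : ℕ} {α : Cn n → Alt n p} (hα : ContDiffOn ℝ ∞ α O) :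
    SmoothFam (fun y => wedgeL (α y)) O := fun _ hU =>
  FibSmoothOn.family ((wedgeL (n := n) (p := p)).restrictScalars ℝ) hα hU

theorem smoothFam_contrCov {Q : Cn n → Matrix (Fin n ⊕ Fin n) (Fin n ⊕ Fin n) ℝ}
    (hQ : ∀ s t, ContDiffOn ℝ ∞ (fun y => Q y s t) O) (β : Cov n) :
    SmoothFam (fun y => contrCov (Q y) β) O := by
  simp only [contrCov_apply]
  refine smoothFam_sum _ fun s _ => smoothFam_sum _ fun t _ => ?_
  exact SmoothFam.smul ((Complex.ofRealCLM.contDiff.comp_contDiffOn (hQ s t)).mul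
    contDiffOn_const) (smoothFam_const _)

theorem smoothFam_wedgeAdj {Q : Cn n → Matrix (Fin n ⊕ Fin n) (Fin n ⊕ Fin n) ℝ}
    (hQ : ∀ s t, ContDiffOn ℝ ∞ (fun y => Q y s t) O) {p : ℕ} {α : Cn n → Alt n p}
    (hα : ContDiffOn ℝ ∞ α O) : SmoothFam (fun y => wedgeAdj (Q y) (α y)) O := by
  induction p with
  | zero =>
    simp only [wedgeAdj_zero, Algebra.algebraMap_eq_smul_one]
    refine SmoothFam.smul ?_ (smoothFam_const 1)
    exact (Complex.conjCLE : ℂ →L[ℝ] ℂ).contDiff.comp_contDiffOn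
      ((ContinuousAlternatingMap.apply ℝ (Cn n) ℂ ![]).contDiff.comp_contDiffOn hα)
  | succ p ih =>
    simp only [wedgeAdj_succ]
    refine SmoothFam.smul contDiffOn_const (smoothFam_sum _ fun s _ => SmoothFam.mul (ih ?_)
      (smoothFam_contrCov hQ _))
    let T : Alt n (p + 1) →L[ℝ] Alt n p := LinearMap.toContinuousLinearMap
      { toFun := fun a => a.curryLeft (stdBasis n s)
        map_add' := fun _ _ => rfl
        map_smul' := fun _ _ => rfl }
    exact T.contDiff.comp_contDiffOn hα

end SmoothFam

section MetricSmooth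

variable {w : Cn n → Alt n 2} {O : Set (Cn n)}

theorem contDiffOn_gramMatrix {r : WithTop ℕ∞} (hw : ContDiffOn ℝ r w O) (s t : Fin n ⊕ Fin n) :
    ContDiffOn ℝ r (fun y => gramMatrix (w y) s t) O := by
  simp only [gramMatrix, Matrix.of_apply]
  exact Complex.reCLM.contDiff.comp_contDiffOn
    ((ContinuousAlternatingMap.apply ℝ (Cn n) ℂ
      ![realBasis n s, Complex.I • realBasis n t]).contDiff.comp_contDiffOn hw)

theorem contDiffOn_det_gramMatrix {r : WithTop ℕ∞} (hw : ContDiffOn ℝ r w O) :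
    ContDiffOn ℝ r (fun y => (gramMatrix (w y)).det) O :=
  contDiff_det.comp_contDiffOn (contDiffOn_pi.2 fun s => contDiffOn_pi.2 fun t =>
    contDiffOn_gramMatrix hw s t)

theorem contDiffOn_volDensity {r : WithTop ℕ∞} (hw : ContDiffOn ℝ r w O)
    (h : ∀ y ∈ O, IsHermitianAt (w y)) : ContDiffOn ℝ r (fun y => volDensity (w y)) O :=
  (contDiffOn_det_gramMatrix hw).sqrt fun y hy => (h y hy).gramMatrix_posDef.det_pos.ne'

theorem contDiffOn_cometric {r : WithTop ℕ∞} (hw : ContDiffOn ℝ r w O)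
    (h : ∀ y ∈ O, IsHermitianAt (w y)) (s t : Fin n ⊕ Fin n) :
    ContDiffOn ℝ r (fun y => cometric (w y) s t) O := by
  simp only [cometric, Matrix.inv_def, Matrix.smul_apply, Ring.inverse_eq_inv',
    Matrix.adjugate_apply, smul_eq_mul]
  refine ((contDiffOn_det_gramMatrix hw).inv fun y hy =>
    (h y hy).gramMatrix_posDef.det_pos.ne').mul ?_
  have hH : ContDiffOn ℝ r (F := (Fin n ⊕ Fin n) → (Fin n ⊕ Fin n) → ℝ)
      (fun y => (gramMatrix (w y)).updateRow t (Pi.single s 1)) O := by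
    refine contDiffOn_pi.2 fun p => contDiffOn_pi.2 fun q => ?_
    by_cases hp : p = t
    · subst hp
      simp only [Matrix.updateRow_self]
      exact contDiffOn_const
    · simp only [Matrix.updateRow_ne hp]
      exact contDiffOn_gramMatrix hw p q
  exact contDiff_det.comp_contDiffOn hH

theorem contDiffOn_cometricInner {Q : Cn n → Matrix (Fin n ⊕ Fin n) (Fin n ⊕ Fin n) ℝ}
    {r : WithTop ℕ∞} (hQ : ∀ s t, ContDiffOn ℝ r (fun y => Q y s t) O) {k : ℕ}
    {a b : Cn n → Alt n k} (ha : ContDiffOn ℝ r a O) (hb : ContDiffOn ℝ r b O) :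
    ContDiffOn ℝ r (fun y => cometricInner (Q y) (a y) (b y)) O := by
  have ev : ∀ {a : Cn n → Alt n k} (m : Fin k → Cn n), ContDiffOn ℝ r a O →
      ContDiffOn ℝ r (fun y => a y m) O := fun m ha =>
    (ContinuousAlternatingMap.apply ℝ (Cn n) ℂ m).contDiff.comp_contDiffOn ha
  simp only [cometricInner]
  refine contDiffOn_const.mul (ContDiffOn.sum fun s _ => ContDiffOn.sum fun t _ => ?_)
  refine ((contDiffOn_prod fun i _ => ?_).mul (ev _ ha)).mul
    ((Complex.conjCLE : ℂ →L[ℝ] ℂ).contDiff.comp_contDiffOn (ev _ hb))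
  exact Complex.ofRealCLM.contDiff.comp_contDiffOn (hQ _ _)

theorem contDiffOn_fibInner {Q : Cn n → Matrix (Fin n ⊕ Fin n) (Fin n ⊕ Fin n) ℝ}
    (hQ : ∀ s t, ContDiffOn ℝ ∞ (fun y => Q y s t) O) {U V : Cn n → Fib n}
    (hU : FibSmoothOn U O) (hV : FibSmoothOn V O) :
    ContDiffOn ℝ ∞ (fun y => fibInner (Q y) (U y) (V y)) O :=
  ContDiffOn.sum fun k _ => contDiffOn_cometricInner hQ (hU k) (hV k)

end MetricSmooth

end
end HermitianForms

namespace HermitianForms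
noncomputable section

variable {n : ℕ}

/-! ### Forms in charts -/

set_option linter.unusedSectionVars false

section Charts

variable {X : Type*} [TopologicalSpace X] [ChartedSpace (Cn n) X]

/-- The preferred chart at `c`. -/
abbrev cht (n : ℕ) {X : Type*} [TopologicalSpace X] [ChartedSpace (Cn n) X] (c : X) :
    PartialEquiv X (Cn n) := extChartAt 𝓘(ℂ, Cn n) c

/-- The change of coordinates between the charts at `c` and at `x`. -/
def chg (c x : X) : Cn n → Cn n := cht n x ∘ (cht n c).symm

/-- The set where the change of coordinates is defined. -/
def chgDom (n : ℕ) {X : Type*} [TopologicalSpace X] [ChartedSpace (Cn n) X] (c x : X) :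
    Set (Cn n) := ((cht n c).symm ≫ cht n x).source

theorem isOpen_cht_target (c : X) : IsOpen (cht n c).target := isOpen_extChartAt_target c

theorem isOpen_cht_source (c : X) : IsOpen (cht n c).source := isOpen_extChartAt_source c

theorem mem_chgDom {c x : X} {y : Cn n} :
    y ∈ chgDom n c x ↔ y ∈ (cht n c).target ∧ (cht n c).symm y ∈ (cht n x).source := by
  simp [chgDom, PartialEquiv.trans_source]

theorem isOpen_chgDom (c x : X) : IsOpen (chgDom n c x) := by
  have : chgDom n c x = (cht n c).target ∩ (cht n c).symm ⁻¹' (cht n x).source := by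
    ext y; exact mem_chgDom
  rw [this]
  exact (continuousOn_extChartAt_symm c).isOpen_inter_preimage (isOpen_cht_target c)
    (isOpen_cht_source x)

theorem mem_chgDom_self {c : X} {y : Cn n} (hy : y ∈ (cht n c).target) :
    y ∈ chgDom n c ((cht n c).symm y) :=
  mem_chgDom.2 ⟨hy, mem_extChartAt_source _⟩

theorem chg_apply (c x : X) (y : Cn n) : chg c x y = cht n x ((cht n c).symm y) := rfl

theorem symm_chg {c x : X} {y : Cn n} (hy : y ∈ chgDom n c x) :
    (cht n x).symm (chg c x y) = (cht n c).symm y :=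
  (cht n x).left_inv (mem_chgDom.1 hy).2

theorem chg_mem_target {c x : X} {y : Cn n} (hy : y ∈ chgDom n c x) :
    chg c x y ∈ (cht n x).target := (cht n x).map_source (mem_chgDom.1 hy).2

theorem chg_chg {c x : X} {y : Cn n} (hy : y ∈ chgDom n c x) : chg x c (chg c x y) = y := by
  rw [chg_apply, symm_chg hy, (cht n c).right_inv (mem_chgDom.1 hy).1]

variable [IsManifold 𝓘(ℂ, Cn n) ∞ X]

theorem contDiffOn_chg (c x : X) : ContDiffOn ℂ ∞ (chg c x) (chgDom n c x) :=
  contDiffOn_ext_coord_change x c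

theorem contDiffAt_chg {c x : X} {y : Cn n} (hy : y ∈ chgDom n c x) :
    ContDiffAt ℂ ∞ (chg c x) y :=
  (contDiffOn_chg c x).contDiffAt ((isOpen_chgDom c x).mem_nhds hy)

theorem differentiableAt_chg {c x : X} {y : Cn n} (hy : y ∈ chgDom n c x) :
    DifferentiableAt ℂ (chg c x) y :=
  (contDiffAt_chg hy).differentiableAt (by simp)

theorem fderiv_real_chg {c x : X} {y : Cn n} (hy : y ∈ chgDom n c x) :
    fderiv ℝ (chg c x) y = (fderiv ℂ (chg c x) y).restrictScalars ℝ :=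
  (differentiableAt_chg hy).fderiv_restrictScalars ℝ

theorem chartSymmDeriv_eq (c : X) (y : Cn n) :
    chartSymmDeriv c y = fderiv ℂ (chg c ((cht n c).symm y)) y := rfl

/-- The chain rule for changes of coordinates. -/
theorem fderiv_chg_comp {c x z : X} {y : Cn n} (hx : y ∈ chgDom n c x) (hz : y ∈ chgDom n c z) :
    (fderiv ℂ (chg x z) (chg c x y)).comp (fderiv ℂ (chg c x) y) = fderiv ℂ (chg c z) y := by
  have hxz : chg c x y ∈ chgDom n x z := mem_chgDom.2 ⟨chg_mem_target hx, by
    rw [symm_chg hx]; exact (mem_chgDom.1 hz).2⟩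
  rw [← fderiv_comp y (differentiableAt_chg hxz) (differentiableAt_chg hx)]
  refine Filter.EventuallyEq.fderiv_eq ?_
  filter_upwards [(isOpen_chgDom c x).mem_nhds hx] with y' hy'
  rw [Function.comp_apply, chg_apply, symm_chg hy', chg_apply]

theorem fderiv_chg_self {c : X} {y : Cn n} (hy : y ∈ (cht n c).target) :
    fderiv ℂ (chg c c) y = ContinuousLinearMap.id ℂ (Cn n) := by
  rw [← fderiv_id (𝕜 := ℂ) (x := y)]
  refine Filter.EventuallyEq.fderiv_eq ?_
  filter_upwards [(isOpen_cht_target c).mem_nhds hy] with y' hy'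
  exact (cht n c).right_inv hy'

theorem fderiv_chg_bijective {c x : X} {y : Cn n} (hy : y ∈ chgDom n c x) :
    Function.Bijective (fderiv ℂ (chg c x) y) := by
  have hc : y ∈ chgDom n c c :=
    mem_chgDom.2 ⟨(mem_chgDom.1 hy).1, (cht n c).map_target (mem_chgDom.1 hy).1⟩
  have h := fderiv_chg_comp hy hc
  rw [fderiv_chg_self (mem_chgDom.1 hy).1] at h
  have hinj : Function.Injective (fderiv ℂ (chg c x) y) := fun a b hab => by
    have := congrArg (fun T : Cn n →L[ℂ] Cn n => T a) h
    have h2 := congrArg (fun T : Cn n →L[ℂ] Cn n => T b) h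
    simp only [ContinuousLinearMap.comp_apply, ContinuousLinearMap.id_apply] at this h2
    rw [← this, ← h2, hab]
  exact ⟨hinj, LinearMap.surjective_of_injective
    (f := (fderiv ℂ (chg c x) y).toLinearMap) hinj⟩

theorem chartSymmDeriv_bijective {c : X} {y : Cn n} (hy : y ∈ (cht n c).target) :
    Function.Bijective (chartSymmDeriv c y) :=
  fderiv_chg_bijective (mem_chgDom_self hy)

/-- The expressions of a form in two charts differ by a change of coordinates. -/
theorem localRep_eq {k : ℕ} (α : HForm n k X) {c x : X} {y : Cn n} (hy : y ∈ chgDom n c x) :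
    localRep c α y =
      (localRep x α (chg c x y)).compContinuousLinearMap (fderiv ℝ (chg c x) y) := by
  have h : (chartSymmDeriv x (chg c x y)).comp (fderiv ℂ (chg c x) y) = chartSymmDeriv c y := by
    rw [chartSymmDeriv_eq, chartSymmDeriv_eq, symm_chg hy]
    exact fderiv_chg_comp hy (mem_chgDom_self (mem_chgDom.1 hy).1)
  rw [localRep, ← h, fderiv_real_chg hy, localRep, symm_chg hy]
  rfl

theorem localRep_self {k : ℕ} (α : HForm n k X) (x : X) : localRep x α (cht n x x) = α x := by
  have h : chartSymmDeriv x (cht n x x) = ContinuousLinearMap.id ℂ (Cn n) := by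
    rw [chartSymmDeriv_eq, extChartAt_to_inv]
    exact fderiv_chg_self (mem_extChartAt_target x)
  rw [localRep, h, extChartAt_to_inv]
  rfl

theorem hform_ext {k : ℕ} {α β : HForm n k X}
    (h : ∀ c : X, ∀ y ∈ (cht n c).target, localRep c α y = localRep c β y) : α = β :=
  funext fun x => by
    rw [← localRep_self α, ← localRep_self β, h x _ (mem_extChartAt_target x)]

theorem IsSmoothH.contDiffAt {k : ℕ} {α : HForm n k X} (hα : IsSmoothH α) {c : X} {y : Cn n}
    (hy : y ∈ (cht n c).target) : ContDiffAt ℝ ∞ (localRep c α) y :=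
  (hα c).contDiffAt ((isOpen_cht_target c).mem_nhds hy)

theorem IsSmoothH.differentiableAt {k : ℕ} {α : HForm n k X} (hα : IsSmoothH α) {c : X} {y : Cn n}
    (hy : y ∈ (cht n c).target) : DifferentiableAt ℝ (localRep c α) y :=
  (hα.contDiffAt hy).differentiableAt (by simp)

/-- `∂` (for `ε = i`) and `∂̄` (for `ε = -i`) on `k`-forms. -/
def dH (ε : ℂ) {k : ℕ} (α : HForm n k X) : HForm n (k + 1) X :=
  fun x => dFlat ε (localRep x α) (cht n x x)

theorem delbar_eq {k : ℕ} (α : HForm n k X) : delbar α = dH (-Complex.I) α :=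
  funext fun _ => congrFun (delbarFlat_eq _) _

theorem extD_eq {k : ℕ} (α : HForm n k X) : extD α = dH Complex.I α + dH (-Complex.I) α :=
  funext fun _ => extDeriv_eq_dFlat_add _ _

/-- `∂` and `∂̄` are computed in any chart. -/
theorem localRep_dH (ε : ℂ) {k : ℕ} {α : HForm n k X} (hα : IsSmoothH α) {c : X} {y : Cn n}
    (hy : y ∈ (cht n c).target) : localRep c (dH ε α) y = dFlat ε (localRep c α) y := by
  have hy' := mem_chgDom_self hy
  set x := (cht n c).symm y with hx
  have e1 : chg c x y = cht n x x := rfl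
  have e2 : localRep c (dH ε α) y =
      (dFlat ε (localRep x α) (chg c x y)).compContinuousLinearMap (fderiv ℝ (chg c x) y) := by
    rw [fderiv_real_chg hy']
    rfl
  have e3 : localRep c α =ᶠ[nhds y] fun y' =>
      (localRep x α (chg c x y')).compContinuousLinearMap (fderiv ℝ (chg c x) y') := by
    filter_upwards [(isOpen_chgDom c x).mem_nhds hy'] with y' h' using localRep_eq α h'
  have e4 : dFlat ε (localRep c α) y = dFlat ε (fun y' =>
      (localRep x α (chg c x y')).compContinuousLinearMap (fderiv ℝ (chg c x) y')) y := by
    rw [dFlat, dFlat, e3.fderiv_eq]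
  rw [e2, e4, dFlat_pullback ε (hα.differentiableAt (chg_mem_target hy'))
    (((contDiffAt_chg hy').restrict_scalars ℝ).of_le ENat.LEInfty.out)]
  filter_upwards [(isOpen_chgDom c x).mem_nhds hy'] with y' h'
  rw [fderiv_real_chg h']
  ext1 v
  exact map_smul (fderiv ℂ (chg c x) y') Complex.I v

theorem IsSmoothH.dH (ε : ℂ) {k : ℕ} {α : HForm n k X} (hα : IsSmoothH α) :
    IsSmoothH (dH ε α) := fun c =>
  (ContDiffOn.dFlat ε (isOpen_cht_target c) (hα c)).congr fun _ hy => localRep_dH ε hα hy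

theorem dH_dH (ε ε' : ℂ) {k : ℕ} {α : HForm n k X} (hα : IsSmoothH α) :
    dH ε (dH ε' α) = -dH ε' (dH ε α) := by
  have h : ∀ ε ε', ∀ c : X, ∀ y ∈ (cht n c).target,
      localRep c (HermitianForms.dH ε (HermitianForms.dH ε' α)) y =
        dFlat ε (dFlat ε' (localRep c α)) y := by
    intro ε ε' c y hy
    rw [localRep_dH ε (hα.dH ε') hy]
    have : localRep c (HermitianForms.dH ε' α) =ᶠ[nhds y] dFlat ε' (localRep c α) := by
      filter_upwards [(isOpen_cht_target c).mem_nhds hy] with y' h' using localRep_dH ε' hα h'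
    rw [dFlat, dFlat, this.fderiv_eq]
  refine hform_ext fun c y hy => ?_
  have e : localRep c (-HermitianForms.dH ε' (HermitianForms.dH ε α)) y =
      -localRep c (HermitianForms.dH ε' (HermitianForms.dH ε α)) y := rfl
  rw [e, h _ _ c y hy, h _ _ c y hy,
    dFlat_dFlat _ _ ((hα.contDiffAt hy).of_le ENat.LEInfty.out)]

end Charts

end
end HermitianForms

namespace HermitianForms
noncomputable section

variable {n : ℕ}

/-! ### Forms of mixed degree and their operators -/

section Forms

variable {X : Type*}

/-- The value at `x` of a form of mixed degree. -/
def atPt (u : Form n X) (x : X) : Fib n := fun k => u k x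

theorem form_ext_atPt {u v : Form n X} (h : ∀ x, atPt u x = atPt v x) : u = v :=
  funext fun k => funext fun x => congrFun (h x) k

/-- The operator acting through a family of endomorphisms of the fibres. -/
def ptOp (P : X → FibEnd n) : Op n X := fun u k x => P x (atPt u x) k

/-- The adjoint of `α ∧ ·` in each fibre. -/
def adjOp (ω₀ : HForm n 2 X) {p : ℕ} (α : HForm n p X) : Op n X :=
  ptOp fun x => wedgeAdj (cometric (ω₀ x)) (α x)

/-- The complex conjugate of a form. -/
def conjH {k : ℕ} (α : HForm n k X) : HForm n k X := fun x => conjAlt (α x)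

theorem conjAlt_apply {k : ℕ} (a : Alt n k) (v : Fin k → Cn n) :
    conjAlt a v = (starRingEnd ℂ) (a v) := rfl

theorem conjAlt_conjAlt {k : ℕ} (a : Alt n k) : conjAlt (conjAlt a) = a := by
  ext v; simp [conjAlt_apply]

theorem conjFib_conjFib (a : Fib n) : conjFib (conjFib a) = a :=
  Fib.ext fun k => conjAlt_conjAlt (a k)

theorem conjForm_conjForm (u : Form n X) : conjForm (conjForm u) = u :=
  funext fun k => funext fun x => conjAlt_conjAlt (u k x)

theorem conjFib_add (a b : Fib n) : conjFib (a + b) = conjFib a + conjFib b :=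
  Fib.ext fun k => by
    change conjAlt (a k + b k) = conjAlt (a k) + conjAlt (b k)
    ext v; simp [conjAlt_apply]

theorem conjFib_smul (r : ℂ) (a : Fib n) : conjFib (r • a) = (starRingEnd ℂ) r • conjFib a :=
  Fib.ext fun k => by
    change conjAlt (r • a k) = (starRingEnd ℂ) r • conjAlt (a k)
    ext v; simp [conjAlt_apply]

theorem conjForm_add (u v : Form n X) : conjForm (u + v) = conjForm u + conjForm v :=
  form_ext_atPt fun x => conjFib_add (atPt u x) (atPt v x)

theorem conjForm_smul (r : ℂ) (u : Form n X) :
    conjForm (r • u) = (starRingEnd ℂ) r • conjForm u :=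
  form_ext_atPt fun x => conjFib_smul r (atPt u x)

theorem fibInner_conjFib (Q : Matrix (Fin n ⊕ Fin n) (Fin n ⊕ Fin n) ℝ) (a b : Fib n) :
    fibInner Q (conjFib a) (conjFib b) = (starRingEnd ℂ) (fibInner Q a b) := by
  rw [fibInner, fibInner, map_sum]
  exact Finset.sum_congr rfl fun k _ => cometricInner_conjAlt Q (a k) (b k)

theorem conjFib_wedgeL {p : ℕ} (α : Alt n p) (a : Fib n) :
    conjFib (wedgeL α a) = wedgeL (conjAlt α) (conjFib a) := by
  refine Fib.ext fun m => ?_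
  by_cases hp : p ≤ m
  · rw [wedgeL_apply (Nat.add_sub_of_le hp)]
    change conjAlt (wedgeL α a m) = wedge _ (conjAlt α) (conjAlt (a (m - p)))
    rw [wedgeL_apply (Nat.add_sub_of_le hp), wedge_conjAlt]
  · rw [wedgeL_of_lt (by omega)]
    change conjAlt (wedgeL α a m) = 0
    rw [wedgeL_of_lt (by omega)]
    ext v; simp [conjAlt_apply]

theorem conjFib_wedgeAdj {Q : Matrix (Fin n ⊕ Fin n) (Fin n ⊕ Fin n) ℝ} (hQ : Q.PosDef) {p : ℕ}
    (α : Alt n p) (a : Fib n) :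
    conjFib (wedgeAdj Q α a) = wedgeAdj Q (conjAlt α) (conjFib a) := by
  have hs := hQ.isSymm'
  refine fibInner_ext hQ fun b => ?_
  rw [(isAdjAt_wedgeL hs (conjAlt α)).symm hs, ← conjFib_conjFib b, ← conjFib_wedgeL,
    fibInner_conjFib, fibInner_conjFib, (isAdjAt_wedgeL hs α).symm hs]

end Forms

section MixedForms

set_option linter.unusedSectionVars false

variable {X : Type*} [TopologicalSpace X] [ChartedSpace (Cn n) X]

/-- The expression of a form of mixed degree in the chart at `c`. -/
def localRepF (c : X) (u : Form n X) (y : Cn n) : Fib n := fun k => localRep c (u k) y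

theorem localRepF_eq_pull (c : X) (u : Form n X) (y : Cn n) :
    localRepF c u y =
      pullFib ((chartSymmDeriv c y).restrictScalars ℝ) (atPt u ((cht n c).symm y)) := rfl

theorem isSmooth_iff {u : Form n X} :
    IsSmooth u ↔ ∀ c : X, FibSmoothOn (localRepF c u) (cht n c).target :=
  ⟨fun h c k => h k c, fun h k c => h c k⟩

theorem IsSmooth.fibDiffAt {u : Form n X} (hu : IsSmooth u) {c : X} {y : Cn n}
    (hy : y ∈ (cht n c).target) : FibDiffAt (localRepF c u) y :=
  FibSmoothOn.fibDiffAt (isSmooth_iff.1 hu c) (isOpen_cht_target c) hy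

theorem IsSmooth.add {u v : Form n X} (hu : IsSmooth u) (hv : IsSmooth v) : IsSmooth (u + v) :=
  fun k c => (hu k c).add (hv k c)

theorem IsSmooth.smul {u : Form n X} (r : ℂ) (hu : IsSmooth u) : IsSmooth (r • u) :=
  fun k c => by
    have : localRep c ((r • u) k) = fun y => r • localRep c (u k) y := rfl
    rw [this]
    exact (hu k c).const_smul r

theorem isSmooth_zero : IsSmooth (0 : Form n X) := fun k c => by
  have : localRep c ((0 : Form n X) k) = fun _ => (0 : Alt n k) := rfl
  rw [this]
  exact contDiffOn_const

variable [IsManifold 𝓘(ℂ, Cn n) ∞ X]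

/-- `∂` (for `ε = i`) and `∂̄` (for `ε = -i`) on forms of mixed degree. -/
def dE (ε : ℂ) : Op n X
  | _, 0 => 0
  | u, k + 1 => dH ε (u k)

theorem delOp_eq : (delOp : Op n X) = dE Complex.I := by
  funext u k
  cases k <;> rfl

theorem delbarOp_eq : (delbarOp : Op n X) = dE (-Complex.I) := by
  funext u k
  cases k with
  | zero => rfl
  | succ k => exact delbar_eq (u k)

theorem dOp_eq : (dOp : Op n X) = dE Complex.I + dE (-Complex.I) := by
  funext u k
  cases k with
  | zero => exact (add_zero (0 : HForm n 0 X)).symm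
  | succ k => exact extD_eq (u k)

theorem localRepF_self (u : Form n X) (x : X) : localRepF x u (cht n x x) = atPt u x :=
  Fib.ext fun k => localRep_self (u k) x

theorem form_ext {u v : Form n X}
    (h : ∀ c : X, ∀ y ∈ (cht n c).target, localRepF c u y = localRepF c v y) : u = v :=
  form_ext_atPt fun x => by
    rw [← localRepF_self, ← localRepF_self, h x _ (mem_extChartAt_target x)]

theorem localRepF_dE (ε : ℂ) {u : Form n X} (hu : IsSmooth u) {c : X} {y : Cn n}
    (hy : y ∈ (cht n c).target) : localRepF c (dE ε u) y = dFib ε (localRepF c u) y :=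
  Fib.ext fun k => by
    cases k with
    | zero => rfl
    | succ k => exact localRep_dH ε (hu k) hy

theorem IsSmooth.dE (ε : ℂ) {u : Form n X} (hu : IsSmooth u) : IsSmooth (dE ε u) := fun k => by
  cases k with
  | zero => exact isSmooth_zero (n := n) (X := X) 0
  | succ k => exact (hu k).dH ε

theorem dE_dE (ε ε' : ℂ) {u : Form n X} (hu : IsSmooth u) : dE ε (dE ε' u) = -dE ε' (dE ε u) :=
  funext fun k => by
    match k with
    | 0 => exact (neg_zero (G := HForm n 0 X)).symm
    | 1 =>
      have h : ∀ ε : ℂ, dH ε (0 : HForm n 0 X) = 0 := fun ε => by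
        refine hform_ext fun c y hy => ?_
        rw [localRep_dH (α := (0 : HForm n 0 X)) ε (isSmooth_zero (n := n) (X := X) 0) hy, dFlat_eq_sum]
        have e : localRep c (0 : HForm n 0 X) = fun _ => 0 := rfl
        have e' : localRep c (0 : HForm n 1 X) y = 0 := rfl
        rw [e, e', Finset.sum_eq_zero]
        intro s _
        rw [fderiv_fun_const]
        ext v
        simp [extMul_apply]
      exact (h ε).trans (by rw [← neg_zero, ← h ε']; rfl)
    | k + 2 => exact dH_dH ε ε' (hu k)

theorem localRepF_wedgeOp {p : ℕ} (α : HForm n p X) (u : Form n X) (c : X) (y : Cn n) :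
    localRepF c (wedgeOp α u) y = wedgeL (localRep c α y) (localRepF c u y) :=
  pullFib_wedgeL _ (α ((cht n c).symm y)) (atPt u ((cht n c).symm y))

theorem IsSmooth.wedgeOp {p : ℕ} {α : HForm n p X} (hα : IsSmoothH α) {u : Form n X}
    (hu : IsSmooth u) : IsSmooth (wedgeOp α u) :=
  isSmooth_iff.2 fun c => by
    rw [funext fun y => localRepF_wedgeOp α u c y]
    exact smoothFam_wedgeL (hα c) _ (isSmooth_iff.1 hu c)

/-- The Leibniz rule. -/
theorem dE_wedgeOp (ε : ℂ) {p : ℕ} {α : HForm n p X} (hα : IsSmoothH α) {u : Form n X}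
    (hu : IsSmooth u) :
    dE ε (wedgeOp α u) = wedgeOp (dH ε α) u + (-1 : ℂ) ^ p • wedgeOp α (dE ε u) :=
  form_ext fun c y hy => by
    have e : localRepF c (wedgeOp (dH ε α) u + (-1 : ℂ) ^ p • wedgeOp α (dE ε u)) y =
        localRepF c (wedgeOp (dH ε α) u) y +
          (-1 : ℂ) ^ p • localRepF c (wedgeOp α (dE ε u)) y := rfl
    rw [e, localRepF_dE ε (hu.wedgeOp hα) hy, funext fun y => localRepF_wedgeOp α u c y,
      dFib_wedgeL ε (hα.differentiableAt hy) (hu.fibDiffAt hy), localRepF_wedgeOp,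
      localRepF_wedgeOp, localRep_dH ε hα hy, localRepF_dE ε hu hy]

theorem localRep_conjH {k : ℕ} (α : HForm n k X) (c : X) :
    localRep c (conjH α) = fun y => conjAlt (localRep c α y) := rfl

theorem contDiff_conjAlt {k : ℕ} {r : WithTop ℕ∞} : ContDiff ℝ r (conjAlt : Alt n k → Alt n k) := by
  let C : Alt n k →L[ℝ] Alt n k := LinearMap.toContinuousLinearMap
    { toFun := conjAlt
      map_add' := fun a b => by ext v; simp [conjAlt]
      map_smul' := fun r a => by ext v; simp [conjAlt] }
  exact C.contDiff

theorem IsSmoothH.conjH {k : ℕ} {α : HForm n k X} (hα : IsSmoothH α) : IsSmoothH (conjH α) :=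
  fun c => contDiff_conjAlt.comp_contDiffOn (hα c)

theorem IsSmooth.conjForm {u : Form n X} (hu : IsSmooth u) : IsSmooth (conjForm u) :=
  fun k => (hu k).conjH

theorem dH_conjH (ε : ℂ) {k : ℕ} {α : HForm n k X} (hα : IsSmoothH α) :
    dH ε (conjH α) = conjH (dH ((starRingEnd ℂ) ε) α) :=
  funext fun x => by
    change dFlat ε (localRep x (conjH α)) _ = conjAlt (dFlat _ (localRep x α) _)
    rw [localRep_conjH, dFlat_conjAlt ε (hα.differentiableAt (mem_extChartAt_target x))]

theorem dE_conjForm (ε : ℂ) {u : Form n X} (hu : IsSmooth u) :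
    dE ε (conjForm u) = conjForm (dE ((starRingEnd ℂ) ε) u) :=
  funext fun k => by
    cases k with
    | zero =>
      funext x
      ext v
      exact (map_zero (starRingEnd ℂ)).symm
    | succ k => exact dH_conjH ε (hu k)

theorem wedgeOp_conjForm {p : ℕ} (α : HForm n p X) (u : Form n X) :
    wedgeOp (conjH α) (conjForm u) = conjForm (wedgeOp α u) :=
  form_ext_atPt fun x => (conjFib_wedgeL (α x) (atPt u x)).symm

/-! ### Hermitian metrics -/

section Metric

variable {ω₀ : HForm n 2 X}

theorem IsHermitianMetric.isHermitianAt (hω : IsHermitianMetric ω₀) (x : X) :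
    IsHermitianAt (ω₀ x) :=
  { real := hω.real x
    type := hω.type_one_one x
    pos := hω.pos x }

theorem IsHermitianMetric.localRep (hω : IsHermitianMetric ω₀) {c : X} {y : Cn n}
    (hy : y ∈ (cht n c).target) : IsHermitianAt (localRep c ω₀ y) :=
  (hω.isHermitianAt _).comp (chartSymmDeriv_bijective hy).injective

theorem IsHermitianMetric.conjAlt (hω : IsHermitianMetric ω₀) : conjH ω₀ = ω₀ := by
  funext x
  ext v
  have e : v = ![v 0, v 1] := by
    funext i; fin_cases i <;> rfl
  rw [e]
  exact Complex.conj_eq_iff_im.2 (hω.real x _ _)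

theorem IsHermitianMetric.localRepF_adjOp (hω : IsHermitianMetric ω₀) {p : ℕ} (α : HForm n p X)
    (u : Form n X) {c : X} {y : Cn n} (hy : y ∈ (cht n c).target) :
    localRepF c (adjOp ω₀ α u) y = wedgeAdj (cometric (HermitianForms.localRep c ω₀ y))
      (HermitianForms.localRep c α y) (localRepF c u y) :=
  (hω.isHermitianAt _).pullFib_wedgeAdj (chartSymmDeriv_bijective hy) _ _

theorem IsHermitianMetric.contDiffOn_cometric (hω : IsHermitianMetric ω₀) (c : X)
    (s t : Fin n ⊕ Fin n) : ContDiffOn ℝ ∞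
      (fun y => cometric (HermitianForms.localRep c ω₀ y) s t) (cht n c).target :=
  HermitianForms.contDiffOn_cometric (hω.smooth c) (fun _ hy => hω.localRep hy) s t

theorem IsHermitianMetric.isSmooth_adjOp (hω : IsHermitianMetric ω₀) {p : ℕ} {α : HForm n p X}
    (hα : IsSmoothH α) {u : Form n X} (hu : IsSmooth u) : IsSmooth (adjOp ω₀ α u) :=
  isSmooth_iff.2 fun c k =>
    (smoothFam_wedgeAdj (hω.contDiffOn_cometric c) (hα c) _ (isSmooth_iff.1 hu c) k).congr
      fun y hy => by
        exact congrFun (hω.localRepF_adjOp α u hy) k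

theorem IsHermitianMetric.adjOp_conjForm (hω : IsHermitianMetric ω₀) {p : ℕ} (α : HForm n p X)
    (u : Form n X) : adjOp ω₀ (conjH α) (conjForm u) = conjForm (adjOp ω₀ α u) :=
  form_ext_atPt fun x =>
    (conjFib_wedgeAdj (hω.isHermitianAt x).cometric_posDef (α x) (atPt u x)).symm

/-- The pointwise inner product of two forms of mixed degree. -/
def ptInner (ω₀ : HForm n 2 X) (u v : Form n X) (x : X) : ℂ :=
  fibInner (cometric (ω₀ x)) (atPt u x) (atPt v x)

theorem IsHermitianMetric.ptInner_symm (hω : IsHermitianMetric ω₀) (u v : Form n X) {c : X}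
    {y : Cn n} (hy : y ∈ (cht n c).target) : ptInner ω₀ u v ((cht n c).symm y) =
      fibInner (cometric (HermitianForms.localRep c ω₀ y)) (localRepF c u y) (localRepF c v y) :=
  ((hω.isHermitianAt _).fibInner_pull (chartSymmDeriv_bijective hy).injective _ _).symm

theorem IsHermitianMetric.ptInner_wedgeOp (hω : IsHermitianMetric ω₀) {p : ℕ} (α : HForm n p X)
    (u v : Form n X) : ptInner ω₀ (wedgeOp α u) v = ptInner ω₀ u (adjOp ω₀ α v) :=
  funext fun x => isAdjAt_wedgeL (hω.isHermitianAt x).cometric_isSymm (α x) (atPt u x) (atPt v x)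

theorem IsHermitianMetric.isTypeTwoOne (hω : IsHermitianMetric ω₀) (x : X) :
    IsTypeTwoOne (dH Complex.I ω₀ x) := by
  intro u v w
  have hx := mem_extChartAt_target (I := 𝓘(ℂ, Cn n)) x
  have hη := isRealOneOne_fderiv (hω.smooth.differentiableAt hx)
    (Filter.eventually_of_mem ((isOpen_cht_target x).mem_nhds hx)
      fun y hy => (hω.localRep hy).toIsRealOneOne)
  set T := fderiv ℝ (HermitianForms.localRep x ω₀) (cht n x x) with hT
  have key : ∀ a b c : Cn n, ((1 / 2 : ℂ) • (T - Complex.I • T.comp (mulI n))) (Complex.I • a)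
      ![Complex.I • b, Complex.I • c] =
      Complex.I * ((1 / 2 : ℂ) • (T - Complex.I • T.comp (mulI n))) a ![b, c] := by
    intro a b c
    have e1 : ∀ a m, ((1 / 2 : ℂ) • (T - Complex.I • T.comp (mulI n))) a m =
        (1 / 2 : ℂ) * (T a m - Complex.I * T (Complex.I • a) m) := fun a m => rfl
    have e2 : T (Complex.I • Complex.I • a) = -T a := by
      rw [smul_smul, Complex.I_mul_I, neg_one_smul, map_neg]
    rw [e1, e1, e2, (hη (Complex.I • a)).type, ContinuousAlternatingMap.neg_apply, (hη a).type]
    linear_combination (T (Complex.I • a) ![b, c] / 2) * Complex.I_mul_I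
  have hr : ∀ a b c : Cn n, ∀ S : Cn n →L[ℝ] Alt n 2,
      ContinuousAlternatingMap.alternatizeUncurryFin S ![a, b, c] =
        S a ![b, c] - S b ![a, c] + S c ![a, b] := by
    intro a b c S
    rw [ContinuousAlternatingMap.alternatizeUncurryFin_apply, Fin.sum_univ_three]
    have r0 : (0 : Fin 3).removeNth ![a, b, c] = ![b, c] := by
      funext i; fin_cases i <;> rfl
    have r1 : (1 : Fin 3).removeNth ![a, b, c] = ![a, c] := by
      funext i; fin_cases i <;> rfl
    have r2 : (2 : Fin 3).removeNth ![a, b, c] = ![a, b] := by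
      funext i; fin_cases i <;> rfl
    rw [r0, r1, r2]
    simp
    ring
  change ContinuousAlternatingMap.alternatizeUncurryFin _ _ =
    Complex.I * ContinuousAlternatingMap.alternatizeUncurryFin _ _
  rw [hr, hr, key, key, key]
  ring

theorem IsHermitianMetric.dH_neg_I (hω : IsHermitianMetric ω₀) :
    dH (-Complex.I) ω₀ = conjH (dH Complex.I ω₀) := by
  have := dH_conjH (-Complex.I) hω.smooth
  rwa [hω.conjAlt, map_neg, Complex.conj_I, neg_neg] at this

theorem IsSKT.dH_dH (hω : IsSKT ω₀) :
    dH (-Complex.I) (dH Complex.I ω₀) = 0 ∧ dH Complex.I (dH (-Complex.I) ω₀) = 0 := by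
  have h : dH Complex.I (dH (-Complex.I) ω₀) = 0 := by
    rw [← delbar_eq]
    exact hω.2
  exact ⟨by rw [HermitianForms.dH_dH _ _ hω.1.smooth, h, neg_zero], h⟩

end Metric

end MixedForms

end
end HermitianForms

namespace HermitianForms
noncomputable section

variable {n : ℕ}

/-! ### The Riemannian volume measure -/

section Volume

open MeasureTheory

set_option linter.unusedSectionVars false

theorem measurableSet_preimage_inter {α β : Type*} [TopologicalSpace α] [MeasurableSpace α]
    [BorelSpace α] [TopologicalSpace β] [MeasurableSpace β] [BorelSpace β] {f : α → β} {s : Set α}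
    (hf : ContinuousOn f s) (hs : MeasurableSet s) {E : Set β} (hE : MeasurableSet E) :
    MeasurableSet (f ⁻¹' E ∩ s) := by
  have h : Continuous fun x : s => f x := hf.comp_continuous continuous_subtype_val Subtype.prop
  have h2 := MeasurableSet.subtype_image hs (h.measurable hE)
  convert h2 using 1
  ext x
  simp [and_comm]

variable {X : Type*} [TopologicalSpace X] [T2Space X] [CompactSpace X] [MeasurableSpace X]
  [BorelSpace X] [ChartedSpace (Cn n) X] [IsManifold 𝓘(ℂ, Cn n) ∞ X] {ω₀ : HForm n 2 X}

/-- The part of a set that lies in the domain of the chart at `c`, in that chart. -/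
def inChart (c : X) (E : Set X) : Set (Cn n) := (cht n c).symm ⁻¹' E ∩ (cht n c).target

theorem measurableSet_inChart (c : X) {E : Set X} (hE : MeasurableSet E) :
    MeasurableSet (inChart (n := n) c E) :=
  measurableSet_preimage_inter (continuousOn_extChartAt_symm c)
    (isOpen_cht_target c).measurableSet hE

theorem IsHermitianMetric.contDiffOn_volDensity (hω : IsHermitianMetric ω₀) (c : X) :
    ContDiffOn ℝ ∞ (fun y => volDensity (HermitianForms.localRep c ω₀ y)) (cht n c).target :=
  HermitianForms.contDiffOn_volDensity (hω.smooth c) fun _ hy => hω.localRep hy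

theorem IsHermitianMetric.volDensity_pos (hω : IsHermitianMetric ω₀) {c : X} {y : Cn n}
    (hy : y ∈ (cht n c).target) : 0 < volDensity (HermitianForms.localRep c ω₀ y) :=
  Real.sqrt_pos.2 (hω.localRep hy).gramMatrix_posDef.det_pos

theorem IsHermitianMetric.aemeasurable_volDensity (hω : IsHermitianMetric ω₀) (c : X) :
    AEMeasurable (fun y => ENNReal.ofReal (volDensity (HermitianForms.localRep c ω₀ y)))
      (volume.restrict (cht n c).target) :=
  ((hω.contDiffOn_volDensity c).continuousOn.aemeasurable
    (isOpen_cht_target c).measurableSet).ennreal_ofReal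

theorem aemeasurable_cht_symm (ω₀ : HForm n 2 X) (c : X) : AEMeasurable (cht n c).symm
    ((volume.restrict (cht n c).target).withDensity
      (fun y => ENNReal.ofReal (volDensity (HermitianForms.localRep c ω₀ y)))) :=
  ((continuousOn_extChartAt_symm c).aemeasurable (isOpen_cht_target c).measurableSet).mono_ac
    (withDensity_absolutelyContinuous _ _)

theorem chartVolume_eq (ω₀ : HForm n 2 X) (c : X) : chartVolume ω₀ c =
    ((volume.restrict (cht n c).target).withDensity
      (fun y => ENNReal.ofReal (volDensity (HermitianForms.localRep c ω₀ y)))).map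
        (cht n c).symm := rfl

theorem chartVolume_apply (ω₀ : HForm n 2 X) (c : X) {E : Set X} (hE : MeasurableSet E) :
    chartVolume ω₀ c E =
      ∫⁻ y in inChart c E, ENNReal.ofReal (volDensity (localRep c ω₀ y)) := by
  rw [chartVolume_eq, Measure.map_apply_of_aemeasurable (aemeasurable_cht_symm ω₀ c) hE,
    withDensity_apply', Measure.restrict_restrict' (isOpen_cht_target c).measurableSet]
  rfl

/-- The volume measures of two charts agree on the overlap. -/
theorem chartVolume_inter (ω₀ : HForm n 2 X) (c c' : X) {E : Set X} (hE : MeasurableSet E) :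
    chartVolume ω₀ c' (E ∩ (cht n c).source) = chartVolume ω₀ c (E ∩ (cht n c').source) := by
  have hS : ∀ c : X, MeasurableSet (cht n c).source := fun c => (isOpen_cht_source c).measurableSet
  rw [chartVolume_apply _ _ (hE.inter (hS c)), chartVolume_apply _ _ (hE.inter (hS c'))]
  have hB : ∀ y ∈ inChart c (E ∩ (cht n c').source), y ∈ chgDom n c c' := fun y hy =>
    mem_chgDom.2 ⟨hy.2, hy.1.2⟩
  have himg : inChart (n := n) c' (E ∩ (cht n c).source) =
      chg c c' '' inChart c (E ∩ (cht n c').source) := by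
    ext z
    constructor
    · rintro ⟨⟨h1, h2⟩, h3⟩
      refine ⟨chg c' c z, ⟨⟨?_, ?_⟩, ?_⟩, ?_⟩
      · rw [symm_chg (mem_chgDom.2 ⟨h3, h2⟩)]; exact h1
      · rw [symm_chg (mem_chgDom.2 ⟨h3, h2⟩)]; exact (cht n c').map_target h3
      · exact chg_mem_target (mem_chgDom.2 ⟨h3, h2⟩)
      · exact chg_chg (mem_chgDom.2 ⟨h3, h2⟩)
    · rintro ⟨y, hy, rfl⟩
      refine ⟨⟨?_, ?_⟩, chg_mem_target (hB y hy)⟩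
      · rw [symm_chg (hB y hy)]; exact hy.1.1
      · rw [symm_chg (hB y hy)]; exact (cht n c).map_target hy.2
  rw [himg, lintegral_image_eq_lintegral_abs_det_fderiv_mul volume
    (measurableSet_inChart c (hE.inter (hS c')))
    (f' := fun y => fderiv ℝ (chg c c') y)
    (fun y hy => (((differentiableAt_chg (hB y hy)).restrictScalars
      ℝ).hasFDerivAt).hasFDerivWithinAt)
    (fun y hy y' hy' h => by rw [← chg_chg (hB y hy), h, chg_chg (hB y' hy')])]
  refine setLIntegral_congr_fun (measurableSet_inChart c (hE.inter (hS c'))) fun y hy => ?_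
  rw [localRep_eq ω₀ (hB y hy), fderiv_real_chg (hB y hy), volDensity_comp,
    ENNReal.ofReal_mul (abs_nonneg _)]

/-- In the domain of a chart, the Riemannian volume is the volume of that chart. -/
theorem volumeMeasure_apply (ω₀ : HForm n 2 X) (c : X) {E : Set X} (hE : MeasurableSet E)
    (hc : E ⊆ (cht n c).source) : volumeMeasure ω₀ E = chartVolume ω₀ c E := by
  have hS : MeasurableSet (cht n c).source := (isOpen_cht_source c).measurableSet
  refine le_antisymm ?_ ((le_iSup (chartVolume ω₀) c) E)
  have hle : volumeMeasure ω₀ ≤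
      chartVolume ω₀ c + (volumeMeasure ω₀).restrict (cht n c).sourceᶜ := by
    refine iSup_le fun c' => Measure.le_iff.2 fun A hA => ?_
    rw [Measure.add_apply, Measure.restrict_apply hA, ← measure_inter_add_sdiff A hS]
    refine add_le_add ?_ ?_
    · rw [chartVolume_inter ω₀ c c' hA]
      exact measure_mono Set.inter_subset_left
    · exact (le_iSup (chartVolume ω₀) c') _
  refine (hle E).trans ?_
  rw [Measure.add_apply, Measure.restrict_apply hE, Set.disjoint_iff_inter_eq_empty.1 (Set.disjoint_compl_right_iff_subset.2 hc),
    measure_empty, add_zero]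

theorem volumeMeasure_restrict (ω₀ : HForm n 2 X) (c : X) :
    (volumeMeasure ω₀).restrict (cht n c).source = chartVolume ω₀ c := by
  have hS : MeasurableSet (cht n c).source := (isOpen_cht_source c).measurableSet
  refine Measure.ext fun E hE => ?_
  rw [Measure.restrict_apply hE, volumeMeasure_apply ω₀ c (hE.inter hS) Set.inter_subset_right,
    chartVolume_apply _ _ (hE.inter hS), chartVolume_apply _ _ hE]
  congr 2
  ext y
  exact ⟨fun h => ⟨h.1.1, h.2⟩, fun h => ⟨⟨h.1, (cht n c).map_target h.2⟩, h.2⟩⟩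

theorem IsHermitianMetric.isLocallyFiniteMeasure (hω : IsHermitianMetric ω₀) :
    IsLocallyFiniteMeasure (volumeMeasure ω₀) := by
  refine ⟨fun x => ?_⟩
  have hx := mem_extChartAt_target (I := 𝓘(ℂ, Cn n)) x
  obtain ⟨K, hK, hKx, hKT⟩ := exists_compact_subset (isOpen_cht_target x) hx
  have hU : IsOpen ((cht n x).source ∩ cht n x ⁻¹' interior K) :=
    (continuousOn_extChartAt x).isOpen_inter_preimage (isOpen_cht_source x) isOpen_interior
  refine ⟨_, hU.mem_nhds ⟨mem_extChartAt_source x, hKx⟩, ?_⟩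
  rw [volumeMeasure_apply ω₀ x hU.measurableSet Set.inter_subset_left,
    chartVolume_apply _ _ hU.measurableSet]
  have hsub : inChart x ((cht n x).source ∩ cht n x ⁻¹' interior K) ⊆ K := by
    rintro y ⟨⟨-, h2⟩, h3⟩
    rw [Set.mem_preimage, (cht n x).right_inv h3] at h2
    exact interior_subset h2
  refine (lintegral_mono_set hsub).trans_lt ?_
  obtain ⟨C, hC⟩ := hK.exists_bound_of_continuousOn
    ((hω.contDiffOn_volDensity x).continuousOn.mono hKT)
  refine (setLIntegral_mono' hK.measurableSet (g := fun _ => ENNReal.ofReal C)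
    fun y hy => ENNReal.ofReal_le_ofReal ((le_abs_self _).trans (hC y hy))).trans_lt ?_
  rw [setLIntegral_const]
  exact ENNReal.mul_lt_top ENNReal.ofReal_lt_top hK.measure_lt_top

theorem IsHermitianMetric.isFiniteMeasure (hω : IsHermitianMetric ω₀) :
    IsFiniteMeasure (volumeMeasure ω₀) := by
  have := hω.isLocallyFiniteMeasure
  exact CompactSpace.isFiniteMeasure

theorem IsHermitianMetric.isOpenPosMeasure (hω : IsHermitianMetric ω₀) :
    (volumeMeasure ω₀).IsOpenPosMeasure := by
  refine ⟨fun U hU ⟨x, hx⟩ h0 => ?_⟩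
  have hUS := hU.inter (isOpen_cht_source (n := n) x)
  have h1 : volumeMeasure ω₀ (U ∩ (cht n x).source) = 0 := measure_mono_null Set.inter_subset_left h0
  rw [volumeMeasure_apply ω₀ x hUS.measurableSet Set.inter_subset_right,
    chartVolume_apply _ _ hUS.measurableSet] at h1
  set B := inChart (n := n) x (U ∩ (cht n x).source) with hB
  have hBo : IsOpen B := by
    rw [hB, inChart, Set.inter_comm]
    exact (continuousOn_extChartAt_symm x).isOpen_inter_preimage (isOpen_cht_target x) hUS
  have hBT : B ⊆ (cht n x).target := Set.inter_subset_right
  rw [lintegral_eq_zero_iff' ((hω.aemeasurable_volDensity x).mono_measure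
    (Measure.restrict_mono hBT le_rfl))] at h1
  have h2 : ∀ᵐ y ∂(volume.restrict B), False := by
    filter_upwards [h1, ae_restrict_mem hBo.measurableSet] with y hy hyB
    exact (ENNReal.ofReal_pos.2 (hω.volDensity_pos (hBT hyB))).ne' hy
  rw [Filter.eventually_false_iff_eq_bot, ae_eq_bot, Measure.restrict_eq_zero] at h2
  have hne : B.Nonempty := ⟨cht n x x, by
    refine ⟨?_, mem_extChartAt_target x⟩
    rw [Set.mem_preimage, extChartAt_to_inv]
    exact ⟨hx, mem_extChartAt_source x⟩⟩
  exact (hBo.measure_pos volume hne).ne' h2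

/-- The integral of a function supported in the domain of a chart. -/
theorem IsHermitianMetric.integral_eq_chart (hω : IsHermitianMetric ω₀) (c : X) {f : X → ℂ}
    (hf : Continuous f) (hc : ∀ x, x ∉ (cht n c).source → f x = 0) :
    ∫ x, f x ∂(volumeMeasure ω₀) = ∫ y in (cht n c).target,
      (volDensity (HermitianForms.localRep c ω₀ y) : ℂ) * f ((cht n c).symm y) := by
  rw [← setIntegral_eq_integral_of_forall_compl_eq_zero hc, volumeMeasure_restrict,
    chartVolume_eq, integral_map (aemeasurable_cht_symm ω₀ c) hf.aestronglyMeasurable,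
    integral_withDensity_eq_integral_toReal_smul₀ (hω.aemeasurable_volDensity c)
      (Filter.Eventually.of_forall fun _ => ENNReal.ofReal_lt_top)]
  refine setIntegral_congr_fun (isOpen_cht_target c).measurableSet fun y hy => ?_
  rw [ENNReal.toReal_ofReal (hω.volDensity_pos hy).le, Complex.real_smul]

/-! ### The `L²` inner product -/

/-- A function on `X` is continuous if it is so in every chart. -/
theorem continuous_of_charts {F : Type*} [TopologicalSpace F] {f : X → F}
    (h : ∀ c : X, ContinuousOn (fun y => f ((cht n c).symm y)) (cht n c).target) :
    Continuous f := by
  refine continuous_iff_continuousAt.2 fun x => ?_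
  have h1 : ContinuousAt (fun y => f ((cht n x).symm y)) (cht n x x) :=
    (h x).continuousAt ((isOpen_cht_target x).mem_nhds (mem_extChartAt_target x))
  have h2 : ContinuousAt (fun z => f ((cht n x).symm (cht n x z))) x :=
    ContinuousAt.comp (f := cht n x) h1 (continuousAt_extChartAt x)
  refine h2.congr ?_
  filter_upwards [(isOpen_cht_source (n := n) x).mem_nhds (mem_extChartAt_source x)] with z hz
  rw [(cht n x).left_inv hz]

theorem IsHermitianMetric.continuous_fibreInner (hω : IsHermitianMetric ω₀) {k : ℕ}
    {α β : HForm n k X} (hα : IsSmoothH α) (hβ : IsSmoothH β) :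
    Continuous fun x => fibreInner (ω₀ x) (α x) (β x) := by
  refine continuous_of_charts (n := n) fun c => ?_
  refine ContinuousOn.congr (contDiffOn_cometricInner (hω.contDiffOn_cometric c) (hα c)
    (hβ c)).continuousOn fun y hy => ?_
  rw [fibreInner_eq]
  exact ((hω.isHermitianAt _).cometricInner_pull (chartSymmDeriv_bijective hy).injective _ _).symm

theorem ptInner_eq_sum (ω₀ : HForm n 2 X) (u v : Form n X) (x : X) :
    ptInner ω₀ u v x = ∑ k ∈ Finset.range (2 * n + 1), fibreInner (ω₀ x) (u k x) (v k x) := by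
  simp only [fibreInner_eq]
  rfl

theorem IsHermitianMetric.continuous_ptInner (hω : IsHermitianMetric ω₀) {u v : Form n X}
    (hu : IsSmooth u) (hv : IsSmooth v) : Continuous (ptInner ω₀ u v) := by
  rw [funext (ptInner_eq_sum ω₀ u v)]
  exact continuous_finsetSum _ fun k _ => hω.continuous_fibreInner (hu k) (hv k)

theorem IsHermitianMetric.integrable (hω : IsHermitianMetric ω₀) {f : X → ℂ}
    (hf : Continuous f) : Integrable f (volumeMeasure ω₀) := by
  have := hω.isFiniteMeasure
  exact hf.integrable_of_hasCompactSupport (HasCompactSupport.of_compactSpace f)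

theorem IsHermitianMetric.L2_eq (hω : IsHermitianMetric ω₀) {u v : Form n X}
    (hu : IsSmooth u) (hv : IsSmooth v) :
    L2 ω₀ u v = ∫ x, ptInner ω₀ u v x ∂(volumeMeasure ω₀) := by
  simp only [ptInner_eq_sum]
  rw [integral_finsetSum _ fun k _ => hω.integrable (hω.continuous_fibreInner (hu k) (hv k))]
  rfl

theorem IsHermitianMetric.L2_add_left (hω : IsHermitianMetric ω₀) {u u' v : Form n X}
    (hu : IsSmooth u) (hu' : IsSmooth u') (hv : IsSmooth v) :
    L2 ω₀ (u + u') v = L2 ω₀ u v + L2 ω₀ u' v := by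
  rw [hω.L2_eq (hu.add hu') hv, hω.L2_eq hu hv, hω.L2_eq hu' hv, ← integral_add
    (hω.integrable (hω.continuous_ptInner hu hv)) (hω.integrable (hω.continuous_ptInner hu' hv))]
  exact integral_congr_ae (.of_forall fun x => fibInner_add_left _ _ _)

theorem IsHermitianMetric.L2_smul_left (hω : IsHermitianMetric ω₀) (r : ℂ) {u v : Form n X}
    (hu : IsSmooth u) (hv : IsSmooth v) : L2 ω₀ (r • u) v = r * L2 ω₀ u v := by
  rw [hω.L2_eq (hu.smul r) hv, hω.L2_eq hu hv, ← integral_const_mul]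
  exact integral_congr_ae (.of_forall fun x => fibInner_smul_left _ _ _)

theorem IsHermitianMetric.L2_conj_symm (hω : IsHermitianMetric ω₀) {u v : Form n X}
    (hu : IsSmooth u) (hv : IsSmooth v) : (starRingEnd ℂ) (L2 ω₀ u v) = L2 ω₀ v u := by
  rw [hω.L2_eq hu hv, hω.L2_eq hv hu, ← integral_conj]
  exact integral_congr_ae (.of_forall fun x =>
    fibInner_conj_symm (hω.isHermitianAt x).cometric_isSymm _ _)

theorem IsHermitianMetric.L2_conjForm (hω : IsHermitianMetric ω₀) {u v : Form n X}
    (hu : IsSmooth u) (hv : IsSmooth v) :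
    L2 ω₀ (conjForm u) (conjForm v) = (starRingEnd ℂ) (L2 ω₀ u v) := by
  rw [hω.L2_eq hu hv, hω.L2_eq hu.conjForm hv.conjForm, ← integral_conj]
  exact integral_congr_ae (.of_forall fun x => fibInner_conjFib _ _ _)

theorem IsHermitianMetric.L2_self (hω : IsHermitianMetric ω₀) {u : Form n X} (hu : IsSmooth u) :
    L2 ω₀ u u = ((∫ x, (ptInner ω₀ u u x).re ∂(volumeMeasure ω₀) : ℝ) : ℂ) := by
  rw [hω.L2_eq hu hu, ← integral_complex_ofReal]
  refine integral_congr_ae (.of_forall fun x => ?_)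
  have := fibInner_self_nonneg (hω.isHermitianAt x).cometric_posDef (atPt u x)
  exact Complex.ext rfl (Complex.le_def.1 this).2.symm

theorem IsHermitianMetric.L2_self_nonneg (hω : IsHermitianMetric ω₀) {u : Form n X}
    (hu : IsSmooth u) : 0 ≤ L2 ω₀ u u := by
  rw [hω.L2_self hu]
  exact Complex.zero_le_real.2 (integral_nonneg fun x => (Complex.le_def.1
    (fibInner_self_nonneg (hω.isHermitianAt x).cometric_posDef (atPt u x))).1)

theorem IsHermitianMetric.eq_zero_of_L2_self (hω : IsHermitianMetric ω₀) {u : Form n X}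
    (hu : IsSmooth u) (h : L2 ω₀ u u = 0) : u = 0 := by
  have := hω.isOpenPosMeasure
  have hc : Continuous fun x => (ptInner ω₀ u u x).re :=
    Complex.continuous_re.comp (hω.continuous_ptInner hu hu)
  have hn : ∀ x, 0 ≤ ptInner ω₀ u u x := fun x =>
    fibInner_self_nonneg (hω.isHermitianAt x).cometric_posDef (atPt u x)
  rw [hω.L2_self hu, Complex.ofReal_eq_zero, integral_eq_zero_iff_of_nonneg
    (fun x => (Complex.le_def.1 (hn x)).1) (hω.integrable (hω.continuous_ptInner hu hu)).re] at h
  have h2 := (hc.ae_eq_iff_eq (volumeMeasure ω₀) continuous_const).1 h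
  refine form_ext_atPt fun x => ?_
  refine fibInner_self_eq_zero (hω.isHermitianAt x).cometric_posDef (Complex.ext ?_ ?_)
  · exact congrFun h2 x
  · exact (Complex.le_def.1 (hn x)).2.symm

end Volume

end
end HermitianForms

namespace HermitianForms
noncomputable section

variable {n : ℕ}

/-! ### The formal adjoint of `∂ + τ` -/

section Divergence

open MeasureTheory

/-- The integral over an open set of a directional derivative vanishes for functions with compact
support. -/
theorem setIntegral_lineDeriv_eq_zero {O K : Set (Cn n)} (hO : IsOpen O) {g g' : Cn n → ℂ}
    {v : Cn n} (hg : ContDiffOn ℝ ∞ g O) (hg' : ∀ y ∈ O, HasLineDerivAt ℝ g (g' y) y v)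
    (hK : IsCompact K) (hKO : K ⊆ O) (hz : ∀ y ∈ O, y ∉ K → g y = 0) :
    IntegrableOn g' O ∧ ∫ y in O, g' y = 0 := by
  set F : Cn n → ℂ := O.indicator g with hF
  have hFK : ∀ y, y ∉ K → F y = 0 := fun y hy => by
    by_cases h : y ∈ O
    · rw [hF, Set.indicator_of_mem h, hz y h hy]
    · exact Set.indicator_of_notMem h _
  have e1 : ∀ y ∈ O, F =ᶠ[nhds y] g := fun y hy => by
    filter_upwards [hO.mem_nhds hy] with z hz using Set.indicator_of_mem hz g
  have e2 : ∀ y, y ∉ K → F =ᶠ[nhds y] fun _ => 0 := fun y hy => by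
    filter_upwards [hK.isClosed.isOpen_compl.mem_nhds hy] with z hz using hFK z hz
  have hFc : ContDiff ℝ ∞ F := contDiff_iff_contDiffAt.2 fun y => by
    by_cases hy : y ∈ K
    · exact ((hg.contDiffAt (hO.mem_nhds (hKO hy)))).congr_of_eventuallyEq (e1 y (hKO hy))
    · exact contDiffAt_const.congr_of_eventuallyEq (e2 y hy)
  have hFs : HasCompactSupport F := HasCompactSupport.intro hK hFK
  have hFd : Continuous fun y => fderiv ℝ F y v :=
    (hFc.continuous_fderiv (by simp)).clm_apply continuous_const
  have hFds : HasCompactSupport fun y => fderiv ℝ F y v := hFs.fderiv_apply ℝ v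
  have hi : Integrable fun y => fderiv ℝ F y v := hFd.integrable_of_hasCompactSupport hFds
  have e3 : ∀ y ∈ O, g' y = fderiv ℝ F y v := fun y hy => by
    have h1 := (((hFc.differentiable (by simp)) y).hasFDerivAt.hasLineDerivAt v)
    exact (hg' y hy).unique (h1.congr_of_eventuallyEq (e1 y hy).symm)
  have h0 : ∫ y, fderiv ℝ F y v = 0 := by
    have := integral_mul_fderiv_eq_neg_fderiv_mul_of_integrable (μ := volume) (f := fun _ => (1 : ℂ))
      (g := F) (v := v) (by simp) (by simpa using hi)
      (by simpa using hFc.continuous.integrable_of_hasCompactSupport hFs)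
      (fun _ _ => differentiableAt_const _) (fun y _ => hFc.differentiable (by simp) y)
    simpa using this
  refine ⟨(integrableOn_congr_fun e3 hO.measurableSet).2 hi.integrableOn, ?_⟩
  rw [setIntegral_congr_fun hO.measurableSet e3,
    setIntegral_eq_integral_of_forall_compl_eq_zero, h0]
  intro y hy
  have : y ∉ K := fun h => hy (hKO h)
  rw [(e2 y this).fderiv_eq]
  simp

end Divergence

section GlobalAdjoint

open MeasureTheory

set_option linter.unusedSectionVars false

variable {X : Type*} [TopologicalSpace X] [ChartedSpace (Cn n) X] [IsManifold 𝓘(ℂ, Cn n) ∞ X]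

theorem dE_add (ε : ℂ) {u v : Form n X} (hu : IsSmooth u) (hv : IsSmooth v) :
    dE ε (u + v) = dE ε u + dE ε v :=
  form_ext fun c y hy => by
    have e1 : localRepF c (u + v) = fun y => localRepF c u y + localRepF c v y := rfl
    have e2 : localRepF c (dE ε u + dE ε v) y =
        localRepF c (dE ε u) y + localRepF c (dE ε v) y := rfl
    rw [e2, localRepF_dE ε (hu.add hv) hy, localRepF_dE ε hu hy, localRepF_dE ε hv hy, e1,
      dFib_eq_sum, dFib_eq_sum, dFib_eq_sum, ← Finset.sum_add_distrib]
    refine Finset.sum_congr rfl fun s _ => ?_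
    rw [← map_add]
    congr 1
    refine Fib.ext fun k => ?_
    exact congrArg (fun T : Cn n →L[ℝ] Alt n k => T (stdBasis n s))
      (fderiv_fun_add (hu.fibDiffAt hy k) (hv.fibDiffAt hy k))

theorem dE_smul (ε r : ℂ) {u : Form n X} (hu : IsSmooth u) : dE ε (r • u) = r • dE ε u :=
  form_ext fun c y hy => by
    have e1 : localRepF c (r • u) = fun y => r • localRepF c u y := rfl
    have e2 : localRepF c (r • dE ε u) y = r • localRepF c (dE ε u) y := rfl
    rw [e2, localRepF_dE ε (hu.smul r) hy, localRepF_dE ε hu hy, e1,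
      dFib_eq_sum, dFib_eq_sum, Finset.smul_sum]
    refine Finset.sum_congr rfl fun s _ => ?_
    rw [← map_smul]
    congr 1
    refine Fib.ext fun k => ?_
    exact congrArg (fun T : Cn n →L[ℝ] Alt n k => T (stdBasis n s))
      (fderiv_fun_const_smul (hu.fibDiffAt hy k) r)

theorem dFib_congr (ε : ℂ) {U V : Cn n → Fib n} {y : Cn n} (h : U =ᶠ[nhds y] V) :
    dFib ε U y = dFib ε V y := by
  rw [dFib_eq_sum, dFib_eq_sum]
  refine Finset.sum_congr rfl fun s _ => ?_
  congr 1
  refine Fib.ext fun k => ?_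
  have : (fun x => U x k) =ᶠ[nhds y] fun x => V x k := h.mono fun x hx => congrFun hx k
  rw [dirD_apply, dirD_apply, this.fderiv_eq]

/-- `∂` and `∂̄` do not increase supports. -/
theorem atPt_dE_eq_zero (ε : ℂ) {u : Form n X} (hu : IsSmooth u) {K : Set X} (hK : IsClosed K)
    (h : ∀ x, x ∉ K → atPt u x = 0) {x : X} (hx : x ∉ K) : atPt (dE ε u) x = 0 := by
  have hy := mem_extChartAt_target (I := 𝓘(ℂ, Cn n)) x
  have e : localRepF x u =ᶠ[nhds (cht n x x)] fun _ => 0 := by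
    have hc : ContinuousAt (cht n x).symm (cht n x x) := continuousAt_extChartAt_symm x
    have hx' : Kᶜ ∈ nhds ((cht n x).symm (cht n x x)) := by
      rw [extChartAt_to_inv]
      exact hK.isOpen_compl.mem_nhds hx
    filter_upwards [hc hx'] with z hz
    rw [localRepF_eq_pull, h _ hz, map_zero]
  rw [← localRepF_self, localRepF_dE ε hu hy, dFib_congr ε e, dFib_eq_sum]
  refine Finset.sum_eq_zero fun s _ => ?_
  have : dirD (fun _ => (0 : Fib n)) (cht n x x) (stdBasis n s) = 0 := Fib.ext fun k => by
    rw [dirD_apply]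
    exact congrArg (fun T : Cn n →L[ℝ] Alt n k => T (stdBasis n s))
      (congrFun (fderiv_fun_const (𝕜 := ℝ) (E := Cn n) (F := Alt n k) 0) (cht n x x))
  rw [this, map_zero]

/-- The torsion operators `τ = [Λ, ∂ω ∧ ·]` (for `ε = i`) and `τ̄ = [Λ, ∂̄ω ∧ ·]` (for `ε = -i`),
with `Λ` the adjoint of `L` in each fibre. -/
def torOp (ε : ℂ) (ω₀ : HForm n 2 X) : Op n X := fun u =>
  adjOp ω₀ ω₀ (wedgeOp (dH ε ω₀) u) - wedgeOp (dH ε ω₀) (adjOp ω₀ ω₀ u)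

/-- `i [Λ, ∂̄]` (for `ε = i`) and `-i [Λ, ∂]` (for `ε = -i`). -/
def lamDiff (ε : ℂ) (ω₀ : HForm n 2 X) : Op n X := fun v =>
  ε • (adjOp ω₀ ω₀ (dE (-ε) v) - dE (-ε) (adjOp ω₀ ω₀ v))

theorem atPt_torOp (ω₀ : HForm n 2 X) (u : Form n X) (x : X) :
    atPt (torOp Complex.I ω₀ u) x = torAt (ω₀ x) (dH Complex.I ω₀ x) (atPt u x) := rfl

theorem IsSmooth.sub {u v : Form n X} (hu : IsSmooth u) (hv : IsSmooth v) : IsSmooth (u - v) :=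
  fun k c => (hu k c).sub (hv k c)

theorem IsSmooth.sum {ι : Type*} {t : Finset ι} {u : ι → Form n X} (h : ∀ i ∈ t, IsSmooth (u i)) :
    IsSmooth (∑ i ∈ t, u i) := by
  classical
  induction t using Finset.induction_on with
  | empty => exact isSmooth_zero
  | insert i t hi ih =>
    rw [Finset.sum_insert hi]
    exact (h i (Finset.mem_insert_self i t)).add
      (ih fun j hj => h j (Finset.mem_insert_of_mem hj))

variable {ω₀ : HForm n 2 X}

theorem IsHermitianMetric.isSmooth_torOp (hω : IsHermitianMetric ω₀) (ε : ℂ) {u : Form n X}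
    (hu : IsSmooth u) : IsSmooth (torOp ε ω₀ u) :=
  (hω.isSmooth_adjOp hω.smooth (hu.wedgeOp (hω.smooth.dH _))).sub
    ((hω.isSmooth_adjOp hω.smooth hu).wedgeOp (hω.smooth.dH _))

theorem IsHermitianMetric.isSmooth_lamDiff (hω : IsHermitianMetric ω₀) (ε : ℂ) {v : Form n X}
    (hv : IsSmooth v) : IsSmooth (lamDiff ε ω₀ v) :=
  ((hω.isSmooth_adjOp hω.smooth (hv.dE _)).sub ((hω.isSmooth_adjOp hω.smooth hv).dE _)).smul _

/-- The divergence formula in a chart. -/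
theorem IsHermitianMetric.sum_divTerm_localRep (hω : IsHermitianMetric ω₀) {u v : Form n X}
    (hu : IsSmooth u) (hv : IsSmooth v) {c : X} {y : Cn n} (hy : y ∈ (cht n c).target) :
    ∑ s, divTerm (HermitianForms.localRep c ω₀) (localRepF c u) (localRepF c v) y s =
      (volDensity (HermitianForms.localRep c ω₀ y) : ℂ) *
        (ptInner ω₀ (dE Complex.I u + torOp Complex.I ω₀ u) v ((cht n c).symm y) -
          ptInner ω₀ u (lamDiff Complex.I ω₀ v) ((cht n c).symm y)) := by
  have hΛ : ∀ z ∈ (cht n c).target, localRepF c (adjOp ω₀ ω₀ v) z =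
      lamAt (HermitianForms.localRep c ω₀ z) (localRepF c v z) := fun z hz =>
    hω.localRepF_adjOp ω₀ v hz
  have hΛ' : localRepF c (adjOp ω₀ ω₀ v) =ᶠ[nhds y] fun z =>
      lamAt (HermitianForms.localRep c ω₀ z) (localRepF c v z) :=
    Filter.eventually_of_mem ((isOpen_cht_target c).mem_nhds hy) hΛ
  have hd : FibDiffAt (fun z => lamAt (HermitianForms.localRep c ω₀ z) (localRepF c v z)) y :=
    fun k => ((hω.isSmooth_adjOp hω.smooth hv).fibDiffAt hy k).congr_of_eventuallyEq
      (hΛ'.symm.mono fun z hz => congrFun hz k)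
  rw [sum_divTerm (hω.smooth.differentiableAt hy)
    (Filter.eventually_of_mem ((isOpen_cht_target c).mem_nhds hy) fun z hz => hω.localRep hz)
    (hv.fibDiffAt hy) hd, hω.ptInner_symm _ _ hy, hω.ptInner_symm _ _ hy]
  have e1 : localRepF c (dE Complex.I u + torOp Complex.I ω₀ u) y = dFib Complex.I (localRepF c u) y +
      torAt (HermitianForms.localRep c ω₀ y) (dFlat Complex.I (HermitianForms.localRep c ω₀) y)
        (localRepF c u y) := by
    have e : localRepF c (dE Complex.I u + torOp Complex.I ω₀ u) y = localRepF c (dE Complex.I u) y +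
      (localRepF c (adjOp ω₀ ω₀ (wedgeOp (dH Complex.I ω₀) u)) y -
        localRepF c (wedgeOp (dH Complex.I ω₀) (adjOp ω₀ ω₀ u)) y) := rfl
    rw [e, localRepF_dE _ hu hy, hω.localRepF_adjOp _ _ hy, localRepF_wedgeOp, localRepF_wedgeOp,
      hω.localRepF_adjOp _ _ hy, localRep_dH _ hω.smooth hy]
    rfl
  have e2 : localRepF c (lamDiff Complex.I ω₀ v) y = Complex.I • (lamAt (HermitianForms.localRep c ω₀ y)
      (dFib (-Complex.I) (localRepF c v) y) - dFib (-Complex.I)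
        (fun z => lamAt (HermitianForms.localRep c ω₀ z) (localRepF c v z)) y) := by
    have e : localRepF c (lamDiff Complex.I ω₀ v) y =
      Complex.I • (localRepF c (adjOp ω₀ ω₀ (dE (-Complex.I) v)) y -
        localRepF c (dE (-Complex.I) (adjOp ω₀ ω₀ v)) y) := rfl
    rw [e, hω.localRepF_adjOp _ _ hy, localRepF_dE _ hv hy,
      localRepF_dE _ (hω.isSmooth_adjOp hω.smooth hv) hy, dFib_congr _ hΛ']
    rfl
  rw [e1, e2]

variable [T2Space X] [CompactSpace X] [MeasurableSpace X] [BorelSpace X]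

theorem IsHermitianMetric.L2_sub_right (hω : IsHermitianMetric ω₀) {u v v' : Form n X}
    (hu : IsSmooth u) (hv : IsSmooth v) (hv' : IsSmooth v') :
    L2 ω₀ u (v - v') = L2 ω₀ u v - L2 ω₀ u v' := by
  have h := hω.L2_add_left (hv.sub hv') hv' hu
  rw [sub_add_cancel] at h
  rw [← hω.L2_conj_symm (hv.sub hv') hu, ← hω.L2_conj_symm hv hu, ← hω.L2_conj_symm hv' hu, h,
    map_add, add_sub_cancel_right]

/-- The formal adjoint of `∂ + τ` is `i [Λ, ∂̄]`, tested on forms supported in a chart. -/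
theorem IsHermitianMetric.L2_dE_add_torOp_of_support (hω : IsHermitianMetric ω₀) {u v : Form n X}
    (hu : IsSmooth u) (hv : IsSmooth v) {c : X} {K : Set X} (hK : IsClosed K)
    (hKc : K ⊆ (cht n c).source) (h0 : ∀ x, x ∉ K → atPt u x = 0) :
    L2 ω₀ (dE Complex.I u + torOp Complex.I ω₀ u) v = L2 ω₀ u (lamDiff Complex.I ω₀ v) := by
  have hs1 := (hu.dE Complex.I).add (hω.isSmooth_torOp Complex.I hu)
  have hs2 := hω.isSmooth_lamDiff Complex.I hv
  have z1 : ∀ x, x ∉ K → ptInner ω₀ (dE Complex.I u + torOp Complex.I ω₀ u) v x = 0 := fun x hx => by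
    have e : atPt (dE Complex.I u + torOp Complex.I ω₀ u) x = (0 : ℂ) • 0 := by
      change atPt (dE Complex.I u) x + atPt (torOp Complex.I ω₀ u) x = _
      rw [atPt_dE_eq_zero _ hu hK h0 hx, atPt_torOp, h0 x hx, map_zero, add_zero, smul_zero]
    rw [ptInner, e, fibInner_smul_left, zero_mul]
  have z2 : ∀ x, x ∉ K → ptInner ω₀ u (lamDiff Complex.I ω₀ v) x = 0 := fun x hx => by
    have e : atPt u x = (0 : ℂ) • 0 := by rw [h0 x hx, smul_zero]
    rw [ptInner, e, fibInner_smul_left, zero_mul]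
  rw [hω.L2_eq hs1 hv, hω.L2_eq hu hs2, ← sub_eq_zero, ← integral_sub
    (hω.integrable (hω.continuous_ptInner hs1 hv)) (hω.integrable (hω.continuous_ptInner hu hs2)),
    hω.integral_eq_chart (f := fun x => ptInner ω₀ (dE Complex.I u + torOp Complex.I ω₀ u) v x -
      ptInner ω₀ u (lamDiff Complex.I ω₀ v) x) c
      ((hω.continuous_ptInner hs1 hv).sub (hω.continuous_ptInner hu hs2)) fun x hx => by
        rw [z1 x fun h => hx (hKc h), z2 x fun h => hx (hKc h), sub_zero],
    ← setIntegral_congr_fun (isOpen_cht_target c).measurableSet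
      fun y hy => hω.sum_divTerm_localRep hu hv hy]
  have hKt : cht n c '' K ⊆ (cht n c).target := by
    rintro _ ⟨x, hx, rfl⟩
    exact (cht n c).map_source (hKc hx)
  have hKk : IsCompact (cht n c '' K) :=
    hK.isCompact.image_of_continuousOn ((continuousOn_extChartAt c).mono hKc)
  have key : ∀ s, _ := fun s => setIntegral_lineDeriv_eq_zero (isOpen_cht_target c)
    (g := fun y => (volDensity (HermitianForms.localRep c ω₀ y) : ℂ) *
      fibInner (cometric (HermitianForms.localRep c ω₀ y))
        (ext₁ (covP Complex.I s) (localRepF c u y)) (localRepF c v y))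
    (g' := fun y => divTerm (HermitianForms.localRep c ω₀) (localRepF c u) (localRepF c v) y s)
    (v := stdBasis n s)
    ((Complex.ofRealCLM.contDiff.comp_contDiffOn (hω.contDiffOn_volDensity c)).mul
      (contDiffOn_fibInner (hω.contDiffOn_cometric c)
        ((isSmooth_iff.1 hu c).const_map (ext₁ (covP Complex.I s))) (isSmooth_iff.1 hv c)))
    (fun y hy => hasLineDerivAt_divTerm (hω.smooth.differentiableAt hy)
      (Filter.eventually_of_mem ((isOpen_cht_target c).mem_nhds hy) fun z hz => hω.localRep hz)
      (hu.fibDiffAt hy) (hv.fibDiffAt hy) s) hKk hKt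
    (fun y hy hyK => by
      have hx : (cht n c).symm y ∉ K := fun h => hyK ⟨_, h, (cht n c).right_inv hy⟩
      have e : ext₁ (covP Complex.I s) (localRepF c u y) = (0 : ℂ) • 0 := by
        rw [localRepF_eq_pull, h0 _ hx, map_zero, map_zero, smul_zero]
      rw [e, fibInner_smul_left, zero_mul, mul_zero])
  rw [integral_finsetSum _ fun s _ => (key s).1]
  exact Finset.sum_eq_zero fun s _ => (key s).2

theorem isManifold_real (n : ℕ) (X : Type*) [TopologicalSpace X] [ChartedSpace (Cn n) X]
    [IsManifold 𝓘(ℂ, Cn n) ∞ X] : IsManifold 𝓘(ℝ, Cn n) ∞ X := by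
  refine isManifold_of_contDiffOn _ _ _ fun e e' he he' => ?_
  have h := HasGroupoid.compatible (G := contDiffGroupoid ∞ 𝓘(ℂ, Cn n)) he he'
  have h2 := (mem_groupoid_of_pregroupoid.1 h).1
  exact ContDiffOn.restrict_scalars ℝ h2

/-- The product of a form with a real function. -/
def mulForm (ρ : X → ℝ) (u : Form n X) : Form n X := fun k x => (ρ x : ℂ) • u k x

theorem isSmooth_mulForm {ρ : X → ℝ}
    (hρ : ∀ c : X, ContDiffOn ℝ ∞ (fun y => ρ ((cht n c).symm y)) (cht n c).target)
    {u : Form n X} (hu : IsSmooth u) : IsSmooth (mulForm ρ u) := fun k c => by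
  have e : localRep c (mulForm ρ u k) =
    fun y => ((ρ ((cht n c).symm y) : ℝ) : ℂ) • localRep c (u k) y := rfl
  rw [e]
  exact (Complex.ofRealCLM.contDiff.comp_contDiffOn (hρ c)).smul (hu k c)

/-- A smooth form is a finite sum of smooth forms supported in charts. -/
theorem exists_sum_support {u : Form n X} (hu : IsSmooth u) :
    ∃ (t : Finset X) (U : X → Form n X) (K : X → Set X), u = ∑ c ∈ t, U c ∧
      (∀ c, IsSmooth (U c)) ∧ (∀ c, IsClosed (K c)) ∧ (∀ c, K c ⊆ (cht n c).source) ∧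
        ∀ c x, x ∉ K c → atPt (U c) x = 0 := by
  have := isManifold_real n X
  obtain ⟨f, hf⟩ := SmoothPartitionOfUnity.exists_isSubordinate_chartAt_source 𝓘(ℝ, Cn n) X
  refine ⟨f.locallyFinite.finite_nonempty_of_compact.toFinset, fun c => mulForm (f c) u,
    fun c => tsupport (f c), ?_, fun c => ?_, fun c => isClosed_tsupport _, fun c => ?_, ?_⟩
  · refine form_ext_atPt fun x => ?_
    have h1 : ∑ c ∈ f.locallyFinite.finite_nonempty_of_compact.toFinset, f c x = 1 := by
      rw [← f.sum_eq_one (Set.mem_univ x)]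
      refine (finsum_eq_sum_of_support_subset _ fun c hc => ?_).symm
      simp only [Set.Finite.coe_toFinset, Set.mem_ofPred_eq]
      exact ⟨x, hc⟩
    have h2 : ∀ t : Finset X, atPt (∑ c ∈ t, mulForm (f c) u) x =
        (((∑ c ∈ t, f c x : ℝ)) : ℂ) • atPt u x := fun t => by
      refine Fib.ext fun k => ?_
      change (∑ c ∈ t, mulForm (f c) u) k x = (((∑ c ∈ t, f c x : ℝ)) : ℂ) • u k x
      rw [Finset.sum_apply, Finset.sum_apply, Complex.ofReal_sum]
      ext v
      rw [ContinuousAlternatingMap.sum_apply, ContinuousAlternatingMap.smul_apply,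
        smul_eq_mul, Finset.sum_mul]
      rfl
    rw [h2, h1, Complex.ofReal_one, one_smul]
  · refine isSmooth_mulForm (fun c' => ?_) hu
    rw [← contMDiffOn_iff_contDiffOn]
    exact (f c).contMDiff.comp_contMDiffOn (contMDiffOn_extChartAt_symm (I := 𝓘(ℝ, Cn n)) c')
  · rw [extChartAt_source]
    exact hf c
  · intro c x hx
    refine Fib.ext fun k => ?_
    change (f c x : ℂ) • u k x = 0
    rw [image_eq_zero_of_notMem_tsupport hx, Complex.ofReal_zero]
    ext v
    exact zero_mul (u k x v)

theorem torOp_add (ε : ℂ) (ω₀ : HForm n 2 X) (u v : Form n X) :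
    torOp ε ω₀ (u + v) = torOp ε ω₀ u + torOp ε ω₀ v :=
  form_ext_atPt fun x => map_add (torAt (ω₀ x) (dH ε ω₀ x)) (atPt u x) (atPt v x)

/-- The formal adjoint of `∂ + τ` is `i [Λ, ∂̄]`. -/
theorem IsHermitianMetric.L2_dE_add_torOp (hω : IsHermitianMetric ω₀) {u v : Form n X}
    (hu : IsSmooth u) (hv : IsSmooth v) :
    L2 ω₀ (dE Complex.I u + torOp Complex.I ω₀ u) v = L2 ω₀ u (lamDiff Complex.I ω₀ v) := by
  obtain ⟨t, U, K, rfl, hU, hK, hKc, h0⟩ := exists_sum_support hu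
  clear hu
  classical
  induction t using Finset.induction_on with
  | empty =>
    have hz : IsSmooth (0 : Form n X) := isSmooth_zero
    rw [Finset.sum_empty]
    by_cases hX : Nonempty X
    · obtain ⟨c⟩ := hX
      exact hω.L2_dE_add_torOp_of_support (c := c) hz hv isClosed_empty (Set.empty_subset _)
        fun x _ => rfl
    · have : IsEmpty X := not_nonempty_iff.1 hX
      congr 1 <;> exact form_ext_atPt fun x => isEmptyElim x
  | insert c t hc ih =>
    have hS : IsSmooth (∑ c ∈ t, U c) := IsSmooth.sum fun c _ => hU c
    have e : dE Complex.I (U c + ∑ c ∈ t, U c) + torOp Complex.I ω₀ (U c + ∑ c ∈ t, U c) =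
        (dE Complex.I (U c) + torOp Complex.I ω₀ (U c)) +
          (dE Complex.I (∑ c ∈ t, U c) + torOp Complex.I ω₀ (∑ c ∈ t, U c)) := by
      rw [dE_add _ (hU c) hS, torOp_add]
      abel
    rw [Finset.sum_insert hc, e, hω.L2_add_left ((hU c).dE _ |>.add (hω.isSmooth_torOp _ (hU c)))
      ((hS.dE _).add (hω.isSmooth_torOp _ hS)) hv,
      hω.L2_add_left (hU c) hS (hω.isSmooth_lamDiff _ hv), ih,
      hω.L2_dE_add_torOp_of_support (hU c) hv (hK c) (hKc c) (h0 c)]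

end GlobalAdjoint

end
end HermitianForms

namespace HermitianForms
noncomputable section

variable {n : ℕ}

/-! ### Commutation relations -/

section RingIdentity

/-- The algebra behind the comparison of the Laplacians of `∂` and `∂̄`. In it `A`, `B`, `t`, `θ`
stand for `∂`, `i ∂̄`, `τ`, `∂ω ∧ ·`, `A'`, `t'`, `θ'` for the adjoints of `A`, `t`, `θ`, and `B'`, `s'`
for the adjoints of `B` and of `i τ̄`. -/
theorem anticomm_adjoint_identity {R : Type*} [Ring R] [Algebra ℂ R]
    {Λ A B t θ A' B' t' s' θ' : R}
    (h1 : Λ * B - B * Λ = A' + t') (h2 : Λ * A - A * Λ = -(B' + s')) (h3 : A * B = -(B * A))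
    (h4 : B * θ = -(θ * B)) (h5 : t = Λ * θ - θ * Λ) (h6 : Λ * A' - A' * Λ = θ')
    (h7 : Λ * t' - t' * Λ = -(θ' + θ' + θ')) (h8 : Λ * t - t * Λ = s' + s') :
    B * B' + B' * B + (θ * θ' + θ' * θ) = (A + t) * (A' + t') + (A' + t') * (A + t) := by
  have e1 : B * B' + B' * B = A * (A' + t') + (A' + t') * A - (B * s' + s' * B) := by
    have hB : B' = A * Λ - Λ * A - s' := by
      linear_combination (norm := noncomm_ring) h2
    rw [hB, ← h1]
    linear_combination (norm := noncomm_ring) h3 * Λ - Λ * h3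
  have e2 : B * t + t * B = -((A' + t') * θ + θ * (A' + t')) := by
    rw [h5, ← h1]
    linear_combination (norm := noncomm_ring) Λ * h4 - h4 * Λ
  have e3 : Λ * (A' + t') - (A' + t') * Λ = -(θ' + θ') := by
    linear_combination (norm := noncomm_ring) h6 + h7
  have e4 : (B * s' + s' * B) + (B * s' + s' * B) =
      (θ * θ' + θ' * θ) + (θ * θ' + θ' * θ) -
        (((A' + t') * t + t * (A' + t')) + ((A' + t') * t + t * (A' + t'))) := by
    have e5 : (B * s' + s' * B) + (B * s' + s' * B) =
        B * (Λ * t - t * Λ) + (Λ * t - t * Λ) * B := by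
      rw [h8]; noncomm_ring
    have e6 : B * (Λ * t - t * Λ) + (Λ * t - t * Λ) * B =
        Λ * (B * t + t * B) - (B * t + t * B) * Λ -
          ((Λ * B - B * Λ) * t + t * (Λ * B - B * Λ)) := by noncomm_ring
    rw [e5, e6, e2, h1]
    generalize A' + t' = C at *
    linear_combination (norm := (rw [h5]; noncomm_ring)) -(e3 * θ) - θ * e3
  have e7 : (B * B' + B' * B + (θ * θ' + θ' * θ)) + (B * B' + B' * B + (θ * θ' + θ' * θ)) =
      ((A + t) * (A' + t') + (A' + t') * (A + t)) +
        ((A + t) * (A' + t') + (A' + t') * (A + t)) := by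
    rw [e1]
    linear_combination (norm := noncomm_ring) -e4
  have e8 := congrArg (fun z => (1 / 2 : ℂ) • z) e7
  simpa only [← two_smul ℂ, smul_smul, one_div, inv_mul_cancel₀ (two_ne_zero' ℂ), one_smul] using e8

end RingIdentity

section SmoothForms

set_option linter.unusedSectionVars false

variable {X : Type*} [TopologicalSpace X] [ChartedSpace (Cn n) X]

/-- The space of smooth forms. -/
def smoothForms (n : ℕ) (X : Type*) [TopologicalSpace X] [ChartedSpace (Cn n) X] :
    Submodule ℂ (Form n X) where
  carrier := {u | IsSmooth u}
  add_mem' := IsSmooth.add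
  zero_mem' := isSmooth_zero
  smul_mem' r _ h := h.smul r

/-- Smooth forms. -/
def SForm (n : ℕ) (X : Type*) [TopologicalSpace X] [ChartedSpace (Cn n) X] : Type _ :=
  smoothForms n X

instance : AddCommGroup (SForm n X) := inferInstanceAs (AddCommGroup (smoothForms n X))

instance : Module ℂ (SForm n X) := inferInstanceAs (Module ℂ (smoothForms n X))

/-- The form underlying a smooth form. -/
def SForm.form (u : SForm n X) : Form n X := u.1

theorem SForm.smooth (u : SForm n X) : IsSmooth u.form := u.2

/-- A form that is smooth, as a smooth form. -/
def IsSmooth.toSForm {u : Form n X} (hu : IsSmooth u) : SForm n X := ⟨u, hu⟩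

theorem SForm.ext {u v : SForm n X} (h : u.form = v.form) : u = v := Subtype.ext h

theorem SForm.ext_atPt {u v : SForm n X} (h : ∀ x, atPt u.form x = atPt v.form x) : u = v :=
  SForm.ext (form_ext_atPt h)

theorem SForm.form_add (u v : SForm n X) : (u + v).form = u.form + v.form := rfl

theorem SForm.form_sub (u v : SForm n X) : (u - v).form = u.form - v.form := rfl

theorem SForm.form_smul (r : ℂ) (u : SForm n X) : (r • u).form = r • u.form := rfl

/-- Endomorphisms of the space of smooth forms. -/
abbrev FormEnd (n : ℕ) (X : Type*) [TopologicalSpace X] [ChartedSpace (Cn n) X] : Type _ :=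
  Module.End ℂ (SForm n X)

variable [IsManifold 𝓘(ℂ, Cn n) ∞ X] {ω₀ : HForm n 2 X}

/-- `∂` (for `ε = i`) and `∂̄` (for `ε = -i`) on smooth forms. -/
def dS (ε : ℂ) : FormEnd n X where
  toFun u := (u.smooth.dE ε).toSForm
  map_add' u v := SForm.ext (dE_add ε u.smooth v.smooth)
  map_smul' r u := SForm.ext (dE_smul ε r u.smooth)

/-- Multiplication by a smooth form. -/
def wedgeS {p : ℕ} {α : HForm n p X} (hα : IsSmoothH α) : FormEnd n X where
  toFun u := (u.smooth.wedgeOp hα).toSForm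
  map_add' u v := SForm.ext_atPt fun x =>
    map_add (wedgeL (α x)) (atPt u.form x) (atPt v.form x)
  map_smul' r u := SForm.ext_atPt fun x => map_smul (wedgeL (α x)) r (atPt u.form x)

/-- The adjoint of multiplication by a smooth form. -/
def adjS (hω : IsHermitianMetric ω₀) {p : ℕ} {α : HForm n p X} (hα : IsSmoothH α) :
    FormEnd n X where
  toFun u := (hω.isSmooth_adjOp hα u.smooth).toSForm
  map_add' u v := SForm.ext_atPt fun x =>
    map_add (wedgeAdj (cometric (ω₀ x)) (α x)) (atPt u.form x) (atPt v.form x)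
  map_smul' r u := SForm.ext_atPt fun x =>
    map_smul (wedgeAdj (cometric (ω₀ x)) (α x)) r (atPt u.form x)

/-- `Λ` on smooth forms. -/
def lamS (hω : IsHermitianMetric ω₀) : FormEnd n X := adjS hω hω.smooth

/-- `τ` (for `ε = i`) and `τ̄` (for `ε = -i`) on smooth forms. -/
def torS (hω : IsHermitianMetric ω₀) (ε : ℂ) : FormEnd n X :=
  lamS hω * wedgeS (hω.smooth.dH ε) - wedgeS (hω.smooth.dH ε) * lamS hω

/-- The adjoint of `torS`. -/
def torAdjS (hω : IsHermitianMetric ω₀) (ε : ℂ) : FormEnd n X :=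
  adjS hω (hω.smooth.dH ε) * wedgeS hω.smooth - wedgeS hω.smooth * adjS hω (hω.smooth.dH ε)

/-- The formal adjoint of `∂` (for `ε = i`) and of `∂̄` (for `ε = -i`) on smooth forms. -/
def dAdjS (hω : IsHermitianMetric ω₀) (ε : ℂ) : FormEnd n X :=
  ε • (lamS hω * dS (-ε) - dS (-ε) * lamS hω) - torAdjS hω ε

theorem form_neg_smul (r : ℂ) (u v : Form n X) : r • (u - v) = -r • (v - u) := by
  funext k x
  ext m
  change r * (u k x m - v k x m) = -r * (v k x m - u k x m)
  ring

theorem form_neg_one_smul (u : Form n X) : (-1 : ℂ) • u = -u := by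
  funext k x
  ext m
  exact neg_one_mul (u k x m)

theorem dS_mul_dS (ε ε' : ℂ) : (dS ε * dS ε' : FormEnd n X) = -(dS ε' * dS ε) :=
  LinearMap.ext fun u => SForm.ext (dE_dE ε ε' u.smooth)

theorem dS_mul_wedgeS_metric (hω : IsHermitianMetric ω₀) (ε : ℂ) :
    dS ε * wedgeS hω.smooth - wedgeS hω.smooth * dS ε = wedgeS (hω.smooth.dH ε) :=
  LinearMap.ext fun u => SForm.ext <| by
    have h := dE_wedgeOp ε hω.smooth u.smooth
    rw [show (-1 : ℂ) ^ 2 = 1 by norm_num, one_smul] at h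
    change dE ε (wedgeOp ω₀ u.form) - wedgeOp ω₀ (dE ε u.form) = wedgeOp (dH ε ω₀) u.form
    rw [h, add_sub_cancel_right]

/-- `∂̄` anticommutes with multiplication by a `∂̄`-closed `3`-form; for `∂ω` this is the SKT
condition. -/
theorem dS_mul_wedgeS_three {α : HForm n 3 X} (hα : IsSmoothH α) {ε : ℂ} (h0 : dH ε α = 0) :
    dS ε * wedgeS hα = -(wedgeS hα * dS ε) :=
  LinearMap.ext fun u => SForm.ext <| by
    have h := dE_wedgeOp ε hα u.smooth
    have hz : wedgeOp (dH ε α) u.form = 0 := by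
      rw [h0]
      refine form_ext_atPt fun x => ?_
      change wedgeL (0 : Alt n 4) (atPt u.form x) = 0
      rw [map_zero, LinearMap.zero_apply]
    rw [show (-1 : ℂ) ^ 3 = -1 by norm_num, hz, zero_add, form_neg_one_smul] at h
    exact h

theorem conjForm_sub (u v : Form n X) : conjForm (u - v) = conjForm u - conjForm v := by
  have h := conjForm_add (u - v) v
  rw [sub_add_cancel] at h
  rw [h, add_sub_cancel_right]

theorem IsHermitianMetric.dH_conj (hω : IsHermitianMetric ω₀) (ε : ℂ) :
    dH ε ω₀ = conjH (dH ((starRingEnd ℂ) ε) ω₀) := by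
  have := dH_conjH ε hω.smooth
  rwa [hω.conjAlt] at this

theorem IsHermitianMetric.lam_conjForm (hω : IsHermitianMetric ω₀) (u : Form n X) :
    adjOp ω₀ ω₀ (conjForm u) = conjForm (adjOp ω₀ ω₀ u) := by
  have := hω.adjOp_conjForm ω₀ u
  rwa [hω.conjAlt] at this

theorem IsHermitianMetric.lef_conjForm (hω : IsHermitianMetric ω₀) (u : Form n X) :
    wedgeOp ω₀ (conjForm u) = conjForm (wedgeOp ω₀ u) := by
  have := wedgeOp_conjForm ω₀ u
  rwa [hω.conjAlt] at this

theorem IsHermitianMetric.torOp_conjForm (hω : IsHermitianMetric ω₀) (ε : ℂ) (u : Form n X) :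
    torOp ε ω₀ (conjForm u) = conjForm (torOp ((starRingEnd ℂ) ε) ω₀ u) := by
  rw [torOp, torOp, hω.dH_conj ε, wedgeOp_conjForm, hω.lam_conjForm, hω.lam_conjForm,
    wedgeOp_conjForm, conjForm_sub]

theorem IsHermitianMetric.lamDiff_conjForm (hω : IsHermitianMetric ω₀) (ε : ℂ) {u : Form n X}
    (hu : IsSmooth u) :
    lamDiff ε ω₀ (conjForm u) = conjForm (lamDiff ((starRingEnd ℂ) ε) ω₀ u) := by
  rw [lamDiff, lamDiff, dE_conjForm _ hu, hω.lam_conjForm, hω.lam_conjForm,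
    dE_conjForm _ (hω.isSmooth_adjOp hω.smooth hu), conjForm_smul, conjForm_sub, map_neg,
    Complex.conj_conj]

theorem IsHermitianMetric.lam_torOp_I (hω : IsHermitianMetric ω₀) (u : Form n X) :
    adjOp ω₀ ω₀ (torOp Complex.I ω₀ u) - torOp Complex.I ω₀ (adjOp ω₀ ω₀ u) =
      (2 * Complex.I) • (wedgeOp ω₀ (adjOp ω₀ (dH (-Complex.I) ω₀) u) -
        adjOp ω₀ (dH (-Complex.I) ω₀) (wedgeOp ω₀ u)) := by
  rw [hω.dH_neg_I]
  exact form_ext_atPt fun x => LinearMap.congr_fun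
    ((hω.isHermitianAt x).lam_torsion (hω.isTypeTwoOne x)) (atPt u x)

theorem IsHermitianMetric.lam_torOp (hω : IsHermitianMetric ω₀) {ε : ℂ}
    (hε : ε = Complex.I ∨ ε = -Complex.I) (u : Form n X) :
    adjOp ω₀ ω₀ (torOp ε ω₀ u) - torOp ε ω₀ (adjOp ω₀ ω₀ u) =
      (2 * ε) • (wedgeOp ω₀ (adjOp ω₀ (dH (-ε) ω₀) u) -
        adjOp ω₀ (dH (-ε) ω₀) (wedgeOp ω₀ u)) := by
  rcases hε with rfl | rfl
  · exact hω.lam_torOp_I u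
  · have h := congrArg conjForm (hω.lam_torOp_I (conjForm u))
    have e : ∀ v, adjOp ω₀ (dH (-Complex.I) ω₀) (conjForm v) =
        conjForm (adjOp ω₀ (dH Complex.I ω₀) v) := fun v => by
      rw [hω.dH_neg_I, hω.adjOp_conjForm]
    have e' : ∀ v, torOp Complex.I ω₀ (conjForm v) =
        conjForm (torOp (-Complex.I) ω₀ v) := fun v => by
      rw [hω.torOp_conjForm, Complex.conj_I]
    rw [conjForm_sub, e', hω.lam_conjForm, conjForm_conjForm, hω.lam_conjForm, e',
      conjForm_conjForm, conjForm_smul, conjForm_sub, e, hω.lef_conjForm, conjForm_conjForm,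
      hω.lef_conjForm, e, conjForm_conjForm, map_mul, Complex.conj_I, map_ofNat] at h
    rw [h, neg_neg]

theorem lamS_mul_torS (hω : IsHermitianMetric ω₀) {ε : ℂ}
    (hε : ε = Complex.I ∨ ε = -Complex.I) :
    lamS hω * torS hω ε - torS hω ε * lamS hω = -(2 * ε) • torAdjS hω (-ε) :=
  LinearMap.ext fun u => SForm.ext <| by
    have h := hω.lam_torOp hε u.form
    rw [form_neg_smul] at h
    exact h

theorem lefS_mul_torS (hω : IsHermitianMetric ω₀) (ε : ℂ) :
    wedgeS hω.smooth * torS hω ε - torS hω ε * wedgeS hω.smooth =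
      wedgeS (hω.smooth.dH ε) + wedgeS (hω.smooth.dH ε) + wedgeS (hω.smooth.dH ε) :=
  LinearMap.ext fun u => SForm.ext_atPt fun x => by
    have h := LinearMap.congr_fun ((hω.isHermitianAt x).lef_torsion (dH ε ω₀ x))
      (atPt u.form x)
    rw [succ_nsmul, two_nsmul] at h
    exact h

end SmoothForms

section Adjoints

set_option linter.unusedSectionVars false

variable {X : Type*} [TopologicalSpace X] [ChartedSpace (Cn n) X] [IsManifold 𝓘(ℂ, Cn n) ∞ X]
  [T2Space X] [CompactSpace X] [MeasurableSpace X] [BorelSpace X] {ω₀ : HForm n 2 X}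

/-- `P'` is adjoint to `P` on smooth forms. -/
def IsAdjS (ω₀ : HForm n 2 X) (P P' : FormEnd n X) : Prop :=
  ∀ u v : SForm n X, L2 ω₀ (P u).form v.form = L2 ω₀ u.form (P' v).form

theorem IsHermitianMetric.L2_add_right (hω : IsHermitianMetric ω₀) {u v v' : Form n X}
    (hu : IsSmooth u) (hv : IsSmooth v) (hv' : IsSmooth v') :
    L2 ω₀ u (v + v') = L2 ω₀ u v + L2 ω₀ u v' := by
  rw [← hω.L2_conj_symm (hv.add hv') hu, ← hω.L2_conj_symm hv hu, ← hω.L2_conj_symm hv' hu,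
    hω.L2_add_left hv hv' hu, map_add]

theorem IsHermitianMetric.L2_smul_right (hω : IsHermitianMetric ω₀) (r : ℂ) {u v : Form n X}
    (hu : IsSmooth u) (hv : IsSmooth v) :
    L2 ω₀ u (r • v) = (starRingEnd ℂ) r * L2 ω₀ u v := by
  rw [← hω.L2_conj_symm (hv.smul r) hu, ← hω.L2_conj_symm hv hu, hω.L2_smul_left r hv hu, map_mul]

theorem IsHermitianMetric.L2_sub_left (hω : IsHermitianMetric ω₀) {u u' v : Form n X}
    (hu : IsSmooth u) (hu' : IsSmooth u') (hv : IsSmooth v) :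
    L2 ω₀ (u - u') v = L2 ω₀ u v - L2 ω₀ u' v := by
  rw [← hω.L2_conj_symm hv (hu.sub hu'), ← hω.L2_conj_symm hv hu, ← hω.L2_conj_symm hv hu',
    hω.L2_sub_right hv hu hu', map_sub]

variable {P P' R R' : FormEnd n X}

theorem IsAdjS.symm (hω : IsHermitianMetric ω₀) (h : IsAdjS ω₀ P P') : IsAdjS ω₀ P' P :=
  fun u v => by
    rw [← hω.L2_conj_symm v.smooth (P' u).smooth, ← h, hω.L2_conj_symm (P v).smooth u.smooth]

theorem IsAdjS.mul (h : IsAdjS ω₀ P P') (h' : IsAdjS ω₀ R R') : IsAdjS ω₀ (P * R) (R' * P') :=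
  fun u v => (h (R u) v).trans (h' u (P' v))

theorem IsAdjS.add (hω : IsHermitianMetric ω₀) (h : IsAdjS ω₀ P P') (h' : IsAdjS ω₀ R R') :
    IsAdjS ω₀ (P + R) (P' + R') := fun u v => by
  rw [LinearMap.add_apply, LinearMap.add_apply, SForm.form_add, SForm.form_add,
    hω.L2_add_left (P u).smooth (R u).smooth v.smooth, h, h',
    hω.L2_add_right u.smooth (P' v).smooth (R' v).smooth]

theorem IsAdjS.sub (hω : IsHermitianMetric ω₀) (h : IsAdjS ω₀ P P') (h' : IsAdjS ω₀ R R') :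
    IsAdjS ω₀ (P - R) (P' - R') := fun u v => by
  rw [LinearMap.sub_apply, LinearMap.sub_apply, SForm.form_sub, SForm.form_sub,
    hω.L2_sub_left (P u).smooth (R u).smooth v.smooth, h, h',
    hω.L2_sub_right u.smooth (P' v).smooth (R' v).smooth]

theorem IsAdjS.smul (hω : IsHermitianMetric ω₀) (r : ℂ) (h : IsAdjS ω₀ P P') :
    IsAdjS ω₀ (r • P) ((starRingEnd ℂ) r • P') := fun u v => by
  rw [LinearMap.smul_apply, LinearMap.smul_apply, SForm.form_smul, SForm.form_smul,
    hω.L2_smul_left r (P u).smooth v.smooth, h, hω.L2_smul_right _ u.smooth (P' v).smooth,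
    Complex.conj_conj]

theorem IsAdjS.unique (hω : IsHermitianMetric ω₀) (h : IsAdjS ω₀ P P') (h' : IsAdjS ω₀ P R') :
    P' = R' := LinearMap.ext fun v => by
  have hs : IsSmooth ((P' v).form - (R' v).form) := (P' v).smooth.sub (R' v).smooth
  have h0 : L2 ω₀ ((P' v).form - (R' v).form) ((P' v).form - (R' v).form) = 0 := by
    rw [hω.L2_sub_right hs (P' v).smooth (R' v).smooth]
    exact sub_eq_zero.2 ((h hs.toSForm v).symm.trans (h' hs.toSForm v))
  exact SForm.ext (sub_eq_zero.1 (hω.eq_zero_of_L2_self hs h0))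

theorem isAdjS_wedgeS (hω : IsHermitianMetric ω₀) {p : ℕ} {α : HForm n p X} (hα : IsSmoothH α) :
    IsAdjS ω₀ (wedgeS hα) (adjS hω hα) := fun u v => by
  have hs : IsSmooth (wedgeOp α u.form) := u.smooth.wedgeOp hα
  have hs' : IsSmooth (adjOp ω₀ α v.form) := hω.isSmooth_adjOp hα v.smooth
  change L2 ω₀ (wedgeOp α u.form) v.form = L2 ω₀ u.form (adjOp ω₀ α v.form)
  rw [hω.L2_eq hs v.smooth, hω.L2_eq u.smooth hs', hω.ptInner_wedgeOp]

theorem isAdjS_lamS (hω : IsHermitianMetric ω₀) :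
    IsAdjS ω₀ (lamS hω) (wedgeS hω.smooth) := (isAdjS_wedgeS hω hω.smooth).symm hω

theorem isAdjS_torS (hω : IsHermitianMetric ω₀) (ε : ℂ) :
    IsAdjS ω₀ (torS hω ε) (torAdjS hω ε) :=
  ((isAdjS_lamS hω).mul (isAdjS_wedgeS hω _)).sub hω ((isAdjS_wedgeS hω _).mul (isAdjS_lamS hω))

theorem IsHermitianMetric.L2_dE_add_torOp' (hω : IsHermitianMetric ω₀) {ε : ℂ}
    (hε : ε = Complex.I ∨ ε = -Complex.I) {u v : Form n X} (hu : IsSmooth u) (hv : IsSmooth v) :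
    L2 ω₀ (dE ε u + torOp ε ω₀ u) v = L2 ω₀ u (lamDiff ε ω₀ v) := by
  rcases hε with rfl | rfl
  · exact hω.L2_dE_add_torOp hu hv
  · have h := congrArg (starRingEnd ℂ) (hω.L2_dE_add_torOp hu.conjForm hv.conjForm)
    rw [← hω.L2_conjForm ((hu.conjForm.dE _).add (hω.isSmooth_torOp _ hu.conjForm)) hv.conjForm,
      ← hω.L2_conjForm hu.conjForm (hω.isSmooth_lamDiff _ hv.conjForm), dE_conjForm _ hu,
      hω.torOp_conjForm, hω.lamDiff_conjForm _ hv, ← conjForm_add, conjForm_conjForm,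
      conjForm_conjForm, conjForm_conjForm, conjForm_conjForm, Complex.conj_I] at h
    exact h

theorem isAdjS_dS (hω : IsHermitianMetric ω₀) {ε : ℂ} (hε : ε = Complex.I ∨ ε = -Complex.I) :
    IsAdjS ω₀ (dS ε) (dAdjS hω ε) := by
  have h : IsAdjS ω₀ (dS ε + torS hω ε) (ε • (lamS hω * dS (-ε) - dS (-ε) * lamS hω)) :=
    fun u v => hω.L2_dE_add_torOp' hε u.smooth v.smooth
  have h2 := h.sub hω (isAdjS_torS hω ε)
  rwa [add_sub_cancel_right] at h2

/-- `∂̄ ∂̄^⋆ + ∂̄^⋆ ∂̄ + [∂ω ∧ ·, (∂ω ∧ ·)^⋆] = [∂ + τ, (∂ + τ)^⋆]` for `ε = i`, and the conjugate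
identity for `ε = -i`. -/
theorem IsSKT.laplacian_identity (hω : IsSKT ω₀) {ε : ℂ} (hε : ε = Complex.I ∨ ε = -Complex.I) :
    dS (-ε) * dAdjS hω.1 (-ε) + dAdjS hω.1 (-ε) * dS (-ε) +
      (wedgeS (hω.1.smooth.dH ε) * adjS hω.1 (hω.1.smooth.dH ε) +
        adjS hω.1 (hω.1.smooth.dH ε) * wedgeS (hω.1.smooth.dH ε)) =
    (dS ε + torS hω.1 ε) * (dAdjS hω.1 ε + torAdjS hω.1 ε) +
      (dAdjS hω.1 ε + torAdjS hω.1 ε) * (dS ε + torS hω.1 ε) := by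
  have hε2 : ε * ε = -1 := by rcases hε with rfl | rfl <;> simp
  have h0 : dH (-ε) (dH ε ω₀) = 0 := by
    rcases hε with rfl | rfl
    · exact hω.dH_dH.1
    · rw [neg_neg]; exact hω.dH_dH.2
  have key := anticomm_adjoint_identity (Λ := lamS hω.1) (A := dS ε) (B := ε • dS (-ε))
    (t := torS hω.1 ε) (θ := wedgeS (hω.1.smooth.dH ε)) (A' := dAdjS hω.1 ε)
    (B' := -ε • dAdjS hω.1 (-ε)) (t' := torAdjS hω.1 ε) (s' := -ε • torAdjS hω.1 (-ε))
    (θ' := adjS hω.1 (hω.1.smooth.dH ε)) ?_ ?_ ?_ ?_ rfl ?_ ?_ ?_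
  · rw [← key, smul_mul_smul_comm, smul_mul_smul_comm, mul_neg, neg_mul, hε2, neg_neg, one_smul,
      one_smul]
  · rw [dAdjS, sub_add_cancel, mul_smul_comm, smul_mul_assoc, smul_sub]
  · rw [← smul_add, dAdjS, sub_add_cancel, neg_neg, smul_smul, neg_mul_neg, hε2, neg_one_smul,
      neg_neg]
  · rw [mul_smul_comm, smul_mul_assoc, dS_mul_dS, smul_neg]
  · rw [mul_smul_comm, smul_mul_assoc, dS_mul_wedgeS_three _ h0, smul_neg]
  · have hd := isAdjS_dS hω.1 hε
    have h := (hd.mul (isAdjS_wedgeS hω.1 hω.1.smooth)).sub hω.1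
      ((isAdjS_wedgeS hω.1 hω.1.smooth).mul hd)
    rw [dS_mul_wedgeS_metric hω.1] at h
    exact h.unique hω.1 (isAdjS_wedgeS hω.1 _)
  · have ht := isAdjS_torS hω.1 ε
    have hw := isAdjS_wedgeS hω.1 (hω.1.smooth.dH ε)
    have h := ((isAdjS_wedgeS hω.1 hω.1.smooth).mul ht).sub hω.1
      (ht.mul (isAdjS_wedgeS hω.1 hω.1.smooth))
    rw [lefS_mul_torS] at h
    have h2 := h.unique hω.1 ((hw.add hω.1 hw).add hω.1 hw)
    rw [← h2]
    exact (neg_sub _ _).symm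
  · rw [lamS_mul_torS hω.1 hε, ← add_smul]
    congr 1
    ring

end Adjoints

end
end HermitianForms

namespace HermitianForms
noncomputable section

variable {n : ℕ}

/-! ### Boundedness of operators of order zero -/

section Bounded

variable {Y : Type*} {l : Filter Y} {Q : Y → Matrix (Fin n ⊕ Fin n) (Fin n ⊕ Fin n) ℝ}
  {P R : Y → FibEnd n}

/-- A family of endomorphisms of the fibres is bounded along a filter, uniformly for the norms given
by a family of metrics. -/
def BddFam (l : Filter Y) (Q : Y → Matrix (Fin n ⊕ Fin n) (Fin n ⊕ Fin n) ℝ)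
    (P : Y → FibEnd n) : Prop :=
  ∃ M : ℝ, ∀ᶠ y in l, ∀ a, (fibInner (Q y) (P y a) (P y a)).re ≤ M * (fibInner (Q y) a a).re

theorem re_fibInner_self_nonneg {Q : Matrix (Fin n ⊕ Fin n) (Fin n ⊕ Fin n) ℝ} (hQ : Q.PosDef)
    (a : Fib n) : 0 ≤ (fibInner Q a a).re := (Complex.le_def.1 (fibInner_self_nonneg hQ a)).1

theorem BddFam.exists_pos (hQ : ∀ᶠ y in l, (Q y).PosDef) (h : BddFam l Q P) :
    ∃ M : ℝ, 0 < M ∧ ∀ᶠ y in l, ∀ a,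
      (fibInner (Q y) (P y a) (P y a)).re ≤ M * (fibInner (Q y) a a).re := by
  obtain ⟨M, hM⟩ := h
  refine ⟨max M 1, by positivity, ?_⟩
  filter_upwards [hM, hQ] with y hy hQy a
  exact (hy a).trans (mul_le_mul_of_nonneg_right (le_max_left _ _) (re_fibInner_self_nonneg hQy a))

theorem bddFam_zero : BddFam l Q (fun _ => 0) :=
  ⟨0, .of_forall fun y a => by rw [LinearMap.zero_apply, fibInner_zero_left]; simp⟩

theorem BddFam.add (hQ : ∀ᶠ y in l, (Q y).PosDef) (h : BddFam l Q P) (h' : BddFam l Q R) :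
    BddFam l Q (fun y => P y + R y) := by
  obtain ⟨M, hM⟩ := h
  obtain ⟨M', hM'⟩ := h'
  refine ⟨2 * (M + M'), ?_⟩
  filter_upwards [hM, hM', hQ] with y h1 h2 hQy a
  have h3 := re_fibInner_self_nonneg hQy (P y a - R y a)
  have hs := hQy.isSymm'
  rw [fibInner_sub_left, fibInner_sub_right hs, fibInner_sub_right hs] at h3
  rw [LinearMap.add_apply, fibInner_add_left, fibInner_add_right hs, fibInner_add_right hs]
  simp only [Complex.add_re, Complex.sub_re] at h3 ⊢
  linarith [h1 a, h2 a]

theorem BddFam.mul (hQ : ∀ᶠ y in l, (Q y).PosDef) (h : BddFam l Q P) (h' : BddFam l Q R) :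
    BddFam l Q (fun y => P y * R y) := by
  obtain ⟨M, hM0, hM⟩ := h.exists_pos hQ
  obtain ⟨M', hM'⟩ := h'
  refine ⟨M * M', ?_⟩
  filter_upwards [hM, hM'] with y h1 h2 a
  rw [Module.End.mul_apply, mul_assoc]
  exact (h1 (R y a)).trans (mul_le_mul_of_nonneg_left (h2 a) hM0.le)

theorem BddFam.smul (hQ : ∀ᶠ y in l, (Q y).PosDef) {f : Y → ℂ} {z : ℂ}
    (hf : Filter.Tendsto f l (nhds z)) (h : BddFam l Q P) :
    BddFam l Q (fun y => f y • P y) := by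
  obtain ⟨M, hM0, hM⟩ := h.exists_pos hQ
  have hf2 : ∀ᶠ y in l, Complex.normSq (f y) < Complex.normSq z + 1 :=
    (Complex.continuous_normSq.continuousAt.tendsto.comp hf).eventually (gt_mem_nhds (by linarith))
  refine ⟨(Complex.normSq z + 1) * M, ?_⟩
  filter_upwards [hM, hf2, hQ] with y h1 h2 hQy a
  have e : fibInner (Q y) (f y • P y a) (f y • P y a) =
      (Complex.normSq (f y) : ℂ) * fibInner (Q y) (P y a) (P y a) := by
    rw [fibInner_smul_left, fibInner_smul_right hQy.isSymm', ← mul_assoc, Complex.mul_conj]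
  rw [LinearMap.smul_apply, e, Complex.re_ofReal_mul, mul_assoc]
  exact mul_le_mul h2.le (h1 a) (re_fibInner_self_nonneg hQy _)
    (by linarith [Complex.normSq_nonneg z])

theorem BddFam.sub (hQ : ∀ᶠ y in l, (Q y).PosDef) (h : BddFam l Q P) (h' : BddFam l Q R) :
    BddFam l Q (fun y => P y - R y) := by
  have := h.add hQ (h'.smul hQ (f := fun _ => -1) tendsto_const_nhds)
  simpa [sub_eq_add_neg] using this

theorem BddFam.sum (hQ : ∀ᶠ y in l, (Q y).PosDef) {ι : Type*} (s : Finset ι)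
    {P : ι → Y → FibEnd n} (h : ∀ i, BddFam l Q (P i)) :
    BddFam l Q (fun y => ∑ i ∈ s, P i y) := by
  classical
  induction s using Finset.induction_on with
  | empty => simpa using bddFam_zero
  | insert i s hi ih =>
    simp only [Finset.sum_insert hi]
    exact (h i).add hQ ih

/-- `⟨α ∧ a, α ∧ a⟩ ≤ ⟨α, α⟩ ⟨a, a⟩` for a covector `α`, since `⟨α, α⟩` is the anticommutator of
`α ∧ ·` and its adjoint. -/
theorem bddFam_ext₁ (hQ : ∀ᶠ y in l, (Q y).PosDef)
    {Q₀ : Matrix (Fin n ⊕ Fin n) (Fin n ⊕ Fin n) ℝ}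
    (hl : ∀ s t, Filter.Tendsto (fun y => Q y s t) l (nhds (Q₀ s t))) (α : Cov n) :
    BddFam l Q (fun _ => ext₁ α) := by
  have hc : Filter.Tendsto (fun y => (covPair (Q y) α (conjCov α)).re) l
      (nhds (covPair Q₀ α (conjCov α)).re) := by
    refine (Complex.continuous_re.tendsto _).comp ?_
    simp only [covPair]
    refine tendsto_finsetSum _ fun s _ => tendsto_finsetSum _ fun t _ => ?_
    exact (((Complex.continuous_ofReal.tendsto _).comp (hl s t)).mul_const _).mul_const _
  refine ⟨(covPair Q₀ α (conjCov α)).re + 1, ?_⟩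
  filter_upwards [hQ, hc.eventually (gt_mem_nhds (lt_add_one _))] with y hQy hy a
  have hs := hQy.isSymm'
  have h1 := isAdjAt_ext₁ (Q y) α
  have h2 := congrArg (fun z => (fibInner (Q y) a z).re)
    (LinearMap.congr_fun (ext₁_contrCov (Q y) α (conjCov α)) a)
  simp only [LinearMap.add_apply, Module.End.mul_apply, fibInner_add_right hs,
    Module.algebraMap_end_apply, fibInner_smul_right hs, Complex.add_re] at h2
  rw [← h1.symm hs a (contrCov (Q y) (conjCov α) a), ← h1 a (ext₁ α a)] at h2
  have h3 := re_fibInner_self_nonneg hQy (contrCov (Q y) (conjCov α) a)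
  have h4 := fibInner_self_nonneg hQy a
  have h5 : (fibInner (Q y) a a).im = 0 := (Complex.le_def.1 h4).2.symm
  rw [Complex.mul_re, h5, mul_zero, sub_zero, Complex.conj_re] at h2
  have h6 := mul_le_mul_of_nonneg_right hy.le (re_fibInner_self_nonneg hQy a)
  linarith

/-- The adjoints of a bounded family are bounded. -/
theorem BddFam.adjoint (hQ : ∀ᶠ y in l, (Q y).PosDef) (h : BddFam l Q P)
    (hR : ∀ᶠ y in l, IsAdjAt (Q y) (P y) (R y)) : BddFam l Q R := by
  obtain ⟨M, hM0, hM⟩ := h.exists_pos hQ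
  refine ⟨M, ?_⟩
  filter_upwards [hM, hQ, hR] with y h1 hQy h a
  have hs := hQy.isSymm'
  -- expand `0 ≤ ‖P P^⋆ a - M a‖²`
  have h3 := re_fibInner_self_nonneg hQy (P y (R y a) - (M : ℂ) • a)
  have h2 := h1 (R y a)
  have e1 : fibInner (Q y) (P y (R y a)) a = fibInner (Q y) (R y a) (R y a) := h _ _
  have e2 : fibInner (Q y) a (P y (R y a)) = fibInner (Q y) (R y a) (R y a) := (h.symm hs _ _).symm
  rw [fibInner_sub_left, fibInner_sub_right hs, fibInner_sub_right hs, fibInner_smul_left,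
    fibInner_smul_left, fibInner_smul_right hs, fibInner_smul_right hs, e1, e2,
    Complex.conj_ofReal] at h3
  simp only [Complex.sub_re, Complex.re_ofReal_mul] at h3
  have h4 : M * (fibInner (Q y) (R y a) (R y a)).re ≤ M * (M * (fibInner (Q y) a a).re) := by
    linarith
  exact le_of_mul_le_mul_left h4 hM0

theorem bddFam_wedgeL (hQ : ∀ᶠ y in l, (Q y).PosDef)
    {Q₀ : Matrix (Fin n ⊕ Fin n) (Fin n ⊕ Fin n) ℝ}
    (hl : ∀ s t, Filter.Tendsto (fun y => Q y s t) l (nhds (Q₀ s t))) {p : ℕ}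
    {α : Y → Alt n p} {α₀ : Alt n p} (hα : Filter.Tendsto α l (nhds α₀)) :
    BddFam l Q (fun y => wedgeL (α y)) := by
  induction p with
  | zero =>
    have h1 : BddFam l Q (fun _ => (1 : FibEnd n)) :=
      ⟨1, .of_forall fun y a => by rw [one_mul, Module.End.one_apply]⟩
    have h2 : Filter.Tendsto (fun y => α y ![]) l (nhds (α₀ ![])) :=
      ((ContinuousAlternatingMap.apply ℝ (Cn n) ℂ ![]).continuous.tendsto α₀).comp hα
    have h3 := h1.smul hQ h2
    simpa only [wedgeL_zero, Algebra.algebraMap_eq_smul_one] using h3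
  | succ p ih =>
    let C (s : Fin n ⊕ Fin n) : Alt n (p + 1) →ₗ[ℝ] Alt n p :=
      { toFun := fun a => a.curryLeft (stdBasis n s)
        map_add' := fun a b => by ext v; rfl
        map_smul' := fun r a => by ext v; rfl }
    have hC : ∀ s, Filter.Tendsto (fun y => (α y).curryLeft (stdBasis n s)) l
        (nhds (α₀.curryLeft (stdBasis n s))) := fun s =>
      ((C s).continuous_of_finiteDimensional.tendsto α₀).comp hα
    simp only [wedgeL_succ (stdBasis n)]
    exact BddFam.smul hQ (f := fun _ => ((p : ℂ) + 1)⁻¹) tendsto_const_nhds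
      (BddFam.sum hQ _ fun s => (bddFam_ext₁ hQ hl _).mul hQ (ih (hC s)))

end Bounded

section BoundedForms

open MeasureTheory

set_option linter.unusedSectionVars false

variable {X : Type*} [TopologicalSpace X] [ChartedSpace (Cn n) X] [IsManifold 𝓘(ℂ, Cn n) ∞ X]
  {ω₀ : HForm n 2 X}

/-- A family of endomorphisms of the fibres is bounded on `X`. -/
def BddOn (ω₀ : HForm n 2 X) (P : X → FibEnd n) : Prop :=
  BddFam ⊤ (fun x => cometric (ω₀ x)) P

theorem IsHermitianMetric.eventually_posDef (hω : IsHermitianMetric ω₀) :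
    ∀ᶠ x in (⊤ : Filter X), (cometric (ω₀ x)).PosDef :=
  .of_forall fun x => (hω.isHermitianAt x).cometric_posDef

variable [CompactSpace X]

/-- Exterior multiplication by a smooth form is locally bounded, hence bounded by compactness. -/
theorem IsHermitianMetric.bddOn_wedgeL (hω : IsHermitianMetric ω₀) {p : ℕ} {α : HForm n p X}
    (hα : IsSmoothH α) : BddOn ω₀ (fun x => wedgeL (α x)) := by
  have hloc : ∀ x : X, ∃ M : ℝ, ∀ᶠ z in nhds x, ∀ a,
      (fibInner (cometric (ω₀ z)) (wedgeL (α z) a) (wedgeL (α z) a)).re ≤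
        M * (fibInner (cometric (ω₀ z)) a a).re := by
    intro x
    have hT := (isOpen_cht_target (n := n) x).mem_nhds (mem_extChartAt_target x)
    obtain ⟨M, hM⟩ := bddFam_wedgeL (l := nhds (cht n x x))
      (Q := fun y => cometric (HermitianForms.localRep x ω₀ y))
      (Filter.eventually_of_mem hT fun y hy => (hω.localRep hy).cometric_posDef)
      (fun s t => ((hω.contDiffOn_cometric x s t).continuousOn.continuousAt hT).tendsto)
      ((hα x).continuousOn.continuousAt hT).tendsto
    refine ⟨M, ?_⟩
    filter_upwards [(continuousAt_extChartAt (I := 𝓘(ℂ, Cn n)) x).eventually hM,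
      (isOpen_cht_source (n := n) x).mem_nhds (mem_extChartAt_source x)] with z hz hzS a
    have hb := chartSymmDeriv_bijective ((cht n x).map_source hzS)
    have h := hz (pullFib ((chartSymmDeriv x (cht n x z)).restrictScalars ℝ) a)
    have hω' := hω.isHermitianAt ((cht n x).symm (cht n x z))
    have e : wedgeL (HermitianForms.localRep x α (cht n x z))
        (pullFib ((chartSymmDeriv x (cht n x z)).restrictScalars ℝ) a) =
        pullFib ((chartSymmDeriv x (cht n x z)).restrictScalars ℝ)
          (wedgeL (α ((cht n x).symm (cht n x z))) a) := (pullFib_wedgeL _ _ _).symm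
    have f : ∀ b : Fib n, fibInner (cometric (HermitianForms.localRep x ω₀ (cht n x z)))
        (pullFib ((chartSymmDeriv x (cht n x z)).restrictScalars ℝ) b)
        (pullFib ((chartSymmDeriv x (cht n x z)).restrictScalars ℝ) b) =
        fibInner (cometric (ω₀ ((cht n x).symm (cht n x z)))) b b := fun b =>
      hω'.fibInner_pull hb.injective _ _
    rw [e, f, f, (cht n x).left_inv hzS] at h
    exact h
  choose M hM using hloc
  obtain ⟨t, ht⟩ := isCompact_univ.elim_nhds_subcover _ fun x _ => hM x
  refine ⟨∑ x ∈ t, |M x|, Filter.eventually_top.2 fun z a => ?_⟩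
  obtain ⟨x, hx, hz⟩ := Set.mem_iUnion₂.1 (ht.2 (Set.mem_univ z))
  refine (hz a).trans (mul_le_mul_of_nonneg_right ?_
    (re_fibInner_self_nonneg (hω.isHermitianAt z).cometric_posDef a))
  exact (le_abs_self _).trans
    (Finset.single_le_sum (f := fun x => |M x|) (fun _ _ => abs_nonneg _) hx)

theorem IsHermitianMetric.bddOn_wedgeAdj (hω : IsHermitianMetric ω₀) {p : ℕ} {α : HForm n p X}
    (hα : IsSmoothH α) : BddOn ω₀ (fun x => wedgeAdj (cometric (ω₀ x)) (α x)) :=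
  (hω.bddOn_wedgeL hα).adjoint hω.eventually_posDef
    (.of_forall fun x => isAdjAt_wedgeL (hω.isHermitianAt x).cometric_isSymm (α x))

variable [T2Space X] [MeasurableSpace X] [BorelSpace X]

/-- Bounded families of endomorphisms of the fibres are bounded in the `L²` norm. -/
theorem IsHermitianMetric.L2_le_of_bddOn (hω : IsHermitianMetric ω₀) {P : X → FibEnd n}
    (hP : BddOn ω₀ P) : ∃ M : ℝ, 0 < M ∧ ∀ u, IsSmooth u → IsSmooth (ptOp P u) →
      L2 ω₀ (ptOp P u) (ptOp P u) ≤ (M : ℂ) * L2 ω₀ u u := by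
  obtain ⟨M, hM0, hM⟩ := hP.exists_pos hω.eventually_posDef
  refine ⟨M, hM0, fun u hu hPu => ?_⟩
  rw [hω.L2_self hu, hω.L2_self hPu, ← Complex.ofReal_mul, Complex.real_le_real,
    ← integral_const_mul]
  refine integral_mono (hω.integrable (hω.continuous_ptInner hPu hPu)).re
    ((hω.integrable (hω.continuous_ptInner hu hu)).re.const_mul M) fun x => ?_
  exact Filter.eventually_top.1 hM x (atPt u x)

end BoundedForms

end
end HermitianForms

namespace HermitianForms
noncomputable section

variable {n : ℕ}

/-! ### Comparison of the Laplacians -/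

section Comparison

set_option linter.unusedSectionVars false

variable {X : Type*} [TopologicalSpace X] [ChartedSpace (Cn n) X] [IsManifold 𝓘(ℂ, Cn n) ∞ X]
  {ω₀ : HForm n 2 X}

/-- The operator `T` acts on smooth forms as the endomorphism `P`. -/
def ActsAs (T : Op n X) (P : FormEnd n X) : Prop := ∀ u : SForm n X, T u.form = (P u).form

section ActsAs

variable {T S : Op n X} {P R : FormEnd n X}

theorem ActsAs.isSmooth (h : ActsAs T P) {u : Form n X} (hu : IsSmooth u) : IsSmooth (T u) := by
  have := h hu.toSForm
  change T u = _ at this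
  rw [this]
  exact (P hu.toSForm).smooth

theorem ActsAs.add (h : ActsAs T P) (h' : ActsAs S R) : ActsAs (T + S) (P + R) := fun u => by
  rw [Pi.add_apply, h, h']
  rfl

theorem ActsAs.smul (r : ℝ) (h : ActsAs T P) : ActsAs (r • T) ((r : ℂ) • P) := fun u => by
  rw [Pi.smul_apply, h]
  funext k x
  ext m
  exact Complex.real_smul

theorem ActsAs.gcomm_odd {a b : ℤ} (hab : ((-1 : ℝ) ^ (a * b)) = -1) (h : ActsAs T P)
    (h' : ActsAs S R) : ActsAs (gcomm a b T S) (P * R + R * P) := fun u => by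
  have e : gcomm a b T S u.form = T (S u.form) - (-1 : ℝ) • S (T u.form) := by rw [gcomm, hab]
  rw [e, h', h, h, h']
  funext k x
  ext m
  change (P (R u)).form k x m - ((-1 : ℝ) • (R (P u)).form k x m) =
    (P (R u)).form k x m + (R (P u)).form k x m
  rw [neg_one_smul, sub_neg_eq_add]

theorem ActsAs.gcomm_even {a b : ℤ} (hab : ((-1 : ℝ) ^ (a * b)) = 1) (h : ActsAs T P)
    (h' : ActsAs S R) : ActsAs (gcomm a b T S) (P * R - R * P) := fun u => by
  have e : gcomm a b T S u.form = T (S u.form) - (1 : ℝ) • S (T u.form) := by rw [gcomm, hab]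
  rw [e, h', h, h, h']
  funext k x
  ext m
  change (P (R u)).form k x m - ((1 : ℝ) • (R (P u)).form k x m) =
    (P (R u)).form k x m - (R (P u)).form k x m
  rw [one_smul]

end ActsAs

theorem actsAs_dE (ε : ℂ) : ActsAs (dE ε : Op n X) (dS ε) := fun _ => rfl

theorem actsAs_delOp : ActsAs (delOp : Op n X) (dS Complex.I) := by
  rw [delOp_eq]; exact actsAs_dE _

theorem actsAs_delbarOp : ActsAs (delbarOp : Op n X) (dS (-Complex.I)) := by
  rw [delbarOp_eq]; exact actsAs_dE _

theorem actsAs_dOp : ActsAs (dOp : Op n X) (dS Complex.I + dS (-Complex.I)) := by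
  rw [dOp_eq]; exact (actsAs_dE _).add (actsAs_dE _)

theorem actsAs_dh (h : ℝ) :
    ActsAs (dh h : Op n X) ((h : ℂ) • dS Complex.I + dS (-Complex.I)) :=
  (actsAs_delOp.smul h).add actsAs_delbarOp

theorem actsAs_wedgeOp {p : ℕ} {α : HForm n p X} (hα : IsSmoothH α) :
    ActsAs (wedgeOp α) (wedgeS hα) := fun _ => rfl

variable [T2Space X] [CompactSpace X] [MeasurableSpace X] [BorelSpace X]

section Adj

variable {T : Op n X} {P P' : FormEnd n X}

open Classical in
theorem ActsAs.exists_isFormalAdjoint (h : ActsAs T P) (hP : IsAdjS ω₀ P P') :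
    ∃ S, IsFormalAdjoint ω₀ T S := by
  refine ⟨fun v => if hv : IsSmooth v then (P' hv.toSForm).form else 0, fun v hv => ?_,
    fun u v hu hv => ?_⟩
  · change IsSmooth (dite _ _ _)
    rw [dif_pos hv]
    exact (P' hv.toSForm).smooth
  · change _ = L2 ω₀ u (dite _ _ _)
    rw [dif_pos hv]
    have := h hu.toSForm
    change T u = _ at this
    rw [this]
    exact hP hu.toSForm hv.toSForm

theorem ActsAs.hasFormalAdjoint (h : ActsAs T P) (hP : IsAdjS ω₀ P P') :
    HasFormalAdjoint ω₀ T := ⟨fun _ hu => h.isSmooth hu, h.exists_isFormalAdjoint hP⟩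

/-- The formal adjoint is unique on smooth forms. -/
theorem ActsAs.adj (hω : IsHermitianMetric ω₀) (h : ActsAs T P) (hP : IsAdjS ω₀ P P') :
    ActsAs (HermitianForms.adj ω₀ T) P' := fun v => by
  have hex := h.exists_isFormalAdjoint hP
  have hadj : IsFormalAdjoint ω₀ T (HermitianForms.adj ω₀ T) := by
    rw [HermitianForms.adj, dif_pos hex]
    exact hex.choose_spec
  have hs1 := hadj.1 v.form v.smooth
  have hs := hs1.sub (P' v).smooth
  refine sub_eq_zero.1 (hω.eq_zero_of_L2_self hs ?_)
  rw [hω.L2_sub_right hs hs1 (P' v).smooth, ← hadj.2 _ _ hs v.smooth]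
  exact sub_eq_zero.2 ((congrArg (fun w => L2 ω₀ w v.form) (h hs.toSForm)).trans
    (hP hs.toSForm v))

end Adj

theorem actsAs_lam (hω : IsHermitianMetric ω₀) : ActsAs (Lam ω₀) (lamS hω) :=
  (actsAs_wedgeOp hω.smooth).adj hω (isAdjS_wedgeS hω hω.smooth)

theorem actsAs_tau (hω : IsHermitianMetric ω₀) : ActsAs (tau ω₀) (torS hω Complex.I) :=
  (actsAs_lam hω).gcomm_even (by norm_num) (actsAs_wedgeOp (hω.smooth.dH Complex.I))

theorem actsAs_taubar (hω : IsHermitianMetric ω₀) : ActsAs (taubar ω₀) (torS hω (-Complex.I)) :=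
  fun u => by
    have h := actsAs_tau hω u.smooth.conjForm.toSForm
    change conjForm (tau ω₀ (conjForm u.form)) = torOp (-Complex.I) ω₀ u.form
    change tau ω₀ (conjForm u.form) = torOp Complex.I ω₀ (conjForm u.form) at h
    rw [h, hω.torOp_conjForm, conjForm_conjForm, Complex.conj_I]

/-- The square of the `L²` norm of a smooth form. -/
def nsq (ω₀ : HForm n 2 X) (u : SForm n X) : ℝ := (L2 ω₀ u.form u.form).re

theorem nsq_nonneg (hω : IsHermitianMetric ω₀) (u : SForm n X) : 0 ≤ nsq ω₀ u :=
  (Complex.le_def.1 (hω.L2_self_nonneg u.smooth)).1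

theorem L2_self_eq_nsq (hω : IsHermitianMetric ω₀) (u : SForm n X) :
    L2 ω₀ u.form u.form = (nsq ω₀ u : ℂ) :=
  Complex.ext rfl (Complex.le_def.1 (hω.L2_self_nonneg u.smooth)).2.symm

theorem nsq_smul_add (hω : IsHermitianMetric ω₀) (r : ℝ) (u v : SForm n X) :
    nsq ω₀ ((r : ℂ) • u + v) =
      r ^ 2 * nsq ω₀ u + 2 * r * (L2 ω₀ u.form v.form).re + nsq ω₀ v := by
  have hu := u.smooth
  have hv := v.smooth
  have hru := hu.smul (r : ℂ)
  rw [nsq, SForm.form_add, SForm.form_smul, hω.L2_add_left hru hv (hru.add hv),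
    hω.L2_add_right hru hru hv, hω.L2_add_right hv hru hv, hω.L2_smul_left _ hu hru,
    hω.L2_smul_left _ hu hv, hω.L2_smul_right _ hu hu, hω.L2_smul_right _ hv hu,
    ← hω.L2_conj_symm hu hv, Complex.conj_ofReal]
  simp only [Complex.add_re, Complex.re_ofReal_mul, Complex.conj_re, nsq]
  ring

theorem nsq_add (hω : IsHermitianMetric ω₀) (u v : SForm n X) :
    nsq ω₀ (u + v) = nsq ω₀ u + 2 * (L2 ω₀ u.form v.form).re + nsq ω₀ v := by
  have h := nsq_smul_add hω 1 u v
  rwa [Complex.ofReal_one, one_smul, one_pow, one_mul, mul_one] at h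

theorem nsq_add_le (hω : IsHermitianMetric ω₀) {δ : ℝ} (hδ : 0 < δ) (u v : SForm n X) :
    nsq ω₀ (u + v) ≤ (1 + δ) * nsq ω₀ u + (1 + 1 / δ) * nsq ω₀ v := by
  -- `0 ≤ ‖-δ u + v‖²`
  have h := nsq_nonneg hω (((-δ : ℝ) : ℂ) • u + v)
  rw [nsq_smul_add hω] at h
  rw [nsq_add hω]
  have h2 : 0 ≤ δ * nsq ω₀ u - 2 * (L2 ω₀ u.form v.form).re + 1 / δ * nsq ω₀ v := by
    have e : δ * nsq ω₀ u - 2 * (L2 ω₀ u.form v.form).re + 1 / δ * nsq ω₀ v =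
      1 / δ * ((-δ) ^ 2 * nsq ω₀ u + 2 * -δ * (L2 ω₀ u.form v.form).re + nsq ω₀ v) := by
      field_simp
      ring
    rw [e]
    positivity
  linarith

/-- The quadratic form `‖P u‖² + ‖P^⋆ u‖²` of `P P^⋆ + P^⋆ P`. -/
def energy (ω₀ : HForm n 2 X) (P P' : FormEnd n X) (u : SForm n X) : ℝ :=
  nsq ω₀ (P u) + nsq ω₀ (P' u)

theorem energy_nonneg (hω : IsHermitianMetric ω₀) (P P' : FormEnd n X) (u : SForm n X) :
    0 ≤ energy ω₀ P P' u := add_nonneg (nsq_nonneg hω _) (nsq_nonneg hω _)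

theorem energy_add_le (hω : IsHermitianMetric ω₀) {δ : ℝ} (hδ : 0 < δ) (P P' R R' : FormEnd n X)
    (u : SForm n X) : energy ω₀ (P + R) (P' + R') u ≤
      (1 + δ) * energy ω₀ P P' u + (1 + 1 / δ) * energy ω₀ R R' u := by
  have h1 := nsq_add_le hω hδ (P u) (R u)
  have h2 := nsq_add_le hω hδ (P' u) (R' u)
  simp only [energy, LinearMap.add_apply]
  linarith

theorem L2_anticomm (hω : IsHermitianMetric ω₀) {P P' : FormEnd n X} (h : IsAdjS ω₀ P P')
    (u : SForm n X) : L2 ω₀ ((P * P' + P' * P) u).form u.form = (energy ω₀ P P' u : ℂ) := by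
  have e : ((P * P' + P' * P) u).form = (P (P' u)).form + (P' (P u)).form := rfl
  rw [e, hω.L2_add_left (P (P' u)).smooth (P' (P u)).smooth u.smooth, h (P' u) u,
    h.symm hω (P u) u, L2_self_eq_nsq hω, L2_self_eq_nsq hω, energy, Complex.ofReal_add, add_comm]

/-- `⟪⟪∂̄ u, ∂̄ u⟫⟫ + ⟪⟪∂̄^⋆ u, ∂̄^⋆ u⟫⟫` is at most the same expression for `∂ + τ`, with difference given
by `∂ω ∧ ·`, and conjugately. -/
theorem IsSKT.energy_identity (hω : IsSKT ω₀) {ε : ℂ} (hε : ε = Complex.I ∨ ε = -Complex.I)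
    (u : SForm n X) :
    energy ω₀ (dS (-ε)) (dAdjS hω.1 (-ε)) u +
        energy ω₀ (wedgeS (hω.1.smooth.dH ε)) (adjS hω.1 (hω.1.smooth.dH ε)) u =
      energy ω₀ (dS ε + torS hω.1 ε) (dAdjS hω.1 ε + torAdjS hω.1 ε) u := by
  have hε' : -ε = Complex.I ∨ -ε = -Complex.I := by
    rcases hε with rfl | rfl
    · exact Or.inr rfl
    · exact Or.inl (neg_neg _)
  have h := congrArg (fun P : FormEnd n X => L2 ω₀ (P u).form u.form) (hω.laplacian_identity hε)
  beta_reduce at h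
  rw [L2_anticomm hω.1 ((isAdjS_dS hω.1 hε).add hω.1 (isAdjS_torS hω.1 ε)), LinearMap.add_apply,
    SForm.form_add, hω.1.L2_add_left (SForm.smooth _) (SForm.smooth _) u.smooth,
    L2_anticomm hω.1 (isAdjS_dS hω.1 hε'), L2_anticomm hω.1 (isAdjS_wedgeS hω.1 _)] at h
  exact_mod_cast h

/-- The operator `T` preserves smooth forms and has the real quadratic form `f` there. -/
structure HasQuadForm (ω₀ : HForm n 2 X) (T : Op n X) (f : SForm n X → ℝ) : Prop where
  smooth : ∀ u, IsSmooth u → IsSmooth (T u)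
  value : ∀ u : SForm n X, L2 ω₀ (T u.form) u.form = (f u : ℂ)

section HasQuadForm

variable {T S : Op n X} {f g : SForm n X → ℝ}

theorem HasQuadForm.add (hω : IsHermitianMetric ω₀) (h : HasQuadForm ω₀ T f)
    (h' : HasQuadForm ω₀ S g) : HasQuadForm ω₀ (T + S) (fun u => f u + g u) where
  smooth u hu := (h.smooth u hu).add (h'.smooth u hu)
  value u := by
    rw [Pi.add_apply, hω.L2_add_left (h.smooth _ u.smooth) (h'.smooth _ u.smooth) u.smooth,
      h.value, h'.value, Complex.ofReal_add]

theorem HasQuadForm.sub (hω : IsHermitianMetric ω₀) (h : HasQuadForm ω₀ T f)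
    (h' : HasQuadForm ω₀ S g) : HasQuadForm ω₀ (T - S) (fun u => f u - g u) where
  smooth u hu := (h.smooth u hu).sub (h'.smooth u hu)
  value u := by
    rw [Pi.sub_apply, hω.L2_sub_left (h.smooth _ u.smooth) (h'.smooth _ u.smooth) u.smooth,
      h.value, h'.value, Complex.ofReal_sub]

theorem real_smul_form (r : ℝ) (u : Form n X) : r • u = (r : ℂ) • u := by
  funext k x
  ext m
  exact Complex.real_smul

theorem HasQuadForm.smul (hω : IsHermitianMetric ω₀) (r : ℝ) (h : HasQuadForm ω₀ T f) :
    HasQuadForm ω₀ (r • T) (fun u => r * f u) where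
  smooth u hu := by
    rw [Pi.smul_apply, real_smul_form]
    exact (h.smooth u hu).smul _
  value u := by
    rw [Pi.smul_apply, real_smul_form, hω.L2_smul_left _ (h.smooth _ u.smooth) u.smooth, h.value,
      Complex.ofReal_mul]

theorem HasQuadForm.opLE (h : HasQuadForm ω₀ T f) (h' : HasQuadForm ω₀ S g)
    (hfg : ∀ u, f u ≤ g u) : OpLE ω₀ T S := fun u hu => by
  have h1 := h.value hu.toSForm
  have h2 := h'.value hu.toSForm
  change L2 ω₀ (T u) u = _ at h1
  change L2 ω₀ (S u) u = _ at h2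
  rw [h1, h2]
  exact Complex.real_le_real.2 (hfg _)

theorem hasQuadForm_gcomm (hω : IsHermitianMetric ω₀) {P P' : FormEnd n X} {a b : ℤ}
    (hab : ((-1 : ℝ) ^ (a * b)) = -1) (h : ActsAs T P) (hP : IsAdjS ω₀ P P') :
    HasQuadForm ω₀ (gcomm a b T (adj ω₀ T)) (energy ω₀ P P') where
  smooth _ hu := (h.gcomm_odd hab (h.adj hω hP)).isSmooth hu
  value u := by
    rw [h.gcomm_odd hab (h.adj hω hP) u, L2_anticomm hω hP]

theorem hasQuadForm_id (hω : IsHermitianMetric ω₀) : HasQuadForm ω₀ (id : Op n X) (nsq ω₀) where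
  smooth _ hu := hu
  value u := L2_self_eq_nsq hω u

end HasQuadForm

theorem ActsAs.isBoundedOp (hω : IsHermitianMetric ω₀) {T : Op n X} {P : FormEnd n X}
    {F : X → FibEnd n} (h : ActsAs T P) (hF : BddOn ω₀ F)
    (hP : ∀ u : SForm n X, (P u).form = ptOp F u.form) : IsBoundedOp ω₀ T := by
  obtain ⟨M, -, hM⟩ := hω.L2_le_of_bddOn hF
  refine ⟨M, fun u hu => ?_⟩
  have hs := h.isSmooth hu
  have e : T u = ptOp F u := (h hu.toSForm).trans (hP hu.toSForm)
  rw [e] at hs ⊢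
  exact hM u hu hs

theorem isBoundedOp_Xbar (hω : IsHermitianMetric ω₀) : IsBoundedOp ω₀ (Xbar ω₀) := by
  have hθ := hω.smooth.dH (-Complex.I)
  have h1 := hω.bddOn_wedgeL hθ
  have h2 := hω.bddOn_wedgeAdj hθ
  have hQ := hω.eventually_posDef
  have hact : ActsAs (Xbar ω₀) (wedgeS hθ * adjS hω hθ + adjS hω hθ * wedgeS hθ) := by
    rw [Xbar, delbar_eq]
    exact (actsAs_wedgeOp hθ).gcomm_odd (a := 3) (b := -3) (by norm_num)
      ((actsAs_wedgeOp hθ).adj hω (isAdjS_wedgeS hω hθ))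
  exact hact.isBoundedOp hω (BddFam.add hQ (h1.mul hQ h2) (h2.mul hQ h1)) fun _ => rfl

theorem bddOn_torAt (hω : IsHermitianMetric ω₀) (ε : ℂ) :
    BddOn ω₀ (fun x => torAt (ω₀ x) (dH ε ω₀ x)) := by
  have h1 := hω.bddOn_wedgeL (hω.smooth.dH ε)
  have h2 := hω.bddOn_wedgeAdj hω.smooth
  have hQ := hω.eventually_posDef
  exact (BddFam.mul hQ h2 h1).sub hQ (BddFam.mul hQ h1 h2)

/-- The adjoint of the torsion operator in each fibre. -/
def torAdjAt (ω₀ : HForm n 2 X) (ε : ℂ) (x : X) : FibEnd n :=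
  wedgeAdj (cometric (ω₀ x)) (dH ε ω₀ x) * wedgeL (ω₀ x) -
    wedgeL (ω₀ x) * wedgeAdj (cometric (ω₀ x)) (dH ε ω₀ x)

theorem bddOn_torAdjAt (hω : IsHermitianMetric ω₀) (ε : ℂ) : BddOn ω₀ (torAdjAt ω₀ ε) := by
  have h1 := hω.bddOn_wedgeAdj (hω.smooth.dH ε)
  have h2 := hω.bddOn_wedgeL hω.smooth
  have hQ := hω.eventually_posDef
  exact (BddFam.mul hQ h1 h2).sub hQ (BddFam.mul hQ h2 h1)

theorem isBoundedOp_taubarSq (hω : IsHermitianMetric ω₀) : IsBoundedOp ω₀ (taubarSq ω₀) := by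
  have h1 := bddOn_torAt hω (-Complex.I)
  have h2 := bddOn_torAdjAt hω (-Complex.I)
  have hQ := hω.eventually_posDef
  exact ((actsAs_taubar hω).gcomm_odd (a := 1) (b := -1) (by norm_num)
    ((actsAs_taubar hω).adj hω (isAdjS_torS hω _))).isBoundedOp hω
      (BddFam.add hQ (h1.mul hQ h2) (h2.mul hQ h1)) fun _ => rfl

theorem exists_energy_torS_le (hω : IsHermitianMetric ω₀) (ε : ℂ) :
    ∃ C : ℝ, 0 < C ∧ ∀ u, energy ω₀ (torS hω ε) (torAdjS hω ε) u ≤ C * nsq ω₀ u := by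
  obtain ⟨M, hM0, hM⟩ := hω.L2_le_of_bddOn (bddOn_torAt hω ε)
  obtain ⟨M', hM0', hM'⟩ := hω.L2_le_of_bddOn (bddOn_torAdjAt hω ε)
  refine ⟨M + M', by positivity, fun u => ?_⟩
  have h1 := hM u.form u.smooth (torS hω ε u).smooth
  have h2 := hM' u.form u.smooth (torAdjS hω ε u).smooth
  change L2 ω₀ (torS hω ε u).form (torS hω ε u).form ≤ _ at h1
  change L2 ω₀ (torAdjS hω ε u).form (torAdjS hω ε u).form ≤ _ at h2
  rw [L2_self_eq_nsq hω, L2_self_eq_nsq hω, ← Complex.ofReal_mul, Complex.real_le_real] at h1 h2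
  rw [energy, add_mul]
  exact add_le_add h1 h2

/-- The quadratic form of `Δ_h - h Δ` is `1 - h` times that of `Δ'' - h Δ'`. -/
theorem energy_dh_sub (hω : IsHermitianMetric ω₀) (h : ℝ) (P P' R R' : FormEnd n X)
    (u : SForm n X) :
    energy ω₀ ((h : ℂ) • P + R) ((h : ℂ) • P' + R') u - h * energy ω₀ (P + R) (P' + R') u =
      (1 - h) * (energy ω₀ R R' u - h * energy ω₀ P P' u) := by
  simp only [energy, LinearMap.add_apply, LinearMap.smul_apply, nsq_smul_add hω, nsq_add hω]
  ring

end Comparison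

end
end HermitianForms

theorem lemma7p1 {n : ℕ} {X : Type*} [TopologicalSpace X] [T2Space X] [CompactSpace X]
    [MeasurableSpace X] [BorelSpace X] [ChartedSpace (Cn n) X] [IsManifold 𝓘(ℂ, Cn n) ∞ X]
    (ω₀ : HForm n 2 X) (hω : IsSKT ω₀) :
    -- the formal adjoints that occur below exist
    (HasFormalAdjoint ω₀ delOp ∧ HasFormalAdjoint ω₀ delbarOp ∧ HasFormalAdjoint ω₀ dOp ∧
      (∀ h : ℝ, HasFormalAdjoint ω₀ (dh h)) ∧ HasFormalAdjoint ω₀ (lefschetz ω₀) ∧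
      HasFormalAdjoint ω₀ (tau ω₀) ∧ HasFormalAdjoint ω₀ (taubar ω₀) ∧
      HasFormalAdjoint ω₀ (wedgeOp (delbar ω₀))) ∧
    -- (i)
    (∀ δ : ℝ, 0 < δ →
      OpLE ω₀ (lap' ω₀) ((1 + δ) • lap'' ω₀ + (1 + 1 / δ) • taubarSq ω₀) ∧
      OpLE ω₀ ((1 / (1 + δ)) • lap'' ω₀ - (1 / δ) • tauSq ω₀) (lap' ω₀)) ∧
    -- (ii)
    (∀ h : ℝ, 0 < h → h < 1 →
      OpLE ω₀ (h • lap' ω₀ + (h • Xbar ω₀ - (h / (1 - h)) • taubarSq ω₀)) (lap'' ω₀) ∧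
      OpLE ω₀ (h • ((1 - h) • Xbar ω₀ - taubarSq ω₀)) (lapH ω₀ h - h • lap ω₀)) ∧
    -- boundedness, and the resulting uniform lower bound
    IsBoundedOp ω₀ (Xbar ω₀) ∧ IsBoundedOp ω₀ (taubarSq ω₀) ∧
    (∃ C : ℝ, 0 < C ∧ ∀ h : ℝ, 0 < h → h < 1 →
      OpLE ω₀ ((-(C * h)) • (id : Op n X)) (h • ((1 - h) • Xbar ω₀ - taubarSq ω₀)) ∧
      OpLE ω₀ ((-(C * h)) • (id : Op n X)) (lapH ω₀ h - h • lap ω₀)) := by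
  have hH := hω.1
  have hI : (Complex.I : ℂ) = Complex.I ∨ Complex.I = -Complex.I := Or.inl rfl
  have hJ : -Complex.I = Complex.I ∨ -Complex.I = -Complex.I := Or.inr rfl
  -- the concrete operators on smooth forms, and their adjoints
  have aD := isAdjS_dS hH hI
  have aB := isAdjS_dS hH hJ
  have aT := isAdjS_torS hH Complex.I
  have aU := isAdjS_torS hH (-Complex.I)
  have hθ := hH.smooth.dH (-Complex.I)
  have aW := isAdjS_wedgeS hH hθ
  have cW : ActsAs (wedgeOp (delbar ω₀)) (wedgeS hθ) := by
    rw [delbar_eq]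
    exact actsAs_wedgeOp hθ
  have ah : ∀ h : ℝ, IsAdjS ω₀ ((h : ℂ) • dS Complex.I + dS (-Complex.I))
      ((h : ℂ) • dAdjS hH Complex.I + dAdjS hH (-Complex.I)) := fun h => by
    have := (aD.smul hH (h : ℂ)).add hH aB
    rwa [Complex.conj_ofReal] at this
  have q' : HasQuadForm ω₀ (lap' ω₀) _ :=
    hasQuadForm_gcomm hH (a := 1) (b := -1) (by norm_num) actsAs_delOp aD
  have q'' : HasQuadForm ω₀ (lap'' ω₀) _ :=
    hasQuadForm_gcomm hH (a := 1) (b := -1) (by norm_num) actsAs_delbarOp aB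
  have qd : HasQuadForm ω₀ (lap ω₀) _ :=
    hasQuadForm_gcomm hH (a := 1) (b := -1) (by norm_num) actsAs_dOp (aD.add hH aB)
  have qh : ∀ h : ℝ, HasQuadForm ω₀ (lapH ω₀ h) _ := fun h =>
    hasQuadForm_gcomm hH (a := 1) (b := -1) (by norm_num) (actsAs_dh h) (ah h)
  have qT : HasQuadForm ω₀ (tauSq ω₀) _ :=
    hasQuadForm_gcomm hH (a := 1) (b := -1) (by norm_num) (actsAs_tau hH) aT
  have qU : HasQuadForm ω₀ (taubarSq ω₀) _ :=
    hasQuadForm_gcomm hH (a := 1) (b := -1) (by norm_num) (actsAs_taubar hH) aU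
  have qX : HasQuadForm ω₀ (Xbar ω₀) _ :=
    hasQuadForm_gcomm hH (a := 3) (b := -3) (by norm_num) cW aW
  have id1 := fun u => hω.energy_identity hI u
  have id2 := fun u => hω.energy_identity hJ u
  simp only [neg_neg] at id2
  -- the first inequality of (ii), for the quadratic forms; it is (i) with `δ = (1 - h) / h`
  have key : ∀ h : ℝ, 0 < h → h < 1 → ∀ u,
      h * energy ω₀ (dS Complex.I) (dAdjS hH Complex.I) u +
        (h * energy ω₀ (wedgeS hθ) (adjS hH hθ) u -
          h / (1 - h) * energy ω₀ (torS hH (-Complex.I)) (torAdjS hH (-Complex.I)) u) ≤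
        energy ω₀ (dS (-Complex.I)) (dAdjS hH (-Complex.I)) u := fun h h0 h1 u => by
    have h1' : 0 < 1 - h := sub_pos.2 h1
    have hle := energy_add_le hH (div_pos h1' h0) (dS (-Complex.I)) (dAdjS hH (-Complex.I))
      (torS hH (-Complex.I)) (torAdjS hH (-Complex.I)) u
    rw [← id2 u, show 1 + (1 - h) / h = 1 / h by field_simp; ring,
      show 1 + 1 / ((1 - h) / h) = 1 / (1 - h) by field_simp; ring] at hle
    have hle2 := mul_le_mul_of_nonneg_left hle h0.le
    rw [mul_add, mul_add, ← mul_assoc, mul_one_div_cancel h0.ne', one_mul, ← mul_assoc,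
      mul_one_div] at hle2
    linarith
  have key2 : ∀ h : ℝ, 0 < h → h < 1 → ∀ u,
      h * ((1 - h) * energy ω₀ (wedgeS hθ) (adjS hH hθ) u -
        energy ω₀ (torS hH (-Complex.I)) (torAdjS hH (-Complex.I)) u) ≤
      energy ω₀ ((h : ℂ) • dS Complex.I + dS (-Complex.I))
          ((h : ℂ) • dAdjS hH Complex.I + dAdjS hH (-Complex.I)) u -
        h * energy ω₀ (dS Complex.I + dS (-Complex.I))
          (dAdjS hH Complex.I + dAdjS hH (-Complex.I)) u := fun h h0 h1 u => by
    have h1' : 0 < 1 - h := sub_pos.2 h1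
    rw [energy_dh_sub hH]
    have hk := mul_le_mul_of_nonneg_left (sub_nonneg.2 (key h h0 h1 u)) h1'.le
    have e : (1 - h) * (h / (1 - h) *
        energy ω₀ (torS hH (-Complex.I)) (torAdjS hH (-Complex.I)) u) =
        h * energy ω₀ (torS hH (-Complex.I)) (torAdjS hH (-Complex.I)) u := by
      rw [← mul_assoc, mul_div_cancel₀ _ h1'.ne']
    simp only [mul_sub, mul_add] at hk e ⊢
    linarith
  obtain ⟨C, hC0, hC⟩ := exists_energy_torS_le hH (-Complex.I)
  have low : ∀ h : ℝ, 0 < h → h < 1 → ∀ u, -(C * h) * nsq ω₀ u ≤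
      h * ((1 - h) * energy ω₀ (wedgeS hθ) (adjS hH hθ) u -
        energy ω₀ (torS hH (-Complex.I)) (torAdjS hH (-Complex.I)) u) := fun h h0 h1 u => by
    have e1 := mul_nonneg (sub_pos.2 h1).le (energy_nonneg hH (wedgeS hθ) (adjS hH hθ) u)
    have e2 := mul_le_mul_of_nonneg_left (add_le_add e1 (neg_le_neg (hC u))) h0.le
    linarith
  refine ⟨⟨actsAs_delOp.hasFormalAdjoint aD, actsAs_delbarOp.hasFormalAdjoint aB,
    actsAs_dOp.hasFormalAdjoint (aD.add hH aB), fun h => (actsAs_dh h).hasFormalAdjoint (ah h),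
    (actsAs_wedgeOp hH.smooth).hasFormalAdjoint (isAdjS_wedgeS hH hH.smooth),
    (actsAs_tau hH).hasFormalAdjoint aT, (actsAs_taubar hH).hasFormalAdjoint aU,
    cW.hasFormalAdjoint aW⟩, fun δ hδ => ⟨?_, ?_⟩, fun h h0 h1 => ⟨?_, ?_⟩,
    isBoundedOp_Xbar hH, isBoundedOp_taubarSq hH, C, hC0, fun h h0 h1 => ⟨?_, ?_⟩⟩
  · refine q'.opLE ((q''.smul hH (1 + δ)).add hH (qU.smul hH (1 + 1 / δ))) fun u => ?_
    have hle := energy_add_le hH hδ (dS (-Complex.I)) (dAdjS hH (-Complex.I))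
      (torS hH (-Complex.I)) (torAdjS hH (-Complex.I)) u
    rw [← id2 u] at hle
    linarith [energy_nonneg hH (wedgeS hθ) (adjS hH hθ) u]
  · refine ((q''.smul hH (1 / (1 + δ))).sub hH (qT.smul hH (1 / δ))).opLE q' fun u => ?_
    have hle := energy_add_le hH hδ (dS Complex.I) (dAdjS hH Complex.I)
      (torS hH Complex.I) (torAdjS hH Complex.I) u
    rw [← id1 u] at hle
    have hn := energy_nonneg hH (wedgeS (hH.smooth.dH Complex.I))
      (adjS hH (hH.smooth.dH Complex.I)) u
    have hδ' : 0 < 1 + δ := by linarith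
    rw [tsub_le_iff_right, one_div_mul_eq_div, div_le_iff₀ hδ']
    have e : 1 / δ * energy ω₀ (torS hH Complex.I) (torAdjS hH Complex.I) u * (1 + δ) =
        (1 + 1 / δ) * energy ω₀ (torS hH Complex.I) (torAdjS hH Complex.I) u := by
      field_simp
      ring
    rw [add_mul, e]
    linarith
  · exact ((q'.smul hH h).add hH ((qX.smul hH h).sub hH (qU.smul hH (h / (1 - h))))).opLE q''
      (key h h0 h1)
  · exact (((qX.smul hH (1 - h)).sub hH qU).smul hH h).opLE ((qh h).sub hH (qd.smul hH h))
      (key2 h h0 h1)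
  · exact ((hasQuadForm_id hH).smul hH (-(C * h))).opLE
      (((qX.smul hH (1 - h)).sub hH qU).smul hH h) (low h h0 h1)
  · exact ((hasQuadForm_id hH).smul hH (-(C * h))).opLE ((qh h).sub hH (qd.smul hH h))
      fun u => (low h h0 h1 u).trans (key2 h h0 h1 u)
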